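/- Let $d\in\mathbb N$, $1<p<\alpha<2$, $\nu,\gamma>0$, and put $$B_{p,\alpha}=\frac{2^\alpha\,\Gamma(\frac{d+p}{2})\,\Gamma(\frac{\alpha-p}{2})}{|\Gamma(-\frac p2)|\;\Gamma(\frac{d+p-\alpha}{2})},\qquad C_{p,\alpha}=\nu p-\gamma^\alpha B_{p,\alpha}.$$ Assume $\nu p>\gamma^\alpha B_{p,\alpha}$. Let $\mathcal E\in C(\mathbb R^d)$ and let $x^\star\in\mathbb R^d$ satisfy $\mathcal E(x^\star)=\min\mathcal E=:\underline{\mathcal E}$. Assume that there are $\mathcal E_\infty,R_0,\zeta,\mu>0$ with $|x-x^\star|\le(\mathcal E(x)-\underline{\mathcal E})^\mu/\zeta$ for all $x\in B_{R_0}(x^\star)$ and $\mathcal E(x)-\underline{\mathcal E}>\mathcal E_\infty$ for all $x\notin B_{R_0}(x^\star)$. For a probability measure $\rho$ on $\mathbb R^d$ and $\beta>0$ let $$\bar x_{\mathcal E}^\beta(\rho)=\frac{\int x\,e^{-\beta\mathcal E(x)}\,d\rho(x)}{\int e^{-\beta\mathcal E(x)}\,d\rho(x)},\qquad V_p(\rho)=\int|x-x^\star|^p\,d\rho(x).$$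 A weak solution on $[0,T]$, with parameter $\beta$ and initial datum $f_0$, of the fractional Fokker–Planck equation $$\partial_t f=-\nabla\cdot\big(\nu(\bar x_{\mathcal E}-x)f\big)-\gamma^\alpha(-\Delta)^{\alpha/2}\big(|\bar x_{\mathcal E}-x|^\alpha f\big)$$ is a family $(f_t)_{t\in[0,T]}$ of probability measures with $f_{t}=f_0$ at $t=0$, with finite $p$-th moments and $t\mapsto V_p(t):=V_p(f_t)$ continuous, such that for all $\varphi\in C_c^\infty(\mathbb R^d)$ and $t\in[0,T]$, with $\bar x_{\mathcal E}(t)=\bar x^\beta_{\mathcal E}(f_t)$, $$\frac{d}{dt}\int\varphi\,df_t=\nu\int\nabla\varphi\cdot(\bar x_{\mathcal E}(t)-x)\,df_t-\gamma^\alpha\int|\bar x_{\mathcal E}(t)-x|^\alpha\,(-\Delta)^{\alpha/2}\varphi\,df_t ,$$ where $(-\Delta)^{\alpha/2}\varphi=\mathcal F^{-1}(|\xi|^\alpha\mathcal F\varphi)$. **Theorem.** Let $f_0$ be a probability measure with finite $p$-th moment and $x^\star\in\operatorname{supp}f_0$. Let $\varepsilon\in(0,V_p(f_0))$, $\theta\in(0,1)$,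 and $$T_\star=\frac{1}{C_{p,\alpha}(1-\theta)}\log\frac{V_p(f_0)}{\varepsilon}.$$ For every $r>0$ let $m_0(r)>0$ and $P(r)>0$ be given. Then there is $\beta_0>0$ such that the following holds for every $\beta>\beta_0$ and every weak solution $(f_t)$ on $[0,T_\star]$ with parameter $\beta$ and initial datum $f_0$ that satisfies $$f_t(B_r(x^\star))\ge m_0(r)\,e^{-P(r)t}\qquad\text{for all } r>0,\ t\in[0,T_\star].$$ There is $$T\in\Big[\tfrac{1-\theta}{1+\theta/2}\,T_\star,\;T_\star\Big]\qquad\text{with}\qquad V_p(T)=\varepsilon,$$ one has $W_p^p(f_t,\delta_{x^\star})=V_p(t)$ on $[0,T]$, and, provided that $\int|x-x^\star|^{p-\alpha}\,df_0(x)<\infty$ (for example, if $f_0$ has a bounded density), $$V_p(t)\le V_p(0)\,\exp\big(-(1-\theta)\,C_{p,\alpha}\,t\big)\qquad\text{for all } t\in[0,T].$$ -/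

import Mathlib

open MeasureTheory Set
open scoped ENNReal ContDiff FourierTransform

noncomputable section

namespace FracCBO

/-- The constant with `(-Δ)^{α/2} |x|^p = - B_{p,α} |x|^{p-α}` on `ℝ^d`, for `1 < p < α < 2`. -/
def Bconst (d : ℕ) (p α : ℝ) : ℝ :=
  2 ^ α * Real.Gamma ((d + p) / 2) * Real.Gamma ((α - p) / 2) /
    (|Real.Gamma (-p / 2)| * Real.Gamma ((d + p - α) / 2))

/-- The rate `C_{p,α} = ν p - γ^α B_{p,α}`. -/
def Cconst (d : ℕ) (p α ν γ : ℝ) : ℝ := ν * p - γ ^ α * Bconst d p α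

variable {d : ℕ}

/-- `xs` is a global minimizer of `𝓔`, near which `𝓔` grows at least like a power of the distance
to `xs`, and away from which `𝓔` exceeds its minimum by more than a fixed positive amount. -/
def GrowthAssumption (𝓔 : EuclideanSpace ℝ (Fin d) → ℝ) (xs : EuclideanSpace ℝ (Fin d)) : Prop :=
  (∀ x, 𝓔 xs ≤ 𝓔 x) ∧
    ∃ 𝓔inf R₀ ζ μ : ℝ, 0 < 𝓔inf ∧ 0 < R₀ ∧ 0 < ζ ∧ 0 < μ ∧
      (∀ x ∈ Metric.ball xs R₀, ‖x - xs‖ ≤ (𝓔 x - 𝓔 xs) ^ μ / ζ) ∧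
      (∀ x ∈ (Metric.ball xs R₀)ᶜ, 𝓔inf < 𝓔 x - 𝓔 xs)

/-- The consensus point `∫ x e^{-β 𝓔(x)} dρ / ∫ e^{-β 𝓔(x)} dρ`. -/
def consensusPoint (𝓔 : EuclideanSpace ℝ (Fin d) → ℝ) (β : ℝ)
    (ρ : Measure (EuclideanSpace ℝ (Fin d))) : EuclideanSpace ℝ (Fin d) :=
  (∫ x, Real.exp (-β * 𝓔 x) ∂ρ)⁻¹ • ∫ x, Real.exp (-β * 𝓔 x) • x ∂ρ

/-- The fractional Laplacian `(-Δ)^{α/2} φ = 𝓕⁻¹ (|ξ|^α 𝓕 φ)` of a real-valued test function.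
Mathlib's `𝓕` has the kernel `e^{-2πi⟨x,ξ⟩}`, so the symbol `|ξ|^α` of the convention
`e^{-i⟨x,ξ⟩}` becomes `(2π|ξ|)^α`. The value is real since the symbol is real and even. -/
def fracLaplacian (α : ℝ) (φ : EuclideanSpace ℝ (Fin d) → ℝ) (x : EuclideanSpace ℝ (Fin d)) : ℝ :=
  (𝓕⁻ (fun ξ : EuclideanSpace ℝ (Fin d) =>
    (((2 * Real.pi * ‖ξ‖) ^ α : ℝ) : ℂ) *
      𝓕 (fun y : EuclideanSpace ℝ (Fin d) => (φ y : ℂ)) ξ) x).re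

/-- The `p`-th moment `V_p = ∫ |x - xs|^p dρ(x)`. -/
def Vmoment (p : ℝ) (xs : EuclideanSpace ℝ (Fin d))
    (ρ : Measure (EuclideanSpace ℝ (Fin d))) : ℝ :=
  ∫ x, ‖x - xs‖ ^ p ∂ρ

/-- The set of transport plans between `ρ₁` and `ρ₂`. -/
def transportPlans (ρ₁ ρ₂ : Measure (EuclideanSpace ℝ (Fin d))) :
    Set (Measure (EuclideanSpace ℝ (Fin d) × EuclideanSpace ℝ (Fin d))) :=
  {π | IsProbabilityMeasure π ∧ π.map Prod.fst = ρ₁ ∧ π.map Prod.snd = ρ₂}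

/-- The Wasserstein distance `W_p`, with values in `[0, ∞]`. -/
def wassersteinDist (p : ℝ) (ρ₁ ρ₂ : Measure (EuclideanSpace ℝ (Fin d))) : ℝ≥0∞ :=
  ⨅ π ∈ transportPlans ρ₁ ρ₂, (∫⁻ z, edist z.1 z.2 ^ p ∂π) ^ (1 / p)

/-- `f` is, on the time interval `[0, T]`, a weak solution with finite `p`-th moment, depending
continuously on time, of
`∂ₜ f = - ∇ ⬝ (ν (x̄ - x) f) - γ^α (-Δ)^{α/2} (|x̄ - x|^α f)`, `f(0) = f₀`,
where `x̄ = x̄(t)` is the consensus point of `f t`. Continuity of `t ↦ f t` against test functions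
is contained in `weak`. -/
structure IsWeakSolution (𝓔 : EuclideanSpace ℝ (Fin d) → ℝ) (xs : EuclideanSpace ℝ (Fin d))
    (p α ν γ β T : ℝ) (f₀ : Measure (EuclideanSpace ℝ (Fin d)))
    (f : ℝ → Measure (EuclideanSpace ℝ (Fin d))) : Prop where
  prob : ∀ t ∈ Icc 0 T, IsProbabilityMeasure (f t)
  initial : f 0 = f₀
  moment : ∀ t ∈ Icc 0 T, Integrable (fun x => ‖x - xs‖ ^ p) (f t)
  moment_cont : ContinuousOn (fun t => Vmoment p xs (f t)) (Icc 0 T)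
  weak : ∀ φ : EuclideanSpace ℝ (Fin d) → ℝ, ContDiff ℝ ∞ φ → HasCompactSupport φ →
    ∀ t ∈ Icc 0 T,
      HasDerivWithinAt (fun s => ∫ x, φ x ∂(f s))
        (ν * ∫ x, fderiv ℝ φ x (consensusPoint 𝓔 β (f t) - x) ∂(f t)
          - γ ^ α * ∫ x, ‖consensusPoint 𝓔 β (f t) - x‖ ^ α * fracLaplacian α φ x ∂(f t))
        (Icc 0 T) t

/-- The time horizon `T_* = log (V_p(0) / ε) / (C_{p,α} (1 - θ))`. -/
def Tstar (p α ν γ ε θ : ℝ) (xs : EuclideanSpace ℝ (Fin d))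
    (f₀ : Measure (EuclideanSpace ℝ (Fin d))) : ℝ :=
  1 / (Cconst d p α ν γ * (1 - θ)) * Real.log (Vmoment p xs f₀ / ε)

end FracCBO

end

/-! In coordinates centred at `xs`, with `w` the displacement of the consensus point, the equation
has the generator `L_w φ(z) = ν ∇φ(z)⬝(w - z) - γ^α |w - z|^α (-Δ)^{α/2} φ(z)`. For `w = 0` both
parts are homogeneous of degree zero: `z⬝∇|z|^p = p |z|^p` and `(-Δ)^{α/2} |z|^p = -B |z|^(p-α)`, so
`L_0 |z|^p = -C |z|^p`. If the consensus point sat at the minimizer, `V` would therefore decay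
exactly like `V(0) e^{-Ct}`. By the Laplace principle (`exists_consensusPoint_close`) large `β`
makes `w` as small as desired, uniformly over measures with bounded moment and prescribed mass near
`xs`. A continuity argument then keeps `V` within any `σ > 0` of `V(0) e^{-Ct}` on the whole horizon
(`exists_forall_abs_Vmoment_sub_le`). This curve lies strictly above `ε` at the left end of the
interval for `T` and strictly below it at `T_*`, and the intermediate value theorem gives `T`.

Two difficulties remain. The first is that `|z|^p` is no test function, and that `L_w |z|^p`
contains `|w|^α |z|^(p-α)`, a negative moment of `f t` about which nothing is assumed. So `|z|^p` is
cut off at radius of order `1/a` and at radius of order `1/b`. The truncated power is a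
superposition of dilations of a single test function, supported in an annulus
(`powBump_eq_integral`). Hence all estimates for its fractional Laplacian are uniform in `a` and
`b`, and the missing dilations account for the error (`exists_bound_fracLaplacian_powBump_add`). The
constant `B` is identified by integrating against a Gaussian. The outer cutoff disappears through
uniform integrability in time, and the inner one leaves the regularized negative moment `regMoment`,
which never exceeds `b^(α-p)`.

The second difficulty is the exponential bound near `t = 0`. There the margin `V(0) (e^{-(1-θ)Ct} -
e^{-Ct})` is of order `t`, and a uniform error `σ` is useless. If the initial negative moment is
finite, `regMoment` stays bounded up to time `t` for `b` of order `t^(-1/α)`, and with this scale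
all errors are at most a small multiple of `t` (`exists_Vmoment_le_of_small_time`). After a fixed
positive time the margin is bounded below, and a small `σ` suffices (`mul_exp_add_le`). -/

namespace FracCBO

noncomputable section

open Filter Topology Real

variable {d : ℕ}

local notation "𝔼" => EuclideanSpace ℝ (Fin d)


/-! ### Fourier transforms of test functions -/

theorem integrable_pow_mul_fourier {φ : 𝔼 → ℝ} (hφ : ContDiff ℝ ∞ φ) (hc : HasCompactSupport φ)
    (k : ℕ) : Integrable (fun ξ : 𝔼 => ‖ξ‖ ^ k * ‖𝓕 (fun y : 𝔼 => (φ y : ℂ)) ξ‖) := by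
  have h1 : ContDiff ℝ ∞ (fun y : 𝔼 => (φ y : ℂ)) := Complex.ofRealCLM.contDiff.comp hφ
  have h2 : HasCompactSupport (fun y : 𝔼 => (φ y : ℂ)) :=
    hc.comp_left (g := fun r : ℝ => (r : ℂ)) Complex.ofReal_zero
  exact (𝓕 (h2.toSchwartzMap h1)).integrable_pow_mul volume k

theorem continuous_fourier_of_test {φ : 𝔼 → ℝ} (hφ : ContDiff ℝ ∞ φ) (hc : HasCompactSupport φ) :
    Continuous (𝓕 (fun y : 𝔼 => (φ y : ℂ))) := by
  have h1 : ContDiff ℝ ∞ (fun y : 𝔼 => (φ y : ℂ)) := Complex.ofRealCLM.contDiff.comp hφ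
  have h2 : HasCompactSupport (fun y : 𝔼 => (φ y : ℂ)) :=
    hc.comp_left (g := fun r : ℝ => (r : ℂ)) Complex.ofReal_zero
  exact (𝓕 (h2.toSchwartzMap h1)).continuous

theorem integrable_fourier_of_test {φ : 𝔼 → ℝ} (hφ : ContDiff ℝ ∞ φ)
    (hc : HasCompactSupport φ) : Integrable (𝓕 (fun y : 𝔼 => (φ y : ℂ))) := by
  have := integrable_pow_mul_fourier hφ hc 0
  simp only [pow_zero, one_mul] at this
  exact (integrable_norm_iff (continuous_fourier_of_test hφ hc).aestronglyMeasurable).1 this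

theorem integrable_test {φ : 𝔼 → ℝ} (hφ : ContDiff ℝ ∞ φ) (hc : HasCompactSupport φ) :
    Integrable (fun y : 𝔼 => (φ y : ℂ)) :=
  (hφ.continuous.integrable_of_hasCompactSupport hc).ofReal

theorem fourierInv_fourier_test {φ : 𝔼 → ℝ} (hφ : ContDiff ℝ ∞ φ) (hc : HasCompactSupport φ)
    (x : 𝔼) : 𝓕⁻ (𝓕 (fun y : 𝔼 => (φ y : ℂ))) x = φ x := by
  have := Continuous.fourierInv_fourier_eq (f := fun y : 𝔼 => (φ y : ℂ))
    (Complex.continuous_ofReal.comp hφ.continuous) (integrable_test hφ hc)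
    (integrable_fourier_of_test hφ hc)
  exact congrFun this x

theorem rpow_le_one_add_sq {r q : ℝ} (hr : 0 ≤ r) (hq : 0 ≤ q) (hq2 : q ≤ 2) :
    r ^ q ≤ 1 + r ^ 2 := by
  rcases le_total r 1 with h | h
  · have := rpow_le_one hr h hq
    nlinarith [sq_nonneg r]
  · have := rpow_le_rpow_of_exponent_le h hq2
    rw [rpow_two] at this
    linarith

theorem integrable_rpow_mul_fourier {φ : 𝔼 → ℝ} (hφ : ContDiff ℝ ∞ φ)
    (hc : HasCompactSupport φ) {q : ℝ} (hq : 0 ≤ q) (hq2 : q ≤ 2) :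
    Integrable (fun ξ : 𝔼 => ((‖ξ‖ ^ q : ℝ) : ℂ) * 𝓕 (fun y : 𝔼 => (φ y : ℂ)) ξ) := by
  have h0 := integrable_pow_mul_fourier hφ hc 0
  have h2 := integrable_pow_mul_fourier hφ hc 2
  refine Integrable.mono' (h0.add h2) ?_ (ae_of_all _ fun ξ => ?_)
  · have := (continuous_fourier_of_test hφ hc)
    have h3 : Continuous (fun ξ : 𝔼 => ‖ξ‖ ^ q) := continuous_norm.rpow_const fun _ => Or.inr hq
    exact ((Complex.continuous_ofReal.comp h3).mul this).aestronglyMeasurable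
  · rw [norm_mul, Complex.norm_real, norm_of_nonneg (by positivity)]
    simp only [Pi.add_apply, pow_zero]
    rw [← add_mul]
    gcongr
    exact rpow_le_one_add_sq (norm_nonneg _) hq hq2

/-! ### The Gaussian, its self-duality, and Gaussian averages of inverse transforms -/

/-- The Gaussian `exp (-π |x|^2)`. -/
def gauss (x : 𝔼) : ℝ := Real.exp (-π * ‖x‖ ^ 2)

theorem gauss_pos (x : 𝔼) : 0 < gauss x := Real.exp_pos _

theorem gauss_le_one (x : 𝔼) : gauss x ≤ 1 := by
  rw [gauss, Real.exp_le_one_iff]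
  have := Real.pi_pos
  nlinarith [sq_nonneg ‖x‖]

theorem continuous_gauss : Continuous (gauss : 𝔼 → ℝ) := by
  unfold gauss; fun_prop

theorem integrable_gauss : Integrable (gauss : 𝔼 → ℝ) := by
  have := GaussianFourier.integrable_cexp_neg_mul_sq_norm_add (V := 𝔼) (b := (π : ℂ))
    (by simpa using Real.pi_pos) 0 0
  refine (integrable_norm_iff ?_).2 this |>.congr (ae_of_all _ fun x => ?_)
  · exact this.aestronglyMeasurable
  · simp only [inner_zero_left, Complex.ofReal_zero, mul_zero, add_zero, gauss]
    rw [Complex.norm_exp]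
    congr 1
    have : (-(π : ℂ) * (‖x‖ : ℂ) ^ 2) = ((-π * ‖x‖ ^ 2 : ℝ) : ℂ) := by push_cast; ring
    rw [this, Complex.ofReal_re]

theorem integral_exp_inner_gauss (ξ : 𝔼) :
    ∫ y : 𝔼, Complex.exp (((2 * π * inner ℝ ξ y : ℝ) : ℂ) * Complex.I) * (gauss y : ℂ)
      = gauss ξ := by
  have h := fourier_gaussian_innerProductSpace (V := 𝔼) (b := (π : ℂ))
    (by simpa using Real.pi_pos) (-ξ)
  rw [Real.fourier_eq'] at h
  rw [div_self (by exact_mod_cast Real.pi_ne_zero), Complex.one_cpow, one_mul, norm_neg] at h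
  have e : (gauss ξ : ℂ) = Complex.exp (-(π : ℂ) ^ 2 * (‖ξ‖ : ℂ) ^ 2 / π) := by
    rw [gauss]; push_cast; congr 1
    have : (π : ℂ) ≠ 0 := by exact_mod_cast Real.pi_ne_zero
    field_simp
  rw [e, ← h]
  congr 1; ext y
  rw [smul_eq_mul]
  congr 1
  · congr 2; rw [inner_neg_right, real_inner_comm]; push_cast; ring
  · rw [gauss]; push_cast; congr 1

theorem integral_gauss : ∫ y : 𝔼, gauss y = 1 := by
  have := integral_exp_inner_gauss (0 : 𝔼)
  simp only [inner_zero_left, mul_zero, Complex.ofReal_zero, zero_mul, Complex.exp_zero,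
    one_mul] at this
  rw [integral_complex_ofReal] at this
  have h2 : gauss (0 : 𝔼) = 1 := by simp [gauss]
  rw [h2] at this
  exact_mod_cast this

/-- Fubini together with the fact that the Gaussian is its own Fourier transform: averaging over
Gaussian noise of size `u` acts on the frequency side as multiplication by `gauss (u • ξ)`. -/
theorem integral_gauss_mul_fourierInv {h : 𝔼 → ℂ} (hh : Integrable h) (x : 𝔼) (u : ℝ) :
    ∫ y, (gauss y : ℂ) * 𝓕⁻ h (x + u • y) =
      ∫ ξ, (gauss (u • ξ) : ℂ) * (Complex.exp (((2 * π * inner ℝ ξ x : ℝ) : ℂ) * Complex.I) * h ξ) := by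
  have key : ∀ y ξ : 𝔼, (gauss y : ℂ) *
      (Complex.exp (((2 * π * inner ℝ ξ (x + u • y) : ℝ) : ℂ) * Complex.I) • h ξ) =
      (Complex.exp (((2 * π * inner ℝ ξ x : ℝ) : ℂ) * Complex.I) * h ξ) *
      (Complex.exp (((2 * π * inner ℝ (u • ξ) y : ℝ) : ℂ) * Complex.I) * gauss y) := by
    intro y ξ
    rw [inner_add_right, inner_smul_right, inner_smul_left, mul_add, Complex.ofReal_add, add_mul,
      Complex.exp_add, smul_eq_mul]
    simp only [conj_trivial]
    ring
  simp_rw [Real.fourierInv_eq', ← integral_const_mul, key]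
  rw [integral_integral_swap]
  · simp_rw [integral_const_mul, integral_exp_inner_gauss]
    congr 1; ext ξ; ring
  · have hg : Integrable (fun p : 𝔼 × 𝔼 => (gauss p.1 : ℂ) * h p.2) (volume.prod volume) :=
      integrable_gauss.ofReal.mul_prod hh
    have hc : Continuous (fun p : 𝔼 × 𝔼 =>
        Complex.exp (((2 * π * inner ℝ p.2 x : ℝ) : ℂ) * Complex.I) *
        Complex.exp (((2 * π * inner ℝ (u • p.2) p.1 : ℝ) : ℂ) * Complex.I)) := by fun_prop
    have := hg.bdd_mul (c := 1) hc.aestronglyMeasurable (ae_of_all _ fun p => by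
      rw [norm_mul, Complex.norm_exp_ofReal_mul_I, Complex.norm_exp_ofReal_mul_I, one_mul])
    refine this.congr (ae_of_all _ fun p => ?_)
    simp only [Function.uncurry]
    ring


/-! ### Power integrals on the half-line -/

theorem integrableOn_Ioi_of_power_bounds {f : ℝ → ℝ} {A B a b : ℝ} (ha : -1 < a) (hb : b < -1)
    (hf : AEStronglyMeasurable f (volume.restrict (Ioi 0)))
    (h1 : ∀ v, 0 < v → v ≤ 1 → |f v| ≤ A * v ^ a) (h2 : ∀ v, 1 < v → |f v| ≤ B * v ^ b) :
    IntegrableOn f (Ioi 0) := by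
  rw [← Ioc_union_Ioi_eq_Ioi zero_le_one]
  refine IntegrableOn.union ?_ ?_
  · have : IntegrableOn (fun v : ℝ => A * v ^ a) (Ioc 0 1) :=
      ((intervalIntegrable_iff_integrableOn_Ioc_of_le zero_le_one).1
        (intervalIntegral.intervalIntegrable_rpow' ha)).const_mul A
    refine Integrable.mono' this (hf.mono_measure (Measure.restrict_mono Ioc_subset_Ioi_self le_rfl)) ?_
    filter_upwards [ae_restrict_mem measurableSet_Ioc] with v hv
    exact h1 v hv.1 hv.2
  · have : IntegrableOn (fun v : ℝ => B * v ^ b) (Ioi 1) :=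
      (integrableOn_Ioi_rpow_of_lt hb zero_lt_one).const_mul B
    refine Integrable.mono' this
      (hf.mono_measure (Measure.restrict_mono (Ioi_subset_Ioi zero_le_one) le_rfl)) ?_
    filter_upwards [ae_restrict_mem measurableSet_Ioi] with v hv
    exact h2 v hv

/-- This change of variables is the source of all homogeneity: integrating a function of `v * r`
against a power of `v` always yields a power of `r`. -/
theorem integral_Ioi_rpow_mul_comp_mul (F : ℝ → ℝ) (e : ℝ) {r : ℝ} (hr : 0 < r) :
    ∫ v in Ioi (0 : ℝ), v ^ e * F (r * v) = r ^ (-e - 1) * ∫ v in Ioi (0 : ℝ), v ^ e * F v := by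
  have h := integral_comp_mul_left_Ioi (fun v => v ^ e * F v) 0 hr
  rw [mul_zero, smul_eq_mul] at h
  have h2 : ∫ v in Ioi (0 : ℝ), (r * v) ^ e * F (r * v) =
      r ^ e * ∫ v in Ioi (0 : ℝ), v ^ e * F (r * v) := by
    rw [← integral_const_mul]
    refine setIntegral_congr_fun measurableSet_Ioi fun v hv => ?_
    rw [mul_rpow hr.le (le_of_lt hv)]; ring
  rw [h2] at h
  have h3 : r ^ (-e - 1) = (r ^ e)⁻¹ * r⁻¹ := by
    rw [sub_eq_add_neg, rpow_add hr, rpow_neg hr.le, rpow_neg_one]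
  rw [h3, mul_assoc, ← h, ← mul_assoc, inv_mul_cancel₀ (rpow_pos_of_pos hr e).ne', one_mul]

theorem integrableOn_Ioi_rpow_mul_comp_mul {F : ℝ → ℝ} {e : ℝ}
    (hF : IntegrableOn (fun v => v ^ e * F v) (Ioi 0)) {r : ℝ} (hr : 0 < r) :
    IntegrableOn (fun v => v ^ e * F (r * v)) (Ioi 0) := by
  have h := (integrableOn_Ioi_comp_mul_left_iff (fun v => v ^ e * F v) 0 hr).2
    (by rwa [mul_zero])
  refine (h.const_mul ((r ^ e)⁻¹)).congr ?_
  filter_upwards [ae_restrict_mem measurableSet_Ioi] with v hv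
  rw [mul_rpow hr.le (le_of_lt hv), ← mul_assoc, ← mul_assoc,
    inv_mul_cancel₀ (rpow_pos_of_pos hr e).ne', one_mul]

/-- The constant with `∫₀^∞ (1 - exp (-π r² v²)) v^(-q-1) dv = heatConst q * r^q`. -/
def heatConst (q : ℝ) : ℝ := ∫ v in Ioi (0 : ℝ), v ^ (-q - 1) * (1 - Real.exp (-π * v ^ 2))

theorem integrableOn_heatConst {q : ℝ} (hq : 0 < q) (hq2 : q < 2) :
    IntegrableOn (fun v : ℝ => v ^ (-q - 1) * (1 - Real.exp (-π * v ^ 2))) (Ioi 0) := by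
  have hpi := Real.pi_pos
  have h01 : ∀ v : ℝ, 0 ≤ 1 - Real.exp (-π * v ^ 2) := fun v => by
    rw [sub_nonneg, Real.exp_le_one_iff]; nlinarith [sq_nonneg v]
  refine integrableOn_Ioi_of_power_bounds (A := π) (B := 1) (a := 1 - q) (b := -q - 1)
    (by linarith) (by linarith) (by
      apply Measurable.aestronglyMeasurable
      fun_prop) ?_ ?_
  · intro v hv _
    rw [abs_of_nonneg (mul_nonneg (rpow_nonneg hv.le _) (h01 v))]
    have h1 : 1 - Real.exp (-π * v ^ 2) ≤ π * v ^ 2 := by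
      have := Real.add_one_le_exp (-π * v ^ 2); linarith
    have h2 : v ^ (1 - q) = v ^ (-q - 1) * v ^ 2 := by
      rw [← rpow_two, ← rpow_add hv]; ring_nf
    rw [h2]
    calc _ ≤ v ^ (-q - 1) * (π * v ^ 2) := by gcongr
      _ = _ := by ring
  · intro v hv
    have hv0 : 0 < v := by linarith
    rw [abs_of_nonneg (mul_nonneg (rpow_nonneg hv0.le _) (h01 v)), one_mul]
    have := Real.exp_pos (-π * v ^ 2)
    exact mul_le_of_le_one_right (by positivity) (by linarith)

theorem heatConst_pos {q : ℝ} (hq : 0 < q) (hq2 : q < 2) : 0 < heatConst q := by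
  have hpi := Real.pi_pos
  rw [heatConst, setIntegral_pos_iff_support_of_nonneg_ae]
  · have : Ioi (0 : ℝ) ⊆ Function.support
        (fun v : ℝ => v ^ (-q - 1) * (1 - Real.exp (-π * v ^ 2))) := by
      intro v hv
      have hv : 0 < v := hv
      have : Real.exp (-π * v ^ 2) < 1 := by
        rw [Real.exp_lt_one_iff]; nlinarith [mul_pos hpi (pow_pos hv 2)]
      exact (mul_pos (rpow_pos_of_pos hv _) (by linarith)).ne'
    rw [inter_eq_right.2 this]
    simp
  · filter_upwards [ae_restrict_mem measurableSet_Ioi] with v hv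
    refine mul_nonneg (rpow_nonneg (le_of_lt hv) _) ?_
    simp only [sub_nonneg, Real.exp_le_one_iff]
    nlinarith [sq_nonneg v]
  · exact integrableOn_heatConst hq hq2

theorem gauss_smul (v : ℝ) (ξ : 𝔼) : gauss (v • ξ) = Real.exp (-π * (‖ξ‖ * v) ^ 2) := by
  rw [gauss, norm_smul, mul_pow, mul_pow, norm_eq_abs, sq_abs, mul_comm (v ^ 2)]

theorem integral_one_sub_gauss_smul {q : ℝ} (hq : 0 < q) (ξ : 𝔼) :
    ∫ v in Ioi (0 : ℝ), v ^ (-q - 1) * (1 - gauss (v • ξ)) = heatConst q * ‖ξ‖ ^ q := by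
  rcases eq_or_ne ξ 0 with rfl | h
  · simp [gauss, zero_rpow hq.ne']
  · have := integral_Ioi_rpow_mul_comp_mul (fun v => 1 - Real.exp (-π * v ^ 2)) (-q - 1)
      (norm_pos_iff.2 h)
    simp_rw [gauss_smul, heatConst]
    rw [this, mul_comm]
    congr 2; ring

theorem integrableOn_one_sub_gauss_smul {q : ℝ} (hq : 0 < q) (hq2 : q < 2) (ξ : 𝔼) :
    IntegrableOn (fun v : ℝ => v ^ (-q - 1) * (1 - gauss (v • ξ))) (Ioi 0) := by
  rcases eq_or_ne ξ 0 with rfl | h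
  · simp [gauss]
  · have := integrableOn_Ioi_rpow_mul_comp_mul (integrableOn_heatConst hq hq2)
      (norm_pos_iff.2 h)
    simpa only [gauss_smul] using this

/-! ### The heat representation of `|D|^q` -/

theorem integrable_gauss_mul_of_bounded {f : 𝔼 → ℝ} (hf : Continuous f) {K : ℝ}
    (hK : ∀ x, |f x| ≤ K) : Integrable (fun y => gauss y * f y) := by
  have := integrable_gauss.bdd_mul (f := f) (c := K) hf.aestronglyMeasurable
    (ae_of_all _ fun x => by simpa using hK x) (μ := (volume : Measure 𝔼))
  simpa only [mul_comm] using this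

theorem exists_bound_of_test {φ : 𝔼 → ℝ} (hφ : Continuous φ) (hc : HasCompactSupport φ) :
    ∃ K, 0 < K ∧ ∀ x, |φ x| ≤ K := by
  obtain ⟨K, hK⟩ := hc.exists_bound_of_continuous hφ
  exact ⟨max K 1, by positivity, fun x => (hK x).trans (le_max_left _ _)⟩

theorem integral_one_sub_gauss_mul_fourier {φ : 𝔼 → ℝ} (hφ : ContDiff ℝ ∞ φ)
    (hc : HasCompactSupport φ) (x : 𝔼) (v : ℝ) :
    ∫ ξ : 𝔼, ((1 - gauss (v • ξ) : ℝ) : ℂ) *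
      (Complex.exp (((2 * π * inner ℝ ξ x : ℝ) : ℂ) * Complex.I) *
        𝓕 (fun y : 𝔼 => (φ y : ℂ)) ξ) = ((∫ y, gauss y * (φ x - φ (x + v • y)) : ℝ) : ℂ) := by
  have hh := integrable_fourier_of_test hφ hc
  have h1 := integral_gauss_mul_fourierInv hh x v
  simp_rw [fourierInv_fourier_test hφ hc] at h1
  have hi : Integrable (fun ξ : 𝔼 => Complex.exp (((2 * π * inner ℝ ξ x : ℝ) : ℂ) * Complex.I) *
        𝓕 (fun y : 𝔼 => (φ y : ℂ)) ξ) := by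
    refine hh.bdd_mul (c := 1) ?_ (ae_of_all _ fun ξ => by rw [Complex.norm_exp_ofReal_mul_I])
    apply Continuous.aestronglyMeasurable; fun_prop
  have hi2 : Integrable (fun ξ : 𝔼 => (gauss (v • ξ) : ℂ) *
      (Complex.exp (((2 * π * inner ℝ ξ x : ℝ) : ℂ) * Complex.I) *
        𝓕 (fun y : 𝔼 => (φ y : ℂ)) ξ)) := by
    refine hi.bdd_mul (c := 1) ?_ (ae_of_all _ fun ξ => by
      rw [Complex.norm_real, norm_of_nonneg (gauss_pos _).le]; exact gauss_le_one _)
    apply Continuous.aestronglyMeasurable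
    have := continuous_gauss (d := d)
    fun_prop
  simp only [Complex.ofReal_sub, Complex.ofReal_one, sub_mul, one_mul]
  rw [integral_sub hi hi2, ← h1]
  have h3 : ∫ ξ : 𝔼, Complex.exp (((2 * π * inner ℝ ξ x : ℝ) : ℂ) * Complex.I) *
        𝓕 (fun y : 𝔼 => (φ y : ℂ)) ξ = φ x := by
    rw [← fourierInv_fourier_test hφ hc, Real.fourierInv_eq']
    rfl
  rw [h3]
  obtain ⟨K, -, hK⟩ := exists_bound_of_test hφ.continuous hc
  have hI : Integrable (fun y => gauss y * φ (x + v • y)) :=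
    integrable_gauss_mul_of_bounded (f := fun y => φ (x + v • y))
      (hφ.continuous.comp (by fun_prop)) (fun y => hK _)
  simp_rw [mul_sub]
  rw [integral_sub (integrable_gauss.mul_const _) hI, integral_mul_const, integral_gauss, one_mul,
    Complex.ofReal_sub]
  congr 1
  rw [← integral_complex_ofReal]
  congr 1; ext y; push_cast; rfl

/-- The symbol `|ξ|^q` is a superposition over `v` of the multipliers `1 - gauss (v • ξ)`, each of
which subtracts from `φ` its Gaussian average at scale `v`. Integrability of `|ξ|^q 𝓕 φ` justifies
Fubini. The result is a formula in physical space, from which decay, scaling and the value at the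
origin can be read off. -/
theorem heat_representation {φ : 𝔼 → ℝ} (hφ : ContDiff ℝ ∞ φ)
    (hc : HasCompactSupport φ) {q : ℝ} (hq : 0 < q) (hq2 : q < 2) (x : 𝔼) :
    (heatConst q : ℂ) * ∫ ξ : 𝔼, (Complex.exp (((2 * π * inner ℝ ξ x : ℝ) : ℂ) * Complex.I) *
        (((‖ξ‖ ^ q : ℝ) : ℂ) * 𝓕 (fun y : 𝔼 => (φ y : ℂ)) ξ)) =
      ((∫ v in Ioi (0 : ℝ), v ^ (-q - 1) *
        ∫ y, gauss y * (φ x - φ (x + v • y)) : ℝ) : ℂ) := by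
  set g : 𝔼 → ℂ := fun ξ => Complex.exp (((2 * π * inner ℝ ξ x : ℝ) : ℂ) * Complex.I) *
        𝓕 (fun y : 𝔼 => (φ y : ℂ)) ξ with hg
  have hgc : Continuous g := by
    have := continuous_fourier_of_test hφ hc
    fun_prop
  have hsw : ∫ ξ : 𝔼, ∫ v in Ioi (0 : ℝ), ((v ^ (-q - 1) * (1 - gauss (v • ξ)) : ℝ) : ℂ) * g ξ =
      ∫ v in Ioi (0 : ℝ), ∫ ξ : 𝔼, ((v ^ (-q - 1) * (1 - gauss (v • ξ)) : ℝ) : ℂ) * g ξ := by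
    refine integral_integral_swap ?_
    have hm : Measurable (Function.uncurry fun (ξ : 𝔼) (v : ℝ) =>
        ((v ^ (-q - 1) * (1 - gauss (v • ξ)) : ℝ) : ℂ) * g ξ) := by
      have h1 : Measurable (fun p : 𝔼 × ℝ => gauss (p.2 • p.1)) :=
        (continuous_gauss.comp (by fun_prop)).measurable
      have h2 : Measurable (fun p : 𝔼 × ℝ => p.2 ^ (-q - 1)) := by fun_prop
      exact (Complex.measurable_ofReal.comp (h2.mul (measurable_const.sub h1))).mul
        (hgc.measurable.comp measurable_fst)
    rw [integrable_prod_iff hm.aestronglyMeasurable]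
    refine ⟨ae_of_all _ fun ξ => ?_, ?_⟩
    · exact (integrableOn_one_sub_gauss_smul hq hq2 ξ).ofReal.mul_const (g ξ)
    · have h1 := (integrable_rpow_mul_fourier hφ hc hq.le hq2.le).norm.const_mul (heatConst q)
      refine h1.congr (ae_of_all _ fun ξ => ?_)
      simp only [Function.uncurry, norm_mul, Complex.norm_real]
      rw [integral_mul_const, hg]
      simp only [norm_mul, Complex.norm_exp_ofReal_mul_I, one_mul]
      rw [norm_of_nonneg (show 0 ≤ ‖ξ‖ ^ q by positivity), ← mul_assoc,
        ← integral_one_sub_gauss_smul hq ξ]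
      congr 1
      refine setIntegral_congr_fun measurableSet_Ioi fun v hv => ?_
      rw [norm_of_nonneg (rpow_nonneg (le_of_lt hv) _), norm_of_nonneg]
      linarith [gauss_le_one (v • ξ)]
  calc _ = ∫ ξ : 𝔼, ((heatConst q * ‖ξ‖ ^ q : ℝ) : ℂ) * g ξ := by
        rw [← integral_const_mul]
        congr 1; ext ξ; rw [hg]; push_cast; ring
    _ = ∫ ξ : 𝔼, ∫ v in Ioi (0 : ℝ), ((v ^ (-q - 1) * (1 - gauss (v • ξ)) : ℝ) : ℂ) * g ξ := by
        congr 1; ext ξ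
        rw [integral_mul_const, integral_complex_ofReal, integral_one_sub_gauss_smul hq ξ]
    _ = _ := by
        rw [hsw, ← integral_complex_ofReal]
        refine setIntegral_congr_fun measurableSet_Ioi fun v _ => ?_
        rw [Complex.ofReal_mul, ← integral_one_sub_gauss_mul_fourier hφ hc x v,
          ← integral_const_mul]
        congr 1; ext ξ; rw [hg]; push_cast; ring


/-! ### The fractional Laplacian of test functions -/

/-- The complex-valued function `|2πξ|^α 𝓕 φ`. -/
def fracSymbol (α : ℝ) (φ : 𝔼 → ℝ) (ξ : 𝔼) : ℂ :=
  (((2 * π * ‖ξ‖) ^ α : ℝ) : ℂ) * 𝓕 (fun y : 𝔼 => (φ y : ℂ)) ξ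

theorem fracSymbol_eq (α : ℝ) (φ : 𝔼 → ℝ) (ξ : 𝔼) :
    fracSymbol α φ ξ = (((2 * π) ^ α : ℝ) : ℂ) *
      (((‖ξ‖ ^ α : ℝ) : ℂ) * 𝓕 (fun y : 𝔼 => (φ y : ℂ)) ξ) := by
  rw [fracSymbol, mul_rpow (by positivity) (norm_nonneg _)]
  push_cast; ring

theorem integrable_fracSymbol {α : ℝ} (hα : 0 < α) (hα2 : α < 2) {φ : 𝔼 → ℝ}
    (hφ : ContDiff ℝ ∞ φ) (hc : HasCompactSupport φ) : Integrable (fracSymbol α φ) := by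
  have := (integrable_rpow_mul_fourier hφ hc hα.le hα2.le).const_mul (((2 * π) ^ α : ℝ) : ℂ)
  exact this.congr (ae_of_all _ fun ξ => (fracSymbol_eq α φ ξ).symm)

theorem fourierInv_fracSymbol {α : ℝ} (hα : 0 < α) (hα2 : α < 2) {φ : 𝔼 → ℝ}
    (hφ : ContDiff ℝ ∞ φ) (hc : HasCompactSupport φ) (x : 𝔼) :
    𝓕⁻ (fracSymbol α φ) x = (((2 * π) ^ α / heatConst α * ∫ v in Ioi (0 : ℝ), v ^ (-α - 1) *
        ∫ y, gauss y * (φ x - φ (x + v • y)) : ℝ) : ℂ) := by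
  have h := heat_representation hφ hc hα hα2 x
  have hk : (heatConst α : ℂ) ≠ 0 := by exact_mod_cast (heatConst_pos hα hα2).ne'
  rw [Complex.ofReal_mul, ← h, Real.fourierInv_eq', Complex.ofReal_div, ← mul_assoc,
    div_mul_cancel₀ _ hk, ← integral_const_mul]
  congr 1; ext ξ
  rw [fracSymbol_eq, smul_eq_mul]; ring

theorem fracLaplacian_eq_heat {α : ℝ} (hα : 0 < α) (hα2 : α < 2) {φ : 𝔼 → ℝ}
    (hφ : ContDiff ℝ ∞ φ) (hc : HasCompactSupport φ) (x : 𝔼) :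
    fracLaplacian α φ x = (2 * π) ^ α / heatConst α * ∫ v in Ioi (0 : ℝ), v ^ (-α - 1) *
        ∫ y, gauss y * (φ x - φ (x + v • y)) := by
  have := fourierInv_fracSymbol hα hα2 hφ hc x
  change (𝓕⁻ (fracSymbol α φ) x).re = _
  rw [this, Complex.ofReal_re]

theorem fourierInv_fracSymbol_eq {α : ℝ} (hα : 0 < α) (hα2 : α < 2) {φ : 𝔼 → ℝ}
    (hφ : ContDiff ℝ ∞ φ) (hc : HasCompactSupport φ) (x : 𝔼) :
    𝓕⁻ (fracSymbol α φ) x = (fracLaplacian α φ x : ℂ) := by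
  rw [fracLaplacian_eq_heat hα hα2 hφ hc, fourierInv_fracSymbol hα hα2 hφ hc]

theorem continuous_fracLaplacian {α : ℝ} (hα : 0 < α) (hα2 : α < 2) {φ : 𝔼 → ℝ}
    (hφ : ContDiff ℝ ∞ φ) (hc : HasCompactSupport φ) : Continuous (fracLaplacian α φ) := by
  have : Continuous (𝓕⁻ (fracSymbol α φ)) :=
    VectorFourier.fourierIntegral_continuous Real.continuous_fourierChar
      (by simp only [LinearMap.neg_apply, innerₗ_apply_apply]; fun_prop)
      (integrable_fracSymbol hα hα2 hφ hc)
  exact Complex.continuous_re.comp this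

theorem exists_bound_fracLaplacian {α : ℝ} (hα : 0 < α) (hα2 : α < 2) {φ : 𝔼 → ℝ}
    (hφ : ContDiff ℝ ∞ φ) (hc : HasCompactSupport φ) :
    ∃ K, 0 < K ∧ ∀ x, |fracLaplacian α φ x| ≤ K := by
  refine ⟨(∫ ξ, ‖fracSymbol α φ ξ‖) + 1, by positivity, fun x => ?_⟩
  have h := fourierInv_fracSymbol_eq hα hα2 hφ hc x
  have h2 : |fracLaplacian α φ x| = ‖𝓕⁻ (fracSymbol α φ) x‖ := by
    rw [h, Complex.norm_real, norm_eq_abs]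
  rw [h2, Real.fourierInv_eq']
  refine (norm_integral_le_integral_norm _).trans ?_
  simp_rw [norm_smul, Complex.norm_exp_ofReal_mul_I, one_mul]
  linarith

theorem fracLaplacian_comp_isometry (α : ℝ) {φ : 𝔼 → ℝ} (A : 𝔼 ≃ₗᵢ[ℝ] 𝔼)
    (hA : ∀ x, φ (A x) = φ x) (x : 𝔼) : fracLaplacian α φ (A x) = fracLaplacian α φ x := by
  have h1 : fracSymbol α φ ∘ A = fracSymbol α φ := by
    ext ξ
    simp only [Function.comp, fracSymbol, A.norm_map]
    congr 1
    have h2 : (fun y : 𝔼 => (φ y : ℂ)) ∘ A = fun y : 𝔼 => (φ y : ℂ) := by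
      funext y; simp [hA]
    rw [← Real.fourier_comp_linearIsometry, h2]
  change (𝓕⁻ (fracSymbol α φ) (A x)).re = (𝓕⁻ (fracSymbol α φ) x).re
  rw [← Real.fourierInv_comp_linearIsometry, h1]

/-- The symbol is radial, so the operator commutes with linear isometries; two points of equal norm
are exchanged by the reflection in the hyperplane orthogonal to their difference. -/
theorem fracLaplacian_radial (α : ℝ) {φ : 𝔼 → ℝ} (hφ : ∀ x y, ‖x‖ = ‖y‖ → φ x = φ y) {x y : 𝔼}
    (h : ‖x‖ = ‖y‖) : fracLaplacian α φ x = fracLaplacian α φ y := by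
  have := fracLaplacian_comp_isometry α (φ := φ) (Submodule.reflection (ℝ ∙ (x - y))ᗮ)
    (fun z => hφ _ _ (LinearIsometryEquiv.norm_map _ _)) x
  rw [Submodule.reflection_sub h] at this
  exact this.symm

theorem fracLaplacian_comp_sub (α : ℝ) (φ : 𝔼 → ℝ) (a x : 𝔼) :
    fracLaplacian α (fun y => φ (y - a)) x = fracLaplacian α φ (x - a) := by
  have h1 : ∀ ξ, fracSymbol α (fun y => φ (y - a)) ξ =
      Complex.exp (((-2 * π * inner ℝ a ξ : ℝ) : ℂ) * Complex.I) * fracSymbol α φ ξ := by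
    intro ξ
    have : 𝓕 (fun y : 𝔼 => (φ (y - a) : ℂ)) ξ =
        Complex.exp (((-2 * π * inner ℝ a ξ : ℝ) : ℂ) * Complex.I) *
          𝓕 (fun y : 𝔼 => (φ y : ℂ)) ξ := by
      rw [Real.fourier_eq', Real.fourier_eq', ← integral_const_mul,
        ← integral_add_right_eq_self _ a]
      congr 1; ext y
      rw [add_sub_cancel_right, inner_add_left, smul_eq_mul, smul_eq_mul, ← mul_assoc,
        ← Complex.exp_add]
      congr 2; push_cast; ring
    rw [fracSymbol, this, fracSymbol]; ring
  change (𝓕⁻ (fracSymbol α _) x).re = (𝓕⁻ (fracSymbol α φ) (x - a)).re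
  rw [Real.fourierInv_eq', Real.fourierInv_eq']
  congr 2; ext ξ
  rw [h1, smul_eq_mul, smul_eq_mul, ← mul_assoc, ← Complex.exp_add, inner_sub_right,
    real_inner_comm ξ a]
  congr 2; push_cast; ring

/-- The integral of `v^(-α-1) min (1, v²)`. -/
theorem integrableOn_rpow_mul_min_sq {α : ℝ} (hα : 0 < α) (hα2 : α < 2) :
    IntegrableOn (fun v : ℝ => v ^ (-α - 1) * min 1 (v ^ 2)) (Ioi 0) := by
  refine integrableOn_Ioi_of_power_bounds (A := 1) (B := 1) (a := 1 - α) (b := -α - 1)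
    (by linarith) (by linarith) (by
      apply Measurable.aestronglyMeasurable
      fun_prop) ?_ ?_
  · intro v hv _
    rw [abs_of_nonneg (by positivity), one_mul]
    have h2 : v ^ (1 - α) = v ^ (-α - 1) * v ^ 2 := by
      rw [← rpow_two, ← rpow_add hv]; ring_nf
    rw [h2]
    gcongr
    exact min_le_right _ _
  · intro v hv
    have hv0 : 0 < v := by linarith
    rw [abs_of_nonneg (by positivity), one_mul]
    exact mul_le_of_le_one_right (by positivity) (min_le_left _ _)

theorem integrable_sq_mul_gauss : Integrable (fun y : 𝔼 => gauss y * ‖y‖ ^ 2) := by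
  have h : Integrable (fun y : 𝔼 => Real.exp (-(π / 2) * ‖y‖ ^ 2)) := by
    have := (integrable_gauss (d := d)).comp_smul (R := (Real.sqrt 2)⁻¹)
      (by positivity)
    refine this.congr (ae_of_all _ fun y => ?_)
    simp only [gauss, norm_smul, mul_pow, norm_eq_abs, sq_abs, inv_pow]
    rw [Real.sq_sqrt (by norm_num)]
    congr 1; ring
  refine Integrable.mono' h ?_ (ae_of_all _ fun y => ?_)
  · exact (continuous_gauss.mul (by fun_prop)).aestronglyMeasurable
  · rw [norm_of_nonneg (mul_nonneg (gauss_pos _).le (by positivity)), gauss]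
    have h1 := Real.add_one_le_exp (π / 2 * ‖y‖ ^ 2)
    have h2 : ‖y‖ ^ 2 ≤ Real.exp (π / 2 * ‖y‖ ^ 2) := by
      have := Real.two_le_pi
      nlinarith [sq_nonneg ‖y‖]
    calc _ ≤ Real.exp (-π * ‖y‖ ^ 2) * Real.exp (π / 2 * ‖y‖ ^ 2) := by gcongr
      _ = _ := by rw [← Real.exp_add]; congr 1; ring

/-- Far from the support, `φ x = 0`, and `x + v • y` meets the support only if `v ‖y‖ ≥ ‖x‖ / 2`.
The second Gaussian moment bounds the mean by a multiple of `min 1 ((v / ‖x‖)^2)`, and scaling in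
`v` gives decay of order `‖x‖^(-α)`. This is the rate that the weight `|x̄ - x|^α` of the equation
requires. -/
theorem exists_decay_fracLaplacian {α : ℝ} (hα : 0 < α) (hα2 : α < 2) {φ : 𝔼 → ℝ}
    (hφ : ContDiff ℝ ∞ φ) (hc : HasCompactSupport φ) :
    ∃ K, 0 < K ∧ ∀ x, |fracLaplacian α φ x| ≤ K ∧ ‖x‖ ^ α * |fracLaplacian α φ x| ≤ K := by
  obtain ⟨B, hB, hφB⟩ := exists_bound_of_test hφ.continuous hc
  obtain ⟨K₁, hK₁, hK⟩ := exists_bound_fracLaplacian hα hα2 hφ hc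
  obtain ⟨R, hR, hsupp⟩ : ∃ R, 0 < R ∧ ∀ x, R < ‖x‖ → φ x = 0 := by
    obtain ⟨R, hR⟩ := hc.isCompact.isBounded.subset_closedBall (0 : 𝔼)
    refine ⟨max R 1, by positivity, fun x hx => ?_⟩
    by_contra hne
    have := hR (subset_tsupport φ hne)
    rw [mem_closedBall_zero_iff] at this
    exact absurd (this.trans (le_max_left R 1)) (not_le.2 hx)
  set S := ∫ y : 𝔼, gauss y * ‖y‖ ^ 2 with hS
  have hS0 : 0 ≤ S := integral_nonneg fun y => mul_nonneg (gauss_pos _).le (by positivity)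
  set I := ∫ v in Ioi (0 : ℝ), v ^ (-α - 1) * min 1 (v ^ 2) with hI
  have hI0 : 0 ≤ I := setIntegral_nonneg measurableSet_Ioi fun v (hv : 0 < v) => by positivity
  -- the Gaussian mean at points far from the support
  have hD : ∀ x : 𝔼, 2 * R < ‖x‖ → ∀ v : ℝ, 0 < v →
      |∫ y, gauss y * (φ x - φ (x + v • y))| ≤ B * (1 + 4 * S) * min 1 ((‖x‖⁻¹ * v) ^ 2) := by
    intro x hx v hv
    have hx0 : 0 < ‖x‖ := by linarith
    have hφx : φ x = 0 := hsupp x (by linarith)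
    -- The first bound serves for `v` large compared with `‖x‖`. The second is Chebyshev's: where
    -- the integrand does not vanish, `(2 v ‖y‖ / ‖x‖)^2 ≥ 1` may be inserted as a factor.
    have hpt : ∀ y, |gauss y * (φ x - φ (x + v • y))| ≤
        min (gauss y * B) (B * 4 * (‖x‖⁻¹ * v) ^ 2 * (gauss y * ‖y‖ ^ 2)) := by
      intro y
      rw [hφx, zero_sub, abs_mul, abs_neg, abs_of_pos (gauss_pos y)]
      refine le_min (by gcongr; exacts [(gauss_pos y).le, hφB _]) ?_
      by_cases hxy : R < ‖x + v • y‖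
      · rw [hsupp _ hxy, abs_zero, mul_zero]
        have := gauss_pos y
        positivity
      · push Not at hxy
        have h1 : ‖x‖ ≤ ‖x + v • y‖ + v * ‖y‖ := by
          have := norm_sub_le (x + v • y) (v • y)
          rw [add_sub_cancel_right, norm_smul, norm_eq_abs, abs_of_pos hv] at this
          exact this
        have h2 : 1 ≤ 2 * (‖x‖⁻¹ * v * ‖y‖) := by
          have : ‖x‖ / 2 ≤ v * ‖y‖ := by linarith
          calc (1 : ℝ) = 2 * (‖x‖⁻¹ * (‖x‖ / 2)) := by field_simp
            _ ≤ 2 * (‖x‖⁻¹ * (v * ‖y‖)) := by gcongr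
            _ = _ := by ring
        have h3 : 1 ≤ (2 * (‖x‖⁻¹ * v * ‖y‖)) ^ 2 := one_le_pow₀ h2
        have h4 := gauss_pos y
        calc gauss y * |φ (x + v • y)| ≤ gauss y * B := by gcongr; exact hφB _
          _ ≤ gauss y * B * (2 * (‖x‖⁻¹ * v * ‖y‖)) ^ 2 := le_mul_of_one_le_right (by positivity) h3
          _ = _ := by ring
    have e1 : |∫ y, gauss y * (φ x - φ (x + v • y))| ≤ B := by
      rw [← norm_eq_abs]
      refine (norm_integral_le_of_norm_le (integrable_gauss.mul_const B)
        (ae_of_all _ fun y => (hpt y).trans (min_le_left _ _))).trans ?_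
      rw [integral_mul_const, integral_gauss, one_mul]
    have e2 : |∫ y, gauss y * (φ x - φ (x + v • y))| ≤ B * 4 * (‖x‖⁻¹ * v) ^ 2 * S := by
      rw [← norm_eq_abs]
      refine (norm_integral_le_of_norm_le (integrable_sq_mul_gauss.const_mul _)
        (ae_of_all _ fun y => (hpt y).trans (min_le_right _ _))).trans ?_
      rw [integral_const_mul]
    rcases le_total 1 ((‖x‖⁻¹ * v) ^ 2) with h | h
    · rw [min_eq_left h]; nlinarith
    · rw [min_eq_right h]
      have : 0 ≤ B * (‖x‖⁻¹ * v) ^ 2 := by positivity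
      nlinarith
  set c := (2 * π) ^ α / heatConst α with hcdef
  have hc0 : 0 ≤ c := div_nonneg (by positivity) (heatConst_pos hα hα2).le
  refine ⟨K₁ + (2 * R) ^ α * K₁ + c * (B * (1 + 4 * S) * I), by positivity, fun x => ⟨?_, ?_⟩⟩
  · have : 0 ≤ (2 * R) ^ α * K₁ + c * (B * (1 + 4 * S) * I) := by positivity
    linarith [hK x]
  by_cases hx : 2 * R < ‖x‖
  · have hx0 : 0 < ‖x‖ := by linarith
    have hint := integrableOn_Ioi_rpow_mul_comp_mul (integrableOn_rpow_mul_min_sq hα hα2)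
      (inv_pos.2 hx0)
    have hval := integral_Ioi_rpow_mul_comp_mul (fun v => min 1 (v ^ 2)) (-α - 1) (inv_pos.2 hx0)
    have : |fracLaplacian α φ x| ≤ c * (B * (1 + 4 * S) * (‖x‖ ^ (-α) * I)) := by
      rw [fracLaplacian_eq_heat hα hα2 hφ hc, abs_mul, abs_of_nonneg hc0]
      gcongr
      rw [← norm_eq_abs]
      refine (norm_integral_le_of_norm_le (hint.const_mul (B * (1 + 4 * S))) ?_).trans ?_
      · filter_upwards [ae_restrict_mem measurableSet_Ioi] with v hv
        have hv : 0 < v := hv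
        rw [norm_mul, norm_of_nonneg (rpow_nonneg hv.le _), norm_eq_abs]
        calc _ ≤ v ^ (-α - 1) * (B * (1 + 4 * S) * min 1 ((‖x‖⁻¹ * v) ^ 2)) := by
              gcongr; exact hD x hx v hv
          _ = _ := by ring
      · rw [integral_const_mul, hval, ← hI, show -(-α - 1) - 1 = α by ring, inv_rpow hx0.le,
          rpow_neg hx0.le]
    calc _ ≤ ‖x‖ ^ α * (c * (B * (1 + 4 * S) * (‖x‖ ^ (-α) * I))) := by gcongr
      _ = (‖x‖ ^ α * ‖x‖ ^ (-α)) * (c * (B * (1 + 4 * S) * I)) := by ring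
      _ = c * (B * (1 + 4 * S) * I) := by rw [← rpow_add hx0]; simp
      _ ≤ _ := by
        have : 0 ≤ K₁ + (2 * R) ^ α * K₁ := by positivity
        linarith
  · push Not at hx
    have : ‖x‖ ^ α * |fracLaplacian α φ x| ≤ (2 * R) ^ α * K₁ := by gcongr; exact hK x
    have : 0 ≤ K₁ + c * (B * (1 + 4 * S) * I) := by positivity
    linarith


/-! ### Mixtures of dilations -/

theorem contDiff_comp_smul {φ : 𝔼 → ℝ} (hφ : ContDiff ℝ ∞ φ) (v : ℝ) :
    ContDiff ℝ ∞ (fun y => φ (v • y)) := hφ.comp (contDiff_const_smul v)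

theorem hasCompactSupport_comp_smul {φ : 𝔼 → ℝ} (hc : HasCompactSupport φ) {v : ℝ} (hv : v ≠ 0) :
    HasCompactSupport (fun y => φ (v • y)) := hc.comp_smul hv

theorem fracLaplacian_comp_smul {α : ℝ} (hα : 0 < α) (hα2 : α < 2) {φ : 𝔼 → ℝ}
    (hφ : ContDiff ℝ ∞ φ) (hc : HasCompactSupport φ) {v : ℝ} (hv : 0 < v) (x : 𝔼) :
    fracLaplacian α (fun y => φ (v • y)) x = v ^ α * fracLaplacian α φ (v • x) := by
  rw [fracLaplacian_eq_heat hα hα2 (contDiff_comp_smul hφ v) (hasCompactSupport_comp_smul hc hv.ne'),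
    fracLaplacian_eq_heat hα hα2 hφ hc]
  have h := integral_Ioi_rpow_mul_comp_mul
    (fun u => ∫ y : 𝔼, gauss y * (φ (v • x) - φ (v • x + u • y))) (-α - 1) hv
  rw [show -(-α - 1) - 1 = α by ring] at h
  rw [mul_left_comm, ← h]
  simp_rw [smul_add, smul_smul]

theorem fourier_comp_smul (φ : 𝔼 → ℝ) {v : ℝ} (hv : 0 < v) (ξ : 𝔼) :
    𝓕 (fun y : 𝔼 => (φ (v • y) : ℂ)) ξ = ((v ^ d)⁻¹ : ℝ) • 𝓕 (fun y : 𝔼 => (φ y : ℂ)) (v⁻¹ • ξ) := by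
  rw [Real.fourier_eq', Real.fourier_eq']
  have := Measure.integral_comp_smul (volume : Measure 𝔼) (fun y =>
    Complex.exp (((-2 * π * inner ℝ y (v⁻¹ • ξ) : ℝ) : ℂ) * Complex.I) • (φ y : ℂ)) v
  rw [finrank_euclideanSpace_fin, abs_of_pos (by positivity)] at this
  rw [← this]
  congr 1; ext y
  rw [inner_smul_left, inner_smul_right]
  simp only [conj_trivial]
  rw [mul_inv_cancel_left₀ hv.ne']

theorem fracSymbol_comp_smul {α : ℝ} (φ : 𝔼 → ℝ) {v : ℝ} (hv : 0 < v) (ξ : 𝔼) :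
    fracSymbol α (fun y => φ (v • y)) ξ =
      (((v ^ d)⁻¹ * v ^ α : ℝ) : ℂ) * fracSymbol α φ (v⁻¹ • ξ) := by
  rw [fracSymbol, fracSymbol, fourier_comp_smul φ hv, norm_smul, norm_inv, norm_of_nonneg hv.le,
    Complex.real_smul]
  have : (2 * π * ‖ξ‖) ^ α = v ^ α * (2 * π * (v⁻¹ * ‖ξ‖)) ^ α := by
    rw [← mul_rpow hv.le (by positivity)]
    congr 1; field_simp
  rw [this]; push_cast; ring

theorem continuous_fracSymbol {α : ℝ} (hα : 0 < α) {φ : 𝔼 → ℝ}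
    (hφ : ContDiff ℝ ∞ φ) (hc : HasCompactSupport φ) : Continuous (fracSymbol α φ) := by
  have h3 : Continuous (fun ξ : 𝔼 => (2 * π * ‖ξ‖) ^ α) :=
    (continuous_const.mul continuous_norm).rpow_const fun _ => Or.inr hα.le
  exact (Complex.continuous_ofReal.comp h3).mul (continuous_fourier_of_test hφ hc)

theorem fourier_mixture {φ : 𝔼 → ℝ} (hφ : ContDiff ℝ ∞ φ) (hc : HasCompactSupport φ)
    {a b : ℝ} (ha : 0 < a) {wt : ℝ → ℝ} (hwt : ContinuousOn wt (Icc a b)) (ξ : 𝔼) :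
    𝓕 (fun y : 𝔼 => ((∫ v in Ioc a b, wt v * φ (v • y) : ℝ) : ℂ)) ξ =
      ∫ v in Ioc a b, (wt v : ℂ) * 𝓕 (fun y : 𝔼 => (φ (v • y) : ℂ)) ξ := by
  obtain ⟨W, hW⟩ := isCompact_Icc.exists_bound_of_continuousOn hwt
  obtain ⟨B, hB, hφB⟩ := exists_bound_of_test hφ.continuous hc
  obtain ⟨R, hR⟩ := hc.isCompact.isBounded.subset_closedBall (0 : 𝔼)
  have hwtm : AEStronglyMeasurable wt (volume.restrict (Ioc a b)) :=
    (hwt.mono Ioc_subset_Icc_self).aestronglyMeasurable measurableSet_Ioc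
  simp_rw [Real.fourier_eq', ← integral_complex_ofReal, ← integral_smul, ← integral_const_mul]
  rw [integral_integral_swap]
  · congr 1; ext v
    congr 1; ext y
    simp only [smul_eq_mul]; push_cast; ring
  · have hdom : Integrable (fun p : 𝔼 × ℝ =>
        (Metric.closedBall (0 : 𝔼) (R / a)).indicator (fun _ => (B * W : ℝ)) p.1 * 1)
        (volume.prod (volume.restrict (Ioc a b))) := by
      refine Integrable.mul_prod (f := (Metric.closedBall (0 : 𝔼) (R / a)).indicator
        (fun _ => (B * W : ℝ))) (g := fun _ => (1 : ℝ)) ?_ ?_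
      · rw [integrable_indicator_iff Metric.isClosed_closedBall.measurableSet]
        exact integrableOn_const (isCompact_closedBall _ _).measure_lt_top.ne
      · exact integrable_const _
    refine Integrable.mono' hdom ?_ ?_
    · have h1 : AEStronglyMeasurable (fun p : 𝔼 × ℝ => wt p.2)
          (volume.prod (volume.restrict (Ioc a b))) := hwtm.comp_snd
      have h2 : Continuous (fun p : 𝔼 × ℝ => φ (p.2 • p.1)) := hφ.continuous.comp (by fun_prop)
      have h3 : Continuous (fun p : 𝔼 × ℝ =>
          Complex.exp (((-2 * π * inner ℝ p.1 ξ : ℝ) : ℂ) * Complex.I)) := by fun_prop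
      exact h3.aestronglyMeasurable.smul
        (Complex.continuous_ofReal.comp_aestronglyMeasurable (h1.mul h2.aestronglyMeasurable))
    · have hmem : ∀ᵐ p : 𝔼 × ℝ ∂(volume.prod (volume.restrict (Ioc a b))), p.2 ∈ Ioc a b := by
        have : ∀ᵐ v ∂(volume.restrict (Ioc a b)), v ∈ Ioc a b := ae_restrict_mem measurableSet_Ioc
        exact Measure.quasiMeasurePreserving_snd.ae this
      filter_upwards [hmem] with p hp
      have hv : 0 < p.2 := ha.trans hp.1
      simp only [Function.uncurry, norm_smul, Complex.norm_exp_ofReal_mul_I, one_mul, mul_one,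
        Complex.norm_real, norm_mul]
      by_cases hy : p.1 ∈ Metric.closedBall (0 : 𝔼) (R / a)
      · rw [indicator_of_mem hy, mul_comm]
        have := hW p.2 (Ioc_subset_Icc_self hp)
        gcongr
        exact hφB _
      · rw [indicator_of_notMem hy]
        have : φ (p.2 • p.1) = 0 := by
          by_contra hne
          have := hR (subset_tsupport φ hne)
          rw [mem_closedBall_zero_iff] at this hy
          apply hy
          rw [norm_smul, norm_of_nonneg hv.le] at this
          rw [le_div_iff₀ ha]
          nlinarith [norm_nonneg p.1, hp.1]
        rw [this]; simp

/-- Fubini on the frequency side. The dilate by `v` has a symbol whose `L¹` norm is `v^α` times the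
original one, which is integrable over an interval that stays away from `0` and `∞`. -/
theorem fracLaplacian_mixture {α : ℝ} (hα : 0 < α) (hα2 : α < 2) {φ : 𝔼 → ℝ}
    (hφ : ContDiff ℝ ∞ φ) (hc : HasCompactSupport φ) {a b : ℝ} (ha : 0 < a)
    {wt : ℝ → ℝ} (hwt : ContinuousOn wt (Icc a b)) (x : 𝔼) :
    fracLaplacian α (fun y => ∫ v in Ioc a b, wt v * φ (v • y)) x =
      ∫ v in Ioc a b, wt v * (v ^ α * fracLaplacian α φ (v • x)) := by
  have hwtm : AEStronglyMeasurable wt (volume.restrict (Ioc a b)) :=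
    (hwt.mono Ioc_subset_Icc_self).aestronglyMeasurable measurableSet_Ioc
  have hS := integrable_fracSymbol hα hα2 hφ hc
  have h1 : ∀ ξ, fracSymbol α (fun y => ∫ v in Ioc a b, wt v * φ (v • y)) ξ =
      ∫ v in Ioc a b, (wt v : ℂ) * fracSymbol α (fun y => φ (v • y)) ξ := by
    intro ξ
    rw [fracSymbol, fourier_mixture hφ hc ha hwt, ← integral_const_mul]
    congr 1; ext v; rw [fracSymbol]; ring
  have hcomplex : 𝓕⁻ (fracSymbol α (fun y => ∫ v in Ioc a b, wt v * φ (v • y))) x =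
      ∫ v in Ioc a b, (wt v : ℂ) * 𝓕⁻ (fracSymbol α (fun y => φ (v • y))) x := by
    simp_rw [Real.fourierInv_eq', h1, ← integral_smul, ← integral_const_mul]
    rw [integral_integral_swap]
    · congr 1; ext v; congr 1; ext ξ; simp only [smul_eq_mul]; ring
    · have hm : AEStronglyMeasurable (Function.uncurry fun (ξ : 𝔼) (v : ℝ) =>
          Complex.exp (((2 * π * inner ℝ ξ x : ℝ) : ℂ) * Complex.I) •
            ((wt v : ℂ) * ((((v ^ d)⁻¹ * v ^ α : ℝ) : ℂ) * fracSymbol α φ (v⁻¹ • ξ))))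
          (volume.prod (volume.restrict (Ioc a b))) := by
        have e1 : AEStronglyMeasurable (fun p : 𝔼 × ℝ => (wt p.2 : ℂ))
          (volume.prod (volume.restrict (Ioc a b))) :=
          Complex.continuous_ofReal.comp_aestronglyMeasurable hwtm.comp_snd
        have e2 : Measurable (fun p : 𝔼 × ℝ => (((p.2 ^ d)⁻¹ * p.2 ^ α : ℝ) : ℂ)) := by fun_prop
        have e3 : Measurable (fun p : 𝔼 × ℝ => fracSymbol α φ (p.2⁻¹ • p.1)) :=
          (continuous_fracSymbol hα hφ hc).measurable.comp (by fun_prop)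
        have e4 : Continuous (fun p : 𝔼 × ℝ =>
          Complex.exp (((2 * π * inner ℝ p.1 x : ℝ) : ℂ) * Complex.I)) := by fun_prop
        exact e4.aestronglyMeasurable.smul
          (e1.mul (e2.aestronglyMeasurable.mul e3.aestronglyMeasurable))
      have hmem : ∀ᵐ p : 𝔼 × ℝ ∂(volume.prod (volume.restrict (Ioc a b))), p.2 ∈ Ioc a b := by
        have : ∀ᵐ v ∂(volume.restrict (Ioc a b)), v ∈ Ioc a b := ae_restrict_mem measurableSet_Ioc
        exact Measure.quasiMeasurePreserving_snd.ae this
      suffices h : Integrable (Function.uncurry fun (ξ : 𝔼) (v : ℝ) =>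
          Complex.exp (((2 * π * inner ℝ ξ x : ℝ) : ℂ) * Complex.I) •
            ((wt v : ℂ) * ((((v ^ d)⁻¹ * v ^ α : ℝ) : ℂ) * fracSymbol α φ (v⁻¹ • ξ))))
          (volume.prod (volume.restrict (Ioc a b))) by
        refine h.congr ?_
        filter_upwards [hmem] with p hp
        simp only [Function.uncurry]
        rw [fracSymbol_comp_smul φ (ha.trans hp.1)]
      rw [integrable_prod_iff' hm]
      constructor
      · filter_upwards [ae_restrict_mem measurableSet_Ioc] with v hv
        have hv0 : 0 < v := ha.trans hv.1
        simp only [Function.uncurry]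
        have := ((hS.comp_smul (R := v⁻¹) (by positivity)).const_mul
          (((v ^ d)⁻¹ * v ^ α : ℝ) : ℂ)).const_mul (wt v : ℂ)
        refine this.bdd_mul (c := 1) ?_ (ae_of_all _ fun ξ => by rw [Complex.norm_exp_ofReal_mul_I])
        apply Continuous.aestronglyMeasurable; fun_prop
      · have hcont : ContinuousOn (fun v : ℝ => |wt v| * (v ^ α * ∫ ξ, ‖fracSymbol α φ ξ‖))
            (Icc a b) := by
          refine hwt.abs.mul (ContinuousOn.mul ?_ continuousOn_const)
          exact continuousOn_id.rpow_const fun v hv => Or.inr hα.le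
        refine ((hcont.integrableOn_Icc).mono_set Ioc_subset_Icc_self).congr ?_
        filter_upwards [ae_restrict_mem measurableSet_Ioc] with v hv
        have hv0 : 0 < v := ha.trans hv.1
        simp only [Function.uncurry, norm_smul, Complex.norm_exp_ofReal_mul_I, one_mul, norm_mul,
          Complex.norm_real]
        rw [integral_const_mul, integral_const_mul,
          Measure.integral_comp_smul (volume : Measure 𝔼) (fun ξ => ‖fracSymbol α φ ξ‖) v⁻¹,
          finrank_euclideanSpace_fin, smul_eq_mul, inv_pow, inv_inv, norm_eq_abs (wt v),
          norm_of_nonneg (show 0 ≤ (v ^ d)⁻¹ by positivity),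
          norm_of_nonneg (show 0 ≤ v ^ α by positivity),
          abs_of_pos (show 0 < v ^ d by positivity)]
        field_simp
  have h2 : ∀ᵐ v ∂(volume.restrict (Ioc a b)),
      (wt v : ℂ) * 𝓕⁻ (fracSymbol α (fun y => φ (v • y))) x =
        ((wt v * (v ^ α * fracLaplacian α φ (v • x)) : ℝ) : ℂ) := by
    filter_upwards [ae_restrict_mem measurableSet_Ioc] with v hv
    have hv0 : 0 < v := ha.trans hv.1
    rw [fourierInv_fracSymbol_eq hα hα2 (contDiff_comp_smul hφ v)
      (hasCompactSupport_comp_smul hc hv0.ne'), fracLaplacian_comp_smul hα hα2 hφ hc hv0]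
    push_cast; ring
  change (𝓕⁻ (fracSymbol α _) x).re = _
  rw [hcomplex, integral_congr_ae h2, integral_complex_ofReal, Complex.ofReal_re]


/-! ### Radial cutoffs -/

/-- A smooth function equal to `1` on `(-∞, 1]` and to `0` on `[2, ∞)`. -/
def cutoff (s : ℝ) : ℝ := Real.smoothTransition (2 - s)

theorem contDiff_cutoff : ContDiff ℝ ∞ cutoff :=
  Real.smoothTransition.contDiff.comp (contDiff_const.sub contDiff_id)

theorem cutoff_nonneg (s : ℝ) : 0 ≤ cutoff s := Real.smoothTransition.nonneg _

theorem cutoff_le_one (s : ℝ) : cutoff s ≤ 1 := Real.smoothTransition.le_one _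

theorem cutoff_of_le {s : ℝ} (h : s ≤ 1) : cutoff s = 1 :=
  Real.smoothTransition.one_of_one_le (by linarith)

theorem cutoff_of_ge {s : ℝ} (h : 2 ≤ s) : cutoff s = 0 :=
  Real.smoothTransition.zero_of_nonpos (by linarith)

theorem deriv_cutoff_of_lt {s : ℝ} (h : s < 1) : deriv cutoff s = 0 := by
  have : cutoff =ᶠ[𝓝 s] fun _ => 1 := by
    filter_upwards [Iio_mem_nhds h] with t ht using cutoff_of_le (le_of_lt ht)
  rw [this.deriv_eq]; simp

theorem deriv_cutoff_of_gt {s : ℝ} (h : 2 < s) : deriv cutoff s = 0 := by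
  have : cutoff =ᶠ[𝓝 s] fun _ => 0 := by
    filter_upwards [Ioi_mem_nhds h] with t ht using cutoff_of_ge (le_of_lt ht)
  rw [this.deriv_eq]; simp

theorem contDiff_deriv_cutoff : ContDiff ℝ ∞ (deriv cutoff) :=
  (contDiff_infty_iff_deriv.1 contDiff_cutoff).2

/-- The radial bump function equal to `1` on `|x| ≤ 1` and to `0` on `|x|² ≥ 2`. -/
def bump (x : 𝔼) : ℝ := cutoff (‖x‖ ^ 2)

theorem contDiff_bump : ContDiff ℝ ∞ (bump : 𝔼 → ℝ) :=
  contDiff_cutoff.comp (contDiff_norm_sq ℝ)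

theorem bump_nonneg (x : 𝔼) : 0 ≤ bump x := cutoff_nonneg _

theorem bump_le_one (x : 𝔼) : bump x ≤ 1 := cutoff_le_one _

theorem bump_of_le {x : 𝔼} (h : ‖x‖ ≤ 1) : bump x = 1 :=
  cutoff_of_le (pow_le_one₀ (norm_nonneg _) h)

theorem bump_of_ge {x : 𝔼} (h : 2 ≤ ‖x‖) : bump x = 0 := cutoff_of_ge (by nlinarith)

theorem hasCompactSupport_of_norm {f : 𝔼 → ℝ} {R : ℝ} (h : ∀ x, R < ‖x‖ → f x = 0) :
    HasCompactSupport f := by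
  refine HasCompactSupport.of_support_subset_isCompact (isCompact_closedBall (0 : 𝔼) R) ?_
  intro x hx
  rw [mem_closedBall_zero_iff]
  by_contra hlt
  exact hx (h x (not_le.1 hlt))

theorem hasCompactSupport_bump : HasCompactSupport (bump : 𝔼 → ℝ) :=
  hasCompactSupport_of_norm (R := 2) fun _ hx => bump_of_ge hx.le

/-- The profile of `annulus`. -/
def annProfile (q s : ℝ) : ℝ := -2 * s ^ ((q + 2) / 2) * deriv cutoff s

/-- The power is singular only at `s = 0`, and the derivative of the cutoff vanishes for `s < 1`. -/
theorem contDiff_annProfile (q : ℝ) : ContDiff ℝ ∞ (annProfile q) := by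
  rw [contDiff_iff_contDiffAt]
  intro s
  rcases lt_or_ge s 1 with h | h
  · have : annProfile q =ᶠ[𝓝 s] fun _ => 0 := by
      filter_upwards [Iio_mem_nhds h] with t ht
      rw [annProfile, deriv_cutoff_of_lt ht, mul_zero]
    exact contDiffAt_const.congr_of_eventuallyEq this
  · have h0 : s ≠ 0 := by linarith
    unfold annProfile
    exact (contDiffAt_const.mul (contDiffAt_id.rpow_const_of_ne h0)).mul
      contDiff_deriv_cutoff.contDiffAt

/-- The function `- |x|^q x ⬝ ∇ bump`, which is supported in an annulus. -/
def annulus (q : ℝ) (x : 𝔼) : ℝ := annProfile q (‖x‖ ^ 2)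

theorem contDiff_annulus (q : ℝ) : ContDiff ℝ ∞ (annulus q : 𝔼 → ℝ) :=
  (contDiff_annProfile q).comp (contDiff_norm_sq ℝ)

theorem annulus_of_lt (q : ℝ) {x : 𝔼} (h : ‖x‖ < 1) : annulus q x = 0 := by
  rw [annulus, annProfile, deriv_cutoff_of_lt, mul_zero]
  exact pow_lt_one₀ (norm_nonneg _) h (by norm_num)

theorem annulus_of_ge (q : ℝ) {x : 𝔼} (h : 2 ≤ ‖x‖) : annulus q x = 0 := by
  rw [annulus, annProfile, deriv_cutoff_of_gt, mul_zero]
  nlinarith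

theorem hasCompactSupport_annulus (q : ℝ) : HasCompactSupport (annulus q : 𝔼 → ℝ) :=
  hasCompactSupport_of_norm (R := 2) fun _ hx => annulus_of_ge q hx.le

theorem annulus_radial (q : ℝ) (x y : 𝔼) (h : ‖x‖ = ‖y‖) : annulus q x = annulus q y := by
  rw [annulus, annulus, h]

/-! ### Truncated powers as superpositions of dilated annuli -/

/-- The truncation `|z|^q (bump (a z) - bump (b z))` of `|z|^q`. -/
def powBump (q a b : ℝ) (z : 𝔼) : ℝ := ‖z‖ ^ q * (bump (a • z) - bump (b • z))

theorem powBump_eq_zero_of_le {q a b : ℝ} (ha : 0 < a) (hab : a ≤ b) {z : 𝔼} (h : ‖z‖ ≤ b⁻¹) :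
    powBump q a b z = 0 := by
  have hb : 0 < b := ha.trans_le hab
  have h1 : ‖b • z‖ ≤ 1 := by
    rw [norm_smul, norm_of_nonneg hb.le]
    calc b * ‖z‖ ≤ b * b⁻¹ := by gcongr
      _ = 1 := mul_inv_cancel₀ hb.ne'
  have h2 : ‖a • z‖ ≤ 1 := by
    refine le_trans ?_ h1
    rw [norm_smul, norm_smul, norm_of_nonneg hb.le, norm_of_nonneg ha.le]; gcongr
  rw [powBump, bump_of_le h1, bump_of_le h2, sub_self, mul_zero]

theorem contDiff_powBump (q : ℝ) {a b : ℝ} (ha : 0 < a) (hab : a ≤ b) :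
    ContDiff ℝ ∞ (powBump q a b : 𝔼 → ℝ) := by
  have hb : 0 < b := ha.trans_le hab
  rw [contDiff_iff_contDiffAt]
  intro z
  rcases eq_or_ne z 0 with rfl | hz
  · have : (powBump q a b : 𝔼 → ℝ) =ᶠ[𝓝 0] fun _ => 0 := by
      filter_upwards [Metric.closedBall_mem_nhds (0 : 𝔼) (inv_pos.2 hb)] with z hz
      exact powBump_eq_zero_of_le ha hab (by simpa using hz)
    exact contDiffAt_const.congr_of_eventuallyEq this
  · unfold powBump
    refine ContDiffAt.mul ((contDiffAt_norm ℝ hz).rpow_const_of_ne (norm_ne_zero_iff.2 hz)) ?_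
    exact ((contDiff_comp_smul contDiff_bump a).sub (contDiff_comp_smul contDiff_bump b)).contDiffAt

theorem powBump_of_ge {q a b : ℝ} (ha : 0 < a) (hab : a ≤ b) {z : 𝔼} (h : 2 * a⁻¹ ≤ ‖z‖) :
    powBump q a b z = 0 := by
  have hb : 0 < b := ha.trans_le hab
  have h2 : 2 ≤ ‖a • z‖ := by
    rw [norm_smul, norm_of_nonneg ha.le]
    calc 2 = a * (2 * a⁻¹) := by field_simp
      _ ≤ _ := by gcongr
  have h1 : 2 ≤ ‖b • z‖ := by
    refine h2.trans ?_
    rw [norm_smul, norm_smul, norm_of_nonneg hb.le, norm_of_nonneg ha.le]; gcongr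
  rw [powBump, bump_of_ge h1, bump_of_ge h2, sub_self, mul_zero]

theorem hasCompactSupport_powBump (q : ℝ) {a b : ℝ} (ha : 0 < a) (hab : a ≤ b) :
    HasCompactSupport (powBump q a b : 𝔼 → ℝ) :=
  hasCompactSupport_of_norm (R := 2 * a⁻¹) fun _ hx => powBump_of_ge ha hab hx.le

theorem hasDerivAt_bump_smul (z : 𝔼) (v : ℝ) :
    HasDerivAt (fun v : ℝ => bump (v • z)) (2 * v * ‖z‖ ^ 2 * deriv cutoff (‖v • z‖ ^ 2)) v := by
  have h1 : HasDerivAt (fun v : ℝ => v ^ 2 * ‖z‖ ^ 2) (2 * v * ‖z‖ ^ 2) v := by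
    have := (hasDerivAt_pow 2 v).mul_const (‖z‖ ^ 2)
    simpa using this
  have h2 : HasDerivAt cutoff (deriv cutoff (‖v • z‖ ^ 2)) (v ^ 2 * ‖z‖ ^ 2) := by
    rw [norm_smul, mul_pow, norm_eq_abs, sq_abs]
    exact ((contDiff_cutoff.differentiable (by simp)) _).hasDerivAt
  have := h2.comp v h1
  have e : (fun v : ℝ => bump (v • z)) = cutoff ∘ fun v => v ^ 2 * ‖z‖ ^ 2 := by
    funext v; simp only [bump, Function.comp, norm_smul, mul_pow, norm_eq_abs, sq_abs]
  rw [e, mul_comm]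
  exact this

/-- The integrand equals `-|z|^q` times the derivative of `v ↦ bump (v • z)`, so this is the
fundamental theorem of calculus. -/
theorem powBump_eq_integral (q : ℝ) {a b : ℝ} (ha : 0 < a) (hab : a ≤ b) (z : 𝔼) :
    powBump q a b z = ∫ v in Ioc a b, v ^ (-q - 1) * annulus q (v • z) := by
  rcases eq_or_ne z 0 with rfl | hz
  · simp only [powBump, smul_zero, sub_self, mul_zero]
    rw [annulus_of_lt q (by simp)]; simp
  have hz0 : 0 < ‖z‖ := norm_pos_iff.2 hz
  rw [← intervalIntegral.integral_of_le hab]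
  have hftc : ∫ v in a..b, 2 * v * ‖z‖ ^ 2 * deriv cutoff (‖v • z‖ ^ 2) =
      bump (b • z) - bump (a • z) := by
    refine intervalIntegral.integral_eq_sub_of_hasDerivAt (fun v _ => hasDerivAt_bump_smul z v) ?_
    apply Continuous.intervalIntegrable
    have := contDiff_deriv_cutoff.continuous
    fun_prop
  have : ∫ v in a..b, v ^ (-q - 1) * annulus q (v • z) =
      ∫ v in a..b, -‖z‖ ^ q * (2 * v * ‖z‖ ^ 2 * deriv cutoff (‖v • z‖ ^ 2)) := by
    refine intervalIntegral.integral_congr fun v hv => ?_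
    rw [uIcc_of_le hab] at hv
    have hv0 : 0 < v := ha.trans_le hv.1
    simp only [annulus, annProfile]
    have e : (‖v • z‖ ^ 2) ^ ((q + 2) / 2) = v ^ (q + 2) * (‖z‖ ^ q * ‖z‖ ^ 2) := by
      rw [norm_smul, norm_of_nonneg hv0.le, ← rpow_natCast, ← rpow_mul (by positivity),
        mul_rpow hv0.le hz0.le, ← rpow_natCast ‖z‖ 2, ← rpow_add hz0]
      push_cast; ring_nf
    have e2 : v ^ (-q - 1) * v ^ (q + 2) = v := by
      rw [← rpow_add hv0]; ring_nf; simp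
    rw [e]
    calc _ = -‖z‖ ^ q * (2 * (v ^ (-q - 1) * v ^ (q + 2)) * ‖z‖ ^ 2 * deriv cutoff (‖v • z‖ ^ 2)) := by
          ring
      _ = _ := by rw [e2]
  rw [this, intervalIntegral.integral_const_mul, hftc, powBump]
  ring

/-- A dilation by `v` contributes `v^α`. The cutoff scales `a` and `b` now occur only as limits of
integration, with one fixed function under the integral. -/
theorem fracLaplacian_powBump {α : ℝ} (hα : 0 < α) (hα2 : α < 2) (q : ℝ) {a b : ℝ} (ha : 0 < a)
    (hab : a ≤ b) (z : 𝔼) : fracLaplacian α (powBump q a b) z =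
      ∫ v in Ioc a b, v ^ (α - q - 1) * fracLaplacian α (annulus q) (v • z) := by
  have h1 : (powBump q a b : 𝔼 → ℝ) = fun z => ∫ v in Ioc a b, v ^ (-q - 1) * annulus q (v • z) :=
    funext (powBump_eq_integral q ha hab)
  rw [h1, fracLaplacian_mixture hα hα2 (contDiff_annulus q) (hasCompactSupport_annulus q) ha]
  · refine setIntegral_congr_fun measurableSet_Ioc fun v hv => ?_
    have hv0 : 0 < v := ha.trans hv.1
    rw [← mul_assoc, ← rpow_add hv0]; ring_nf
  · exact continuousOn_id.rpow_const fun v hv => Or.inl (ha.trans_le hv.1).ne'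


/-! ### The constant `B_{p,α}` -/

theorem integrableOn_rpow_mul_gaussian {s : ℝ} (hs : -1 < s) :
    IntegrableOn (fun v : ℝ => v ^ s * Real.exp (-π * v ^ 2)) (Ioi 0) := by
  have := integrableOn_rpow_mul_exp_neg_mul_rpow (p := 2) (s := s) (b := π) hs (by norm_num)
    Real.pi_pos
  simpa only [rpow_two] using this

theorem integral_rpow_mul_gaussian {s : ℝ} (hs : -1 < s) :
    ∫ v in Ioi (0 : ℝ), v ^ s * Real.exp (-π * v ^ 2) =
      π ^ (-(s + 1) / 2) * (1 / 2) * Gamma ((s + 1) / 2) := by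
  have := integral_rpow_mul_exp_neg_mul_rpow (p := 2) (q := s) (b := π) (by norm_num) hs
    Real.pi_pos
  simpa only [rpow_two] using this

/-- Integration by parts turns the integral into a Gaussian moment, that is into `Γ(1 - q/2) =
-(q/2) Γ(-q/2)`. Since `Γ(1 - q/2) > 0`, the value `Γ(-q/2)` is negative, whence the absolute value.
-/
theorem heatConst_eq {q : ℝ} (hq : 0 < q) (hq2 : q < 2) :
    heatConst q = π ^ (q / 2) * (1 / 2) * |Gamma (-q / 2)| := by
  have hpi := Real.pi_pos
  set F : ℝ → ℝ := fun v => -(v ^ (-q) / q) * (1 - Real.exp (-π * v ^ 2)) with hF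
  have hbd : ∀ v : ℝ, 0 ≤ 1 - Real.exp (-π * v ^ 2) ∧ 1 - Real.exp (-π * v ^ 2) ≤ π * v ^ 2 ∧
      1 - Real.exp (-π * v ^ 2) ≤ 1 := by
    intro v
    have h1 := Real.add_one_le_exp (-π * v ^ 2)
    have h2 : Real.exp (-π * v ^ 2) ≤ 1 := by
      rw [Real.exp_le_one_iff]; nlinarith [sq_nonneg v]
    have h3 := Real.exp_pos (-π * v ^ 2)
    exact ⟨by linarith, by linarith, by linarith⟩
  have hg := integrableOn_rpow_mul_gaussian (s := 1 - q) (by linarith)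
  have hint := (integrableOn_heatConst hq hq2).sub (hg.const_mul (2 * π / q))
  -- The conventional value of `v^(-q)` at `0` plays no role, since the other factor vanishes there;
  -- continuity at `0` comes from `F v = O(v^(2-q))`.
  have hF0 : F 0 = 0 := by simp [hF]
  have hFtc := integral_Ioi_of_hasDerivAt_of_tendsto (f := F) (a := 0) (m := 0) (f' := fun v =>
      v ^ (-q - 1) * (1 - Real.exp (-π * v ^ 2)) -
        2 * π / q * (v ^ (1 - q) * Real.exp (-π * v ^ 2))) ?_ ?_ hint ?_
  · rw [integral_sub (integrableOn_heatConst hq hq2) (hg.const_mul (2 * π / q)),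
      integral_const_mul, integral_rpow_mul_gaussian (by linarith), hF0, sub_zero, sub_eq_zero] at hFtc
    rw [heatConst, hFtc]
    have hΓ : Gamma (-q / 2 + 1) = -q / 2 * Gamma (-q / 2) := Gamma_add_one (by linarith)
    have hpos : 0 < Gamma (-q / 2 + 1) := Gamma_pos_of_pos (by linarith)
    have hneg : Gamma (-q / 2) < 0 := by
      rw [hΓ] at hpos; nlinarith
    rw [abs_of_neg hneg, show (1 - q + 1) / 2 = -q / 2 + 1 by ring, hΓ,
      show -(1 - q + 1) / 2 = q / 2 + (-1 : ℝ) by ring, rpow_add hpi, rpow_neg_one]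
    field_simp
  · rw [ContinuousWithinAt, hF0]
    have h1 : Tendsto (fun v : ℝ => π / q * v ^ (2 - q)) (𝓝[Ici 0] 0) (𝓝 0) := by
      have : ContinuousAt (fun v : ℝ => π / q * v ^ (2 - q)) 0 :=
        continuousAt_const.mul (continuousAt_rpow_const _ _ (Or.inr (by linarith)))
      have h2 := this.tendsto
      simp only [zero_rpow (show 2 - q ≠ 0 by linarith), mul_zero] at h2
      exact h2.mono_left nhdsWithin_le_nhds
    refine squeeze_zero_norm' ?_ h1
    filter_upwards [self_mem_nhdsWithin] with v hv
    rcases eq_or_lt_of_le (show (0 : ℝ) ≤ v from hv) with h | h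
    · rw [← h, hF0, norm_zero, zero_rpow (by linarith), mul_zero]
    · obtain ⟨e1, e2, -⟩ := hbd v
      rw [hF, norm_mul, norm_neg, norm_of_nonneg (by positivity), norm_of_nonneg e1]
      calc v ^ (-q) / q * (1 - Real.exp (-π * v ^ 2)) ≤ v ^ (-q) / q * (π * v ^ 2) := by gcongr
        _ = π / q * (v ^ (-q) * v ^ (2 : ℝ)) := by rw [rpow_two]; ring
        _ = _ := by rw [← rpow_add h]; ring_nf
  · intro v hv
    have hv : 0 < v := hv
    have h1 : HasDerivAt (fun v : ℝ => -(v ^ (-q) / q)) (v ^ (-q - 1)) v := by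
      have := ((hasDerivAt_rpow_const (x := v) (p := -q) (Or.inl hv.ne')).div_const q).neg
      refine this.congr_deriv ?_
      rw [neg_mul, neg_div, neg_neg, mul_div_cancel_left₀ _ hq.ne']
    have h2 : HasDerivAt (fun v : ℝ => 1 - Real.exp (-π * v ^ 2))
        (2 * π * v * Real.exp (-π * v ^ 2)) v := by
      have := (((hasDerivAt_pow 2 v).const_mul (-π)).exp).const_sub 1
      refine this.congr_deriv ?_
      push_cast; ring
    refine (h1.mul h2).congr_deriv ?_
    have : v ^ (1 - q) = v ^ (-q) * v := by
      rw [sub_eq_add_neg, add_comm, rpow_add hv, rpow_one]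
    rw [this]; ring
  · have h1 : Tendsto (fun v : ℝ => q⁻¹ * v ^ (-q)) atTop (𝓝 0) := by
      simpa using (tendsto_rpow_neg_atTop hq).const_mul q⁻¹
    refine squeeze_zero_norm' ?_ h1
    filter_upwards [eventually_gt_atTop 0] with v hv
    obtain ⟨e1, -, e2⟩ := hbd v
    rw [hF, norm_mul, norm_neg, norm_of_nonneg (by positivity), norm_of_nonneg e1]
    calc v ^ (-q) / q * (1 - Real.exp (-π * v ^ 2)) ≤ v ^ (-q) / q * 1 := by gcongr
      _ = _ := by ring

/-! ### Radial integrals against the Gaussian -/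

theorem pow_mul_rpow_gaussian [NeZero d] (s : ℝ) {y : ℝ} (hy : 0 < y) :
    y ^ (d - 1) • (Real.exp (-π * y ^ 2) * y ^ s) = y ^ (d - 1 + s) * Real.exp (-π * y ^ 2) := by
  have hd : 1 ≤ d := NeZero.one_le
  rw [smul_eq_mul, rpow_add hy, ← rpow_natCast, Nat.cast_sub hd, Nat.cast_one]; ring

theorem integrable_gauss_mul_rpow [NeZero d] {s : ℝ} (hs : -d < s) :
    Integrable (fun x : 𝔼 => gauss x * ‖x‖ ^ s) := by
  have h := integrable_fun_norm_addHaar (E := 𝔼) volume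
    (f := fun y : ℝ => Real.exp (-π * y ^ 2) * y ^ s)
  refine h.2 ?_
  rw [finrank_euclideanSpace_fin]
  refine (integrableOn_rpow_mul_gaussian (s := d - 1 + s) (by linarith)).congr ?_
  filter_upwards [ae_restrict_mem measurableSet_Ioi] with y hy
  exact (pow_mul_rpow_gaussian s hy).symm

theorem integral_gauss_mul_rpow [NeZero d] {s : ℝ} (hs : -d < s) :
    ∫ x : 𝔼, gauss x * ‖x‖ ^ s = d • (volume : Measure 𝔼).real (Metric.ball 0 1) •
      (π ^ (-(d + s) / 2) * (1 / 2) * Gamma ((d + s) / 2)) := by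
  have h := integral_fun_norm_addHaar (E := 𝔼) volume
    (f := fun y : ℝ => Real.exp (-π * y ^ 2) * y ^ s)
  rw [finrank_euclideanSpace_fin] at h
  refine h.trans ?_
  congr 2
  have := integral_rpow_mul_gaussian (s := d - 1 + s) (by linarith)
  rw [show (d : ℝ) - 1 + s + 1 = d + s by ring] at this
  rw [← this]
  exact setIntegral_congr_fun measurableSet_Ioi fun y hy => pow_mul_rpow_gaussian s hy

theorem integral_rpow_mul_radial {F : 𝔼 → ℝ} (hF : ∀ x y, ‖x‖ = ‖y‖ → F x = F y) {e₀ : 𝔼}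
    (he₀ : ‖e₀‖ = 1) (e : ℝ) {z : 𝔼} (hz : z ≠ 0) :
    ∫ v in Ioi (0 : ℝ), v ^ e * F (v • z) =
      ‖z‖ ^ (-e - 1) * ∫ v in Ioi (0 : ℝ), v ^ e * F (v • e₀) := by
  rw [← integral_Ioi_rpow_mul_comp_mul (fun v => F (v • e₀)) e (norm_pos_iff.2 hz)]
  refine setIntegral_congr_fun measurableSet_Ioi fun v _ => ?_
  rw [hF (v • z) ((‖z‖ * v) • e₀) (by simp [norm_smul, he₀, mul_comm])]

theorem integrableOn_rpow_mul_radial {F : 𝔼 → ℝ} (hF : ∀ x y, ‖x‖ = ‖y‖ → F x = F y) {e₀ : 𝔼}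
    (he₀ : ‖e₀‖ = 1) {e : ℝ} (hi : IntegrableOn (fun v : ℝ => v ^ e * F (v • e₀)) (Ioi 0))
    {z : 𝔼} (hz : z ≠ 0) : IntegrableOn (fun v : ℝ => v ^ e * F (v • z)) (Ioi 0) := by
  refine (integrableOn_Ioi_rpow_mul_comp_mul (F := fun v => F (v • e₀)) hi
    (norm_pos_iff.2 hz)).congr (ae_of_all _ fun v => ?_)
  simp only
  rw [hF (v • z) ((‖z‖ * v) • e₀) (by simp [norm_smul, he₀, mul_comm])]

theorem ae_ne_zero [NeZero d] : ∀ᵐ x : 𝔼, x ≠ 0 := by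
  have : (volume : Measure 𝔼) {0} = 0 := measure_singleton 0
  filter_upwards [measure_eq_zero_iff_ae_notMem.1 this] with x hx using hx

/-- After Fubini, the inner integral over dilations is homogeneous in `x`, so the double integral
splits into a radial constant and a Gaussian moment. The condition on `e` says that this moment has
exponent above `-d`. It is used to read off the unknown constant of a homogeneous function. -/
theorem integral_rpow_mul_integral_gauss_radial [NeZero d] {F : 𝔼 → ℝ} (hFc : Continuous F)
    (hF : ∀ x y, ‖x‖ = ‖y‖ → F x = F y) {e₀ : 𝔼} (he₀ : ‖e₀‖ = 1) {e : ℝ} (he : e < d - 1)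
    (hi : IntegrableOn (fun v : ℝ => v ^ e * F (v • e₀)) (Ioi 0)) :
    ∫ v in Ioi (0 : ℝ), v ^ e * ∫ x, gauss x * F (v • x) =
      (∫ v in Ioi (0 : ℝ), v ^ e * F (v • e₀)) * ∫ x : 𝔼, gauss x * ‖x‖ ^ (-e - 1) := by
  have hsw : ∫ x : 𝔼, ∫ v in Ioi (0 : ℝ), gauss x * (v ^ e * F (v • x)) =
      ∫ v in Ioi (0 : ℝ), ∫ x : 𝔼, gauss x * (v ^ e * F (v • x)) := by
    refine integral_integral_swap ?_
    have hm : Measurable (Function.uncurry fun (x : 𝔼) (v : ℝ) => gauss x * (v ^ e * F (v • x))) := by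
      have h1 : Measurable (fun p : 𝔼 × ℝ => F (p.2 • p.1)) := (hFc.comp (by fun_prop)).measurable
      have h2 : Measurable (fun p : 𝔼 × ℝ => p.2 ^ e) := by fun_prop
      exact (continuous_gauss.measurable.comp measurable_fst).mul (h2.mul h1)
    rw [integrable_prod_iff hm.aestronglyMeasurable]
    constructor
    · filter_upwards [ae_ne_zero] with x hx
      exact (integrableOn_rpow_mul_radial hF he₀ hi hx).const_mul (gauss x)
    · have h1 := (integrable_gauss_mul_rpow (d := d) (s := -e - 1) (by linarith)).mul_const
        (∫ v in Ioi (0 : ℝ), v ^ e * |F (v • e₀)|)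
      refine h1.congr ?_
      filter_upwards [ae_ne_zero] with x hx
      have := integral_rpow_mul_radial (F := fun x => |F x|)
        (fun x y h => by simp only [hF x y h]) he₀ e hx
      rw [mul_assoc, ← this, ← integral_const_mul]
      refine setIntegral_congr_fun measurableSet_Ioi fun v hv => ?_
      simp only [Function.uncurry, norm_mul]
      rw [norm_of_nonneg (gauss_pos x).le, norm_of_nonneg (rpow_nonneg (le_of_lt hv) _), norm_eq_abs]
  calc _ = ∫ v in Ioi (0 : ℝ), ∫ x : 𝔼, gauss x * (v ^ e * F (v • x)) := by
        refine setIntegral_congr_fun measurableSet_Ioi fun v _ => ?_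
        rw [← integral_const_mul]
        congr 1; ext x; ring
    _ = _ := by
        rw [← hsw, ← integral_const_mul]
        refine integral_congr_ae ?_
        filter_upwards [ae_ne_zero] with x hx
        rw [integral_const_mul, integral_rpow_mul_radial hF he₀ e hx]
        ring

/-- At a given `z` only dilations with `1 ≤ v ‖z‖ ≤ 2` contribute, so the integral over a
sufficiently large bounded interval is already the full one, and there both cutoffs are inactive. -/
theorem integral_rpow_mul_annulus (q : ℝ) {z : 𝔼} (hz : z ≠ 0) :
    ∫ v in Ioi (0 : ℝ), v ^ (-q - 1) * annulus q (v • z) = ‖z‖ ^ q := by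
  have hz0 : 0 < ‖z‖ := norm_pos_iff.2 hz
  have h := powBump_eq_integral q (a := (2 * ‖z‖)⁻¹) (b := 2 * ‖z‖⁻¹) (by positivity)
    (by rw [mul_inv]; gcongr; norm_num) z
  have h1 : powBump q (2 * ‖z‖)⁻¹ (2 * ‖z‖⁻¹) z = ‖z‖ ^ q := by
    rw [powBump, bump_of_le, bump_of_ge]
    · simp
    · rw [norm_smul, norm_of_nonneg (by positivity), mul_assoc, inv_mul_cancel₀ hz0.ne', mul_one]
    · rw [norm_smul, norm_of_nonneg (by positivity), mul_inv, mul_assoc, inv_mul_cancel₀ hz0.ne']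
      norm_num
  rw [← h1, h]
  refine setIntegral_eq_of_subset_of_forall_sdiff_eq_zero measurableSet_Ioi
    (fun v hv => lt_trans (by positivity) hv.1) fun v hv => ?_
  have hv0 : 0 < v := hv.1
  have hn : ‖v • z‖ = v * ‖z‖ := by rw [norm_smul, norm_of_nonneg hv0.le]
  by_cases h2 : (2 * ‖z‖)⁻¹ < v
  · have h3 : 2 * ‖z‖⁻¹ < v := by
      by_contra hh
      exact hv.2 ⟨h2, not_lt.1 hh⟩
    rw [annulus_of_ge, mul_zero]
    rw [hn]
    calc 2 = 2 * ‖z‖⁻¹ * ‖z‖ := by field_simp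
      _ ≤ _ := by gcongr
  · rw [annulus_of_lt, mul_zero]
    rw [hn]
    calc v * ‖z‖ ≤ (2 * ‖z‖)⁻¹ * ‖z‖ := by gcongr; exact not_lt.1 h2
      _ = 1 / 2 := by field_simp
      _ < 1 := by norm_num


theorem exists_unit_vector [NeZero d] : ∃ e : 𝔼, ‖e‖ = 1 := exists_norm_eq 𝔼 zero_le_one

theorem integrableOn_rpow_mul_of_decay {α p K : ℝ} (hp : 0 < p) (hpα : p < α) {g : ℝ → ℝ}
    (hg : Continuous g) (h1 : ∀ v, |g v| ≤ K) (h2 : ∀ v, 0 < v → v ^ α * |g v| ≤ K) :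
    IntegrableOn (fun v : ℝ => v ^ (α - p - 1) * g v) (Ioi 0) := by
  refine integrableOn_Ioi_of_power_bounds (A := K) (B := K) (a := α - p - 1) (b := -p - 1)
    (by linarith) (by linarith) (by
      apply Measurable.aestronglyMeasurable
      have := hg.measurable
      fun_prop) ?_ ?_
  · intro v hv _
    rw [abs_mul, abs_of_nonneg (rpow_nonneg hv.le _), mul_comm]
    gcongr
    exact h1 v
  · intro v hv
    have hv0 : 0 < v := by linarith
    rw [abs_mul, abs_of_nonneg (rpow_nonneg hv0.le _)]
    calc v ^ (α - p - 1) * |g v| = v ^ (-p - 1) * (v ^ α * |g v|) := by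
          rw [← mul_assoc, ← rpow_add hv0]; ring_nf
      _ ≤ v ^ (-p - 1) * K := by gcongr; exact h2 v hv0
      _ = _ := mul_comm _ _

/-- Near `v = 0` boundedness and `p < α` suffice. At infinity the decay of order `v^(-α)` leaves
`v^(-p-1)`. -/
theorem integrableOn_fracLaplacian_annulus [NeZero d] {α p : ℝ} (hp : 0 < p) (hpα : p < α)
    (hα2 : α < 2) (q : ℝ) {z : 𝔼} (hz : z ≠ 0) :
    IntegrableOn (fun v : ℝ => v ^ (α - p - 1) * fracLaplacian α (annulus q) (v • z)) (Ioi 0) := by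
  obtain ⟨e₀, he₀⟩ := exists_unit_vector (d := d)
  have hα : 0 < α := by linarith
  have hr := fun x y h => fracLaplacian_radial α (annulus_radial (d := d) q) (x := x) (y := y) h
  refine integrableOn_rpow_mul_radial hr he₀ ?_ hz
  obtain ⟨K, hK, hb⟩ := exists_decay_fracLaplacian hα hα2 (contDiff_annulus (d := d) q)
    (hasCompactSupport_annulus q)
  refine integrableOn_rpow_mul_of_decay (K := K) (g := fun v => fracLaplacian α (annulus q) (v • e₀))
    hp hpα ?_ (fun v => (hb _).1) fun v hv => ?_
  · exact (continuous_fracLaplacian hα hα2 (contDiff_annulus q)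
      (hasCompactSupport_annulus q)).comp (by fun_prop)
  · have := (hb (v • e₀)).2
    rwa [norm_smul, he₀, mul_one, norm_of_nonneg hv.le] at this

theorem rpow_mul_fracSymbol (α : ℝ) {p : ℝ} (φ : 𝔼 → ℝ) {ξ : 𝔼} (hξ : ξ ≠ 0) :
    ((‖ξ‖ ^ (p - α) : ℝ) : ℂ) * fracSymbol α φ ξ = (((2 * π) ^ α : ℝ) : ℂ) *
      (((‖ξ‖ ^ p : ℝ) : ℂ) * 𝓕 (fun y : 𝔼 => (φ y : ℂ)) ξ) := by
  rw [fracSymbol_eq]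
  have : ‖ξ‖ ^ p = ‖ξ‖ ^ (p - α) * ‖ξ‖ ^ α := by
    rw [← rpow_add (norm_pos_iff.2 hξ)]; ring_nf
  rw [this]; push_cast; ring

/-- On the frequency side, integrating `gauss (v • ξ)` over `v` produces `‖ξ‖^(p-α)`. This cancels
the factor `‖ξ‖^α` of the symbol against the target power, and only `‖ξ‖^p 𝓕 φ` remains, with an
explicit Gaussian constant. -/
theorem integral_rpow_mul_integral_gauss_fracLaplacian [NeZero d] {α p : ℝ} (hp : 0 < p)
    (hpα : p < α) (hα2 : α < 2) {φ : 𝔼 → ℝ} (hφ : ContDiff ℝ ∞ φ) (hc : HasCompactSupport φ) :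
    ((∫ v in Ioi (0 : ℝ), v ^ (α - p - 1) * ∫ x, gauss x * fracLaplacian α φ (v • x) : ℝ) : ℂ) =
      (((2 * π) ^ α * ∫ v in Ioi (0 : ℝ), v ^ (α - p - 1) * Real.exp (-π * v ^ 2) : ℝ) : ℂ) *
      ∫ ξ : 𝔼, ((‖ξ‖ ^ p : ℝ) : ℂ) * 𝓕 (fun y : 𝔼 => (φ y : ℂ)) ξ := by
  have hα : 0 < α := by linarith
  have hS := integrable_fracSymbol hα hα2 hφ hc
  set κ := ∫ v in Ioi (0 : ℝ), v ^ (α - p - 1) * Real.exp (-π * v ^ 2) with hκ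
  have hinner : ∀ v : ℝ, ((∫ x, gauss x * fracLaplacian α φ (v • x) : ℝ) : ℂ) =
      ∫ ξ, (gauss (v • ξ) : ℂ) * fracSymbol α φ ξ := by
    intro v
    have := integral_gauss_mul_fourierInv hS 0 v
    simp only [zero_add, inner_zero_right, mul_zero, Complex.ofReal_zero, zero_mul,
      Complex.exp_zero, one_mul] at this
    rw [← this, ← integral_complex_ofReal]
    congr 1; ext x
    rw [fourierInv_fracSymbol_eq hα hα2 hφ hc]; push_cast; rfl
  have hgi : ∀ ξ : 𝔼, ξ ≠ 0 →
      IntegrableOn (fun v : ℝ => v ^ (α - p - 1) * gauss (v • ξ)) (Ioi 0) ∧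
      ∫ v in Ioi (0 : ℝ), v ^ (α - p - 1) * gauss (v • ξ) = ‖ξ‖ ^ (p - α) * κ := by
    intro ξ hξ
    simp_rw [gauss_smul]
    constructor
    · exact integrableOn_Ioi_rpow_mul_comp_mul (F := fun v => Real.exp (-π * v ^ 2))
        (integrableOn_rpow_mul_gaussian (by linarith)) (norm_pos_iff.2 hξ)
    · rw [integral_Ioi_rpow_mul_comp_mul (fun v => Real.exp (-π * v ^ 2)) _ (norm_pos_iff.2 hξ)]
      congr 2; ring
  have hsw : ∫ ξ : 𝔼, ∫ v in Ioi (0 : ℝ), ((v ^ (α - p - 1) * gauss (v • ξ) : ℝ) : ℂ) *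
        fracSymbol α φ ξ =
      ∫ v in Ioi (0 : ℝ), ∫ ξ : 𝔼, ((v ^ (α - p - 1) * gauss (v • ξ) : ℝ) : ℂ) *
        fracSymbol α φ ξ := by
    refine integral_integral_swap ?_
    have hm : Measurable (Function.uncurry fun (ξ : 𝔼) (v : ℝ) =>
        ((v ^ (α - p - 1) * gauss (v • ξ) : ℝ) : ℂ) * fracSymbol α φ ξ) := by
      have h1 : Measurable (fun p : 𝔼 × ℝ => gauss (p.2 • p.1)) :=
        (continuous_gauss.comp (by fun_prop)).measurable
      have h2 : Measurable (fun q : 𝔼 × ℝ => q.2 ^ (α - p - 1)) := by fun_prop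
      exact (Complex.measurable_ofReal.comp (h2.mul h1)).mul
        ((continuous_fracSymbol hα hφ hc).measurable.comp measurable_fst)
    rw [integrable_prod_iff hm.aestronglyMeasurable]
    constructor
    · filter_upwards [ae_ne_zero] with ξ hξ
      exact (hgi ξ hξ).1.ofReal.mul_const (fracSymbol α φ ξ)
    · have h1 := ((integrable_rpow_mul_fourier hφ hc hp.le (hpα.trans hα2).le).const_mul
        (((2 * π) ^ α : ℝ) : ℂ)).norm.const_mul κ
      refine h1.congr ?_
      filter_upwards [ae_ne_zero] with ξ hξ
      rw [← rpow_mul_fracSymbol α φ hξ]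
      simp only [Function.uncurry, norm_mul, Complex.norm_real]
      rw [integral_mul_const, norm_of_nonneg (show 0 ≤ ‖ξ‖ ^ (p - α) by positivity), ← mul_assoc,
        mul_comm κ, ← (hgi ξ hξ).2]
      congr 1
      refine setIntegral_congr_fun measurableSet_Ioi fun v hv => ?_
      rw [norm_of_nonneg (rpow_nonneg (le_of_lt hv) _), norm_of_nonneg (gauss_pos _).le]
  calc _ = ∫ v in Ioi (0 : ℝ), ∫ ξ : 𝔼, ((v ^ (α - p - 1) * gauss (v • ξ) : ℝ) : ℂ) *
        fracSymbol α φ ξ := by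
        rw [← integral_complex_ofReal]
        refine setIntegral_congr_fun measurableSet_Ioi fun v _ => ?_
        rw [Complex.ofReal_mul, hinner, ← integral_const_mul]
        congr 1; ext ξ; push_cast; ring
    _ = _ := by
        rw [← hsw, ← integral_const_mul]
        refine integral_congr_ae ?_
        filter_upwards [ae_ne_zero] with ξ hξ
        rw [integral_mul_const, integral_complex_ofReal, (hgi ξ hξ).2, Complex.ofReal_mul,
          Complex.ofReal_mul, mul_right_comm, rpow_mul_fracSymbol α φ hξ]
        ring

/-- This is the heat representation of order `p` at the origin. The annulus function vanishes there,
and its Gaussian averages integrate over all scales to the `p`-th Gaussian moment. -/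
theorem heatConst_mul_integral_annulus [NeZero d] {p : ℝ} (hp : 0 < p) (hp2 : p < 2) :
    (heatConst p : ℂ) * ∫ ξ : 𝔼, ((‖ξ‖ ^ p : ℝ) : ℂ) *
      𝓕 (fun y : 𝔼 => (annulus p y : ℂ)) ξ = ((-∫ x : 𝔼, gauss x * ‖x‖ ^ p : ℝ) : ℂ) := by
  obtain ⟨e₀, he₀⟩ := exists_unit_vector (d := d)
  have h := heat_representation (contDiff_annulus (d := d) p) (hasCompactSupport_annulus p) hp hp2 0
  simp only [inner_zero_right, mul_zero, Complex.ofReal_zero, zero_mul, Complex.exp_zero,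
    one_mul, zero_add] at h
  rw [h, annulus_of_lt p (by simp)]
  congr 1
  have hi : IntegrableOn (fun v : ℝ => v ^ (-p - 1) * annulus p (v • e₀)) (Ioi 0) := by
    -- The Bochner integral of a non-integrable function is `0` by convention, whereas this one
    -- equals `‖e₀‖^p = 1`.
    by_contra hni
    have := integral_rpow_mul_annulus p (z := e₀) (by rintro rfl; simp at he₀)
    rw [integral_undef hni, he₀, one_rpow] at this
    norm_num at this
  have hd : (1 : ℝ) ≤ d := by exact_mod_cast (NeZero.one_le : 1 ≤ d)
  have := integral_rpow_mul_integral_gauss_radial (contDiff_annulus (d := d) p).continuous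
    (annulus_radial p) he₀ (e := -p - 1) (by linarith) hi
  rw [integral_rpow_mul_annulus p (by rintro rfl; simp at he₀), he₀, one_rpow, one_mul,
    show -(-p - 1) - 1 = p by ring] at this
  rw [← this, ← integral_neg]
  congr 1; ext v
  rw [← mul_neg, ← integral_neg]
  congr 2; ext y; ring

/-- The fractional Laplacian of `|z|^p` is `-B_{p,α} |z|^(p-α)`, with `|z|^p` written as
a superposition of dilated annuli. -/
theorem integral_rpow_mul_fracLaplacian_annulus [NeZero d] {α p : ℝ} (hp : 1 < p) (hpα : p < α)
    (hα2 : α < 2) {z : 𝔼} (hz : z ≠ 0) :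
    ∫ v in Ioi (0 : ℝ), v ^ (α - p - 1) * fracLaplacian α (annulus p) (v • z) =
      -Bconst d p α * ‖z‖ ^ (p - α) := by
  obtain ⟨e₀, he₀⟩ := exists_unit_vector (d := d)
  have he₀0 : e₀ ≠ 0 := by rintro rfl; simp at he₀
  have hp0 : 0 < p := by linarith
  have hα : 0 < α := by linarith
  have hpi := Real.pi_pos
  have hd : (1 : ℝ) ≤ d := by exact_mod_cast (NeZero.one_le : 1 ≤ d)
  have hsm := contDiff_annulus (d := d) p
  have hcs := hasCompactSupport_annulus (d := d) p
  have hr := fun x y h => fracLaplacian_radial α (annulus_radial (d := d) p) (x := x) (y := y) h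
  have hi := integrableOn_fracLaplacian_annulus (d := d) hp0 hpα hα2 p he₀0
  rw [integral_rpow_mul_radial hr he₀ _ hz, show -(α - p - 1) - 1 = p - α by ring, mul_comm]
  congr 1
  set A := ∫ v in Ioi (0 : ℝ), v ^ (α - p - 1) * fracLaplacian α (annulus p) (v • e₀) with hA
  have h1 := integral_rpow_mul_integral_gauss_radial (continuous_fracLaplacian hα hα2 hsm hcs)
    hr he₀ (e := α - p - 1) (by linarith) hi
  have h2 := integral_rpow_mul_integral_gauss_fracLaplacian hp0 hpα hα2 hsm hcs
  have h3 := heatConst_mul_integral_annulus (d := d) hp0 (hpα.trans hα2)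
  rw [h1, ← hA, show -(α - p - 1) - 1 = p - α by ring] at h2
  set M₁ := ∫ x : 𝔼, gauss x * ‖x‖ ^ (p - α) with hM₁
  set M₂ := ∫ x : 𝔼, gauss x * ‖x‖ ^ p with hM₂
  -- The Gaussian pairing is evaluated twice: by homogeneity, which brings in the unknown `A`, and
  -- by Fourier inversion. Comparing the two determines `A`, since every other factor is an explicit
  -- Gamma integral.
  have h4 : heatConst p * (A * M₁) =
      ((2 * π) ^ α * ∫ v in Ioi (0 : ℝ), v ^ (α - p - 1) * Real.exp (-π * v ^ 2)) * -M₂ := by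
    have : (heatConst p : ℂ) * ((A * M₁ : ℝ) : ℂ) =
        (((2 * π) ^ α * ∫ v in Ioi (0 : ℝ), v ^ (α - p - 1) * Real.exp (-π * v ^ 2) : ℝ) : ℂ) *
          ((-M₂ : ℝ) : ℂ) := by
      rw [h2, ← h3]; ring
    exact_mod_cast this
  rw [integral_rpow_mul_gaussian (by linarith), heatConst_eq hp0 (hpα.trans hα2), hM₁, hM₂,
    integral_gauss_mul_rpow (by linarith), integral_gauss_mul_rpow (by linarith), nsmul_eq_mul,
    nsmul_eq_mul, smul_eq_mul, smul_eq_mul] at h4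
  have hv : 0 < (volume : Measure 𝔼).real (Metric.ball 0 1) :=
    ENNReal.toReal_pos (Metric.measure_ball_pos _ _ one_pos).ne' measure_ball_lt_top.ne
  have hG1 : 0 < Gamma ((d + (p - α)) / 2) := Gamma_pos_of_pos (by linarith)
  -- The poles, where the convention gives the value `0`, are the nonpositive integers, and `-p / 2`
  -- lies strictly between `-1` and `0`.
  have hG2 : Gamma (-p / 2) ≠ 0 := by
    refine Gamma_ne_zero fun m hm => ?_
    have e1 : p = 2 * m := by linarith
    have e2 : p < 2 := by linarith
    rw [e1] at hp e2
    have l1 : (0 : ℝ) < m := by linarith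
    have l2 : (m : ℝ) < 1 := by linarith
    norm_cast at l1 l2
    omega
  have hG3 : 0 < |Gamma (-p / 2)| := abs_pos.2 hG2
  rw [Bconst, show (d : ℝ) + p - α = d + (p - α) by ring,
    show (α - p) / 2 = (α - p - 1 + 1) / 2 by ring]
  have hpow : (2 * π) ^ α * π ^ (-(α - p - 1 + 1) / 2) * π ^ (-(d + p) / 2) =
      2 ^ α * (π ^ (p / 2) * π ^ (-(d + (p - α)) / 2)) := by
    rw [mul_rpow (by norm_num) hpi.le, mul_assoc, mul_assoc, ← rpow_add hpi, ← rpow_add hpi,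
      ← rpow_add hpi]
    ring_nf
  have hP : 0 < π ^ (p / 2) * π ^ (-(d + (p - α)) / 2) := by positivity
  set P := π ^ (p / 2) * π ^ (-(d + (p - α)) / 2) with hPdef
  set v₁ := (volume : Measure 𝔼).real (Metric.ball 0 1)
  set g₁ := Gamma ((d + (p - α)) / 2)
  set g₂ := |Gamma (-p / 2)|
  set g₃ := Gamma ((α - p - 1 + 1) / 2)
  set g₄ := Gamma ((d + p) / 2)
  have h5 : (d * v₁ * P) * (g₂ * g₁ * A) = (d * v₁ * P) * (-(2 ^ α * g₄ * g₃)) := by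
    have e1 : (d * v₁ * P) * (g₂ * g₁ * A) = 4 * (π ^ (p / 2) * (1 / 2) * g₂ * (A * (d * (v₁ *
      (π ^ (-(d + (p - α)) / 2) * (1 / 2) * g₁))))) := by rw [hPdef]; ring
    rw [e1, h4]
    linear_combination (-(d * v₁ * g₃ * g₄)) * hpow
  have h6 := mul_left_cancel₀ (by positivity : (d * v₁ * P) ≠ 0) h5
  rw [← neg_div, eq_div_iff (by positivity)]
  linarith


/-! ### Pointwise bounds -/

/-- The regularized norm `max (1/b) |z|`. -/
def reg (b : ℝ) (z : 𝔼) : ℝ := max b⁻¹ ‖z‖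

theorem reg_pos {b : ℝ} (hb : 0 < b) (z : 𝔼) : 0 < reg b z := lt_max_of_lt_left (inv_pos.2 hb)

theorem reg_rpow_of_le {b : ℝ} (hb : 0 < b) (q : ℝ) {z : 𝔼} (h : ‖z‖ ≤ b⁻¹) :
    reg b z ^ q = b ^ (-q) := by
  rw [reg, max_eq_left h, inv_rpow hb.le, rpow_neg hb.le]

theorem reg_rpow_of_ge {b : ℝ} (q : ℝ) {z : 𝔼} (h : b⁻¹ ≤ ‖z‖) :
    reg b z ^ q = ‖z‖ ^ q := by
  rw [reg, max_eq_right h]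

theorem reg_rpow_le {b : ℝ} (hb : 0 < b) {q : ℝ} (hq : q ≤ 0) (z : 𝔼) :
    reg b z ^ q ≤ b ^ (-q) := by
  rw [rpow_neg hb.le, ← inv_rpow hb.le]
  exact rpow_le_rpow_of_nonpos (inv_pos.2 hb) (le_max_left _ _) hq

theorem reg_rpow_le_norm {b : ℝ} {q : ℝ} (hq : q ≤ 0) {z : 𝔼} (hz : z ≠ 0) :
    reg b z ^ q ≤ ‖z‖ ^ q :=
  rpow_le_rpow_of_nonpos (norm_pos_iff.2 hz) (le_max_right _ _) hq

theorem continuous_reg_rpow {b : ℝ} (hb : 0 < b) (q : ℝ) :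
    Continuous (fun z : 𝔼 => reg b z ^ q) := by
  have : Continuous (fun z : 𝔼 => reg b z) := continuous_const.max continuous_norm
  exact this.rpow_const fun z => Or.inl (reg_pos hb z).ne'

/-- A dominating function for the contribution of large `|z|`. -/
def tail (p α a : ℝ) (z : 𝔼) : ℝ := ‖z‖ ^ p * min 1 ((a * ‖z‖) ^ (α - p))

theorem tail_nonneg (p α : ℝ) {a : ℝ} (ha : 0 ≤ a) (z : 𝔼) : 0 ≤ tail p α a z := by
  unfold tail; positivity

theorem tail_le (p α a : ℝ) (z : 𝔼) : tail p α a z ≤ ‖z‖ ^ p :=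
  mul_le_of_le_one_right (by positivity) (min_le_left _ _)

theorem tail_of_ge {p α a : ℝ} (hpα : p < α) {z : 𝔼} (h : 1 ≤ a * ‖z‖) :
    tail p α a z = ‖z‖ ^ p := by
  rw [tail, min_eq_left (one_le_rpow h (by linarith)), mul_one]

theorem integral_Ioc_rpow_sub_one {s b : ℝ} (hs : 0 < s) (hb : 0 ≤ b) :
    IntegrableOn (fun v : ℝ => v ^ (s - 1)) (Ioc 0 b) ∧
      ∫ v in Ioc 0 b, v ^ (s - 1) = b ^ s / s := by
  constructor
  · exact (intervalIntegrable_iff_integrableOn_Ioc_of_le hb).1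
      (intervalIntegral.intervalIntegrable_rpow' (by linarith))
  · rw [← intervalIntegral.integral_of_le hb, integral_rpow (Or.inl (by linarith)),
      zero_rpow (by linarith), sub_zero, sub_add_cancel]

/-- For `‖z‖ ≤ 1/b` the function is simply bounded, and integrating the power over `(0, b]` gives
`b^(α-p)`. For `‖z‖ ≥ 1/b` the integral is extended to the half-line, where it is homogeneous of
degree `p - α`. The regularized norm encodes both cases. -/
theorem exists_bound_integral_annulus [NeZero d] {α p : ℝ} (hp : 0 < p) (hpα : p < α)
    (hα2 : α < 2) (q : ℝ) : ∃ K, 0 < K ∧ ∀ b : ℝ, 0 < b → ∀ z : 𝔼,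
      IntegrableOn (fun v : ℝ => v ^ (α - p - 1) * |fracLaplacian α (annulus q) (v • z)|) (Ioc 0 b) ∧
      ∫ v in Ioc 0 b, v ^ (α - p - 1) * |fracLaplacian α (annulus q) (v • z)| ≤
        K * reg b z ^ (p - α) := by
  obtain ⟨e₀, he₀⟩ := exists_unit_vector (d := d)
  have he₀0 : e₀ ≠ 0 := by rintro rfl; simp at he₀
  have hα : 0 < α := by linarith
  have hr := fun x y h => fracLaplacian_radial α (annulus_radial (d := d) q) (x := x) (y := y) h
  obtain ⟨K, hK, hbd⟩ := exists_decay_fracLaplacian hα hα2 (contDiff_annulus (d := d) q)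
    (hasCompactSupport_annulus q)
  have hcont := continuous_fracLaplacian hα hα2 (contDiff_annulus (d := d) q)
    (hasCompactSupport_annulus q)
  set A := ∫ v in Ioi (0 : ℝ), v ^ (α - p - 1) * |fracLaplacian α (annulus q) (v • e₀)| with hA
  have hA0 : 0 ≤ A := setIntegral_nonneg measurableSet_Ioi fun v (hv : 0 < v) => by positivity
  have hdom : ∀ b : ℝ, 0 < b → ∀ z : 𝔼, ∀ v ∈ Ioc 0 b,
      v ^ (α - p - 1) * |fracLaplacian α (annulus q) (v • z)| ≤ v ^ (α - p - 1) * K := by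
    intro b hb z v hv
    have := (hbd (v • z)).1
    have hv0 : 0 < v := hv.1
    gcongr
  have hint : ∀ b : ℝ, 0 < b → ∀ z : 𝔼, IntegrableOn
      (fun v : ℝ => v ^ (α - p - 1) * |fracLaplacian α (annulus q) (v • z)|) (Ioc 0 b) := by
    intro b hb z
    refine Integrable.mono' ((integral_Ioc_rpow_sub_one (s := α - p) (by linarith) hb.le).1.mul_const K) ?_ ?_
    · apply Measurable.aestronglyMeasurable
      have : Measurable fun v : ℝ => |fracLaplacian α (annulus q) (v • z)| :=
        (hcont.comp (by fun_prop : Continuous fun v : ℝ => v • z)).abs.measurable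
      fun_prop
    · filter_upwards [ae_restrict_mem measurableSet_Ioc] with v hv
      rw [norm_of_nonneg (mul_nonneg (rpow_nonneg hv.1.le _) (abs_nonneg _))]
      exact hdom b hb z v hv
  refine ⟨K / (α - p) + A, by have : 0 < α - p := by linarith
                              positivity, fun b hb z => ⟨hint b hb z, ?_⟩⟩
  have hKp : 0 ≤ K / (α - p) := div_nonneg hK.le (by linarith)
  rcases le_total ‖z‖ b⁻¹ with h | h
  · rw [reg_rpow_of_le hb _ h, neg_sub]
    have : ∫ v in Ioc 0 b, v ^ (α - p - 1) * |fracLaplacian α (annulus q) (v • z)| ≤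
        b ^ (α - p) / (α - p) * K := by
      rw [← (integral_Ioc_rpow_sub_one (s := α - p) (by linarith) hb.le).2, ← integral_mul_const]
      exact setIntegral_mono_on (hint b hb z)
        ((integral_Ioc_rpow_sub_one (s := α - p) (by linarith) hb.le).1.mul_const K)
        measurableSet_Ioc (hdom b hb z)
    refine this.trans ?_
    rw [add_mul, div_mul_eq_mul_div, div_mul_eq_mul_div, mul_comm K]
    have : 0 ≤ A * b ^ (α - p) := by positivity
    linarith
  · have hz : z ≠ 0 := norm_pos_iff.1 ((inv_pos.2 hb).trans_le h)
    rw [reg_rpow_of_ge _ h]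
    have hi := (integrableOn_fracLaplacian_annulus (d := d) hp hpα hα2 q he₀0).abs
    have hi2 : IntegrableOn (fun v : ℝ => v ^ (α - p - 1) * |fracLaplacian α (annulus q) (v • e₀)|)
        (Ioi 0) := by
      refine IntegrableOn.congr_fun hi (fun v hv => ?_) measurableSet_Ioi
      simp only [abs_mul]
      rw [abs_of_nonneg (rpow_nonneg (le_of_lt hv) _)]
    have habs : ∀ x y : 𝔼, ‖x‖ = ‖y‖ →
        |fracLaplacian α (annulus q) x| = |fracLaplacian α (annulus q) y| :=
      fun x y h => by rw [hr x y h]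
    have h1 := integral_rpow_mul_radial (F := fun x => |fracLaplacian α (annulus q) x|)
      habs he₀ (α - p - 1) hz
    have h2 := integrableOn_rpow_mul_radial (F := fun x => |fracLaplacian α (annulus q) x|)
      habs he₀ hi2 hz
    refine (setIntegral_mono_set h2 ?_ (ae_of_all _ fun v hv => hv.1)).trans ?_
    · filter_upwards [ae_restrict_mem measurableSet_Ioi] with v hv
      exact mul_nonneg (rpow_nonneg (le_of_lt hv) _) (abs_nonneg _)
    · rw [h1, ← hA, show -(α - p - 1) - 1 = p - α by ring, mul_comm]
      gcongr
      linarith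

/-! ### Fractional Laplacian of truncated powers, uniformly in the cutoffs -/

theorem abs_fracLaplacian_powBump_le {α : ℝ} (hα : 0 < α) (hα2 : α < 2) (q : ℝ) {a b : ℝ}
    (ha : 0 < a) (hab : a ≤ b) (z : 𝔼) : |fracLaplacian α (powBump q a b) z| ≤
      ∫ v in Ioc a b, v ^ (α - q - 1) * |fracLaplacian α (annulus q) (v • z)| := by
  rw [fracLaplacian_powBump hα hα2 q ha hab, ← norm_eq_abs]
  refine (norm_integral_le_integral_norm _).trans (le_of_eq ?_)
  refine setIntegral_congr_fun measurableSet_Ioc fun v hv => ?_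
  rw [norm_mul, norm_of_nonneg (rpow_nonneg (ha.trans hv.1).le _), norm_eq_abs]

theorem exists_bound_fracLaplacian_powBump [NeZero d] {α p : ℝ} (hp : 0 < p) (hpα : p < α)
    (hα2 : α < 2) : ∃ K, 0 < K ∧ ∀ a b : ℝ, 0 < a → a ≤ b → ∀ z : 𝔼,
      |fracLaplacian α (powBump p a b) z| ≤ K * reg b z ^ (p - α) := by
  obtain ⟨K, hK, h⟩ := exists_bound_integral_annulus (d := d) hp hpα hα2 p
  refine ⟨K, hK, fun a b ha hab z => ?_⟩
  obtain ⟨h1, h2⟩ := h b (ha.trans_le hab) z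
  refine (abs_fracLaplacian_powBump_le (by linarith) hα2 p ha hab z).trans (le_trans ?_ h2)
  refine setIntegral_mono_set h1 ?_ (ae_of_all _ fun v hv => ⟨ha.trans hv.1, hv.2⟩)
  filter_upwards [ae_restrict_mem measurableSet_Ioc] with v hv
  exact mul_nonneg (rpow_nonneg hv.1.le _) (abs_nonneg _)

/-- For the exponent `p - α` the integrand carries an additional factor `v^α`. It is bounded by
`b^α` in the first estimate, and in the second it is absorbed, together with `‖z‖^α`, by the decay
at `v • z`. -/
theorem exists_bound_fracLaplacian_powBump_sub [NeZero d] {α p : ℝ} (hp : 0 < p) (hpα : p < α)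
    (hα2 : α < 2) : ∃ K, 0 < K ∧ ∀ b : ℝ, 1 ≤ b → ∀ z : 𝔼,
      |fracLaplacian α (powBump (p - α) 1 b) z| ≤ K * (b ^ α * reg b z ^ (p - α)) ∧
      ‖z‖ ^ α * |fracLaplacian α (powBump (p - α) 1 b) z| ≤ K * b ^ (α - p) := by
  have hα : 0 < α := by linarith
  obtain ⟨K, hK, h⟩ := exists_bound_integral_annulus (d := d) hp hpα hα2 (p - α)
  obtain ⟨K', hK', hbd⟩ := exists_decay_fracLaplacian hα hα2 (contDiff_annulus (d := d) (p - α))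
    (hasCompactSupport_annulus (p - α))
  have hαp : 0 < α - p := by linarith
  refine ⟨K + K' / (α - p), by positivity, fun b hb z => ?_⟩
  have hb0 : 0 < b := by linarith
  obtain ⟨h1, h2⟩ := h b hb0 z
  have hle := abs_fracLaplacian_powBump_le hα hα2 (p - α) one_pos hb z
  have hsub : Ioc 1 b ⊆ Ioc 0 b := Ioc_subset_Ioc_left zero_le_one
  have hcont := continuous_fracLaplacian hα hα2 (contDiff_annulus (d := d) (p - α))
    (hasCompactSupport_annulus (p - α))
  have hi : IntegrableOn (fun v : ℝ => v ^ (α - (p - α) - 1) *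
      |fracLaplacian α (annulus (p - α)) (v • z)|) (Ioc 1 b) := by
    refine ContinuousOn.integrableOn_Icc ?_ |>.mono_set Ioc_subset_Icc_self
    refine ContinuousOn.mul (continuousOn_id.rpow_const fun v hv => Or.inl ?_) ?_
    · exact (zero_lt_one.trans_le hv.1).ne'
    · exact (hcont.comp (by fun_prop : Continuous fun v : ℝ => v • z)).abs.continuousOn
  have hsplit : ∀ v : ℝ, 0 < v → v ^ (α - (p - α) - 1) = v ^ α * v ^ (α - p - 1) := fun v hv => by
    rw [← rpow_add hv]; ring_nf
  constructor
  · have : ∫ v in Ioc 1 b, v ^ (α - (p - α) - 1) * |fracLaplacian α (annulus (p - α)) (v • z)| ≤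
        ∫ v in Ioc 0 b, b ^ α * (v ^ (α - p - 1) * |fracLaplacian α (annulus (p - α)) (v • z)|) := by
      refine (setIntegral_mono_on hi (IntegrableOn.mono_set (h1.const_mul (b ^ α)) hsub) measurableSet_Ioc
        fun v hv => ?_).trans (setIntegral_mono_set (h1.const_mul _) ?_ (ae_of_all _ hsub))
      · have hv0 : 0 < v := zero_lt_one.trans hv.1
        rw [hsplit v hv0, mul_assoc]
        gcongr
        exact hv.2
      · filter_upwards [ae_restrict_mem measurableSet_Ioc] with v hv
        have : 0 < v := hv.1
        simp only [Pi.zero_apply]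
        positivity
    rw [integral_const_mul] at this
    have h3 : 0 ≤ b ^ α * reg b z ^ (p - α) := by
      have := reg_pos hb0 z
      positivity
    calc _ ≤ b ^ α * (K * reg b z ^ (p - α)) := hle.trans (this.trans (by gcongr))
      _ = K * (b ^ α * reg b z ^ (p - α)) := by ring
      _ ≤ _ := by gcongr; linarith [div_nonneg hK'.le hαp.le]
  · obtain ⟨i1, i2⟩ := integral_Ioc_rpow_sub_one hαp hb0.le
    have : ‖z‖ ^ α * ∫ v in Ioc 1 b, v ^ (α - (p - α) - 1) *
        |fracLaplacian α (annulus (p - α)) (v • z)| ≤ ∫ v in Ioc 0 b, K' * v ^ (α - p - 1) := by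
      rw [← integral_const_mul]
      refine (setIntegral_mono_on (hi.const_mul _) (IntegrableOn.mono_set (i1.const_mul K') hsub)
        measurableSet_Ioc fun v hv => ?_).trans
        (setIntegral_mono_set (i1.const_mul _) ?_ (ae_of_all _ hsub))
      · have hv0 : 0 < v := zero_lt_one.trans hv.1
        have := (hbd (v • z)).2
        rw [norm_smul, norm_of_nonneg hv0.le, mul_rpow hv0.le (norm_nonneg _)] at this
        rw [hsplit v hv0]
        calc _ = (v ^ α * ‖z‖ ^ α * |fracLaplacian α (annulus (p - α)) (v • z)|) *
              v ^ (α - p - 1) := by ring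
          _ ≤ _ := by gcongr
      · filter_upwards [ae_restrict_mem measurableSet_Ioc] with v hv
        have : 0 < v := hv.1
        simp only [Pi.zero_apply]
        positivity
    rw [integral_const_mul, i2] at this
    calc _ ≤ K' * (b ^ (α - p) / (α - p)) := le_trans (by gcongr) this
      _ = K' / (α - p) * b ^ (α - p) := by ring
      _ ≤ _ := by gcongr; linarith

/-- The integral over all dilations is exactly `-B ‖z‖^(p-α)`, so the error comes from the omitted
ones. Dilations below `a` matter for large `‖z‖` and give `tail`; those above `b` are controlled by
the decay and give `b^(-p)`. -/
theorem exists_bound_fracLaplacian_powBump_add [NeZero d] {α p : ℝ} (hp : 1 < p) (hpα : p < α)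
    (hα2 : α < 2) : ∃ K, 0 < K ∧ ∀ a b : ℝ, 0 < a → a ≤ b → ∀ z : 𝔼,
      |‖z‖ ^ α * fracLaplacian α (powBump p a b) z + Bconst d p α * ‖z‖ ^ p| ≤
        K * (b ^ (-p) + tail p α a z) := by
  have hα : 0 < α := by linarith
  have hp0 : 0 < p := by linarith
  have hαp : 0 < α - p := by linarith
  obtain ⟨K, hK, h⟩ := exists_bound_integral_annulus (d := d) hp0 hpα hα2 p
  obtain ⟨K', hK', hbd⟩ := exists_decay_fracLaplacian hα hα2 (contDiff_annulus (d := d) p)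
    (hasCompactSupport_annulus p)
  refine ⟨K + K' / p, by positivity, fun a b ha hab z => ?_⟩
  have hb : 0 < b := ha.trans_le hab
  have htail := tail_nonneg p α ha.le z
  rcases eq_or_ne z 0 with rfl | hz
  · rw [norm_zero, zero_rpow hα.ne', zero_rpow hp0.ne', zero_mul, mul_zero, add_zero, abs_zero]
    positivity
  have hz0 : 0 < ‖z‖ := norm_pos_iff.2 hz
  have hi := integrableOn_fracLaplacian_annulus (d := d) hp0 hpα hα2 p hz
  have hval := integral_rpow_mul_fracLaplacian_annulus (d := d) hp hpα hα2 hz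
  set f : ℝ → ℝ := fun v => v ^ (α - p - 1) * fracLaplacian α (annulus p) (v • z) with hf
  have hIoc : ∀ {s t : ℝ}, 0 ≤ s → IntegrableOn f (Ioc s t) := fun hs =>
    hi.mono_set fun v hv => lt_of_le_of_lt hs hv.1
  have hsplit : ∫ v in Ioi (0 : ℝ), f v =
      (∫ v in Ioc 0 a, f v) + (∫ v in Ioc a b, f v) + ∫ v in Ioi b, f v := by
    rw [← setIntegral_union (Ioc_disjoint_Ioc_of_le le_rfl) measurableSet_Ioc (hIoc le_rfl)
      (hIoc ha.le), Ioc_union_Ioc_eq_Ioc ha.le hab, ← setIntegral_union _ measurableSet_Ioi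
      (hIoc le_rfl) (hi.mono_set (Ioi_subset_Ioi hb.le)), Ioc_union_Ioi_eq_Ioi hb.le]
    exact Set.disjoint_left.2 fun v hv hv2 => absurd hv.2 (not_le.2 hv2)
  have hG : fracLaplacian α (powBump p a b) z = ∫ v in Ioc a b, f v :=
    fracLaplacian_powBump hα hα2 p ha hab z
  have hzp : ‖z‖ ^ p = ‖z‖ ^ α * ‖z‖ ^ (p - α) := by rw [← rpow_add hz0]; ring_nf
  have hkey : ‖z‖ ^ α * fracLaplacian α (powBump p a b) z + Bconst d p α * ‖z‖ ^ p =
      -(‖z‖ ^ α * ∫ v in Ioc 0 a, f v) - ‖z‖ ^ α * ∫ v in Ioi b, f v := by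
    rw [hG, hzp]
    have : ∫ v in Ioc a b, f v = -Bconst d p α * ‖z‖ ^ (p - α) - (∫ v in Ioc 0 a, f v) -
        ∫ v in Ioi b, f v := by rw [← hval, hsplit]; ring
    rw [this]; ring
  have hfabs : ∀ v, 0 < v → |f v| = v ^ (α - p - 1) * |fracLaplacian α (annulus p) (v • z)| :=
    fun v hv => by rw [hf, abs_mul, abs_of_nonneg (rpow_nonneg hv.le _)]
  -- small dilations
  have h1 : ‖z‖ ^ α * |∫ v in Ioc 0 a, f v| ≤ K * tail p α a z := by
    obtain ⟨-, h2⟩ := h a ha z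
    have h3 : |∫ v in Ioc 0 a, f v| ≤ K * reg a z ^ (p - α) := by
      rw [← norm_eq_abs]
      refine (norm_integral_le_integral_norm _).trans (le_trans (le_of_eq ?_) h2)
      exact setIntegral_congr_fun measurableSet_Ioc fun v hv => hfabs v hv.1
    calc ‖z‖ ^ α * |∫ v in Ioc 0 a, f v| ≤ ‖z‖ ^ α * (K * reg a z ^ (p - α)) := by gcongr
      _ = K * (‖z‖ ^ α * reg a z ^ (p - α)) := by ring
      _ ≤ K * tail p α a z := by
        gcongr
        rw [tail]
        rcases le_total 1 (a * ‖z‖) with h | h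
        · rw [min_eq_left (one_le_rpow h hαp.le), mul_one, hzp]
          exact mul_le_mul_of_nonneg_left (reg_rpow_le_norm (by linarith) hz) (by positivity)
        · rw [min_eq_right (rpow_le_one (by positivity) h hαp.le), mul_rpow ha.le hz0.le]
          have := reg_rpow_le ha (show p - α ≤ 0 by linarith) z
          rw [neg_sub] at this
          calc _ ≤ ‖z‖ ^ α * a ^ (α - p) := by gcongr
            _ = ‖z‖ ^ (p + (α - p)) * a ^ (α - p) := by ring_nf
            _ = _ := by rw [rpow_add hz0]; ring
  have h2 : ‖z‖ ^ α * |∫ v in Ioi b, f v| ≤ K' / p * b ^ (-p) := by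
    have hi2 : IntegrableOn (fun v : ℝ => K' * v ^ (-p - 1)) (Ioi b) :=
      (integrableOn_Ioi_rpow_of_lt (by linarith) hb).const_mul K'
    have : |∫ v in Ioi b, ‖z‖ ^ α * f v| ≤ ∫ v in Ioi b, K' * v ^ (-p - 1) := by
      rw [← norm_eq_abs]
      refine norm_integral_le_of_norm_le hi2 ?_
      filter_upwards [ae_restrict_mem measurableSet_Ioi] with v hv
      have hv0 : 0 < v := hb.trans hv
      rw [norm_mul, norm_of_nonneg (by positivity), norm_eq_abs, hfabs v hv0]
      have := (hbd (v • z)).2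
      rw [norm_smul, norm_of_nonneg hv0.le, mul_rpow hv0.le (norm_nonneg _)] at this
      have e : v ^ (α - p - 1) = v ^ α * v ^ (-p - 1) := by rw [← rpow_add hv0]; ring_nf
      rw [e]
      calc _ = (v ^ α * ‖z‖ ^ α * |fracLaplacian α (annulus p) (v • z)|) * v ^ (-p - 1) := by ring
        _ ≤ _ := by gcongr
    rw [integral_const_mul, abs_mul, abs_of_nonneg (by positivity), integral_const_mul,
      integral_Ioi_rpow_of_lt (by linarith) hb] at this
    refine this.trans (le_of_eq ?_)
    rw [sub_add_cancel]
    field_simp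
  rw [hkey]
  calc _ ≤ ‖z‖ ^ α * |∫ v in Ioc 0 a, f v| + ‖z‖ ^ α * |∫ v in Ioi b, f v| := by
        refine (abs_sub _ _).trans (le_of_eq ?_)
        rw [abs_neg, abs_mul, abs_mul, abs_of_nonneg (by positivity : 0 ≤ ‖z‖ ^ α)]
    _ ≤ K * tail p α a z + K' / p * b ^ (-p) := add_le_add h1 h2
    _ ≤ _ := by
      have e1 : 0 ≤ K * b ^ (-p) := by positivity
      have e2 : 0 ≤ K' / p * tail p α a z := by positivity
      nlinarith


/-! ### Gradient bounds -/

theorem exists_bound_mul_deriv_cutoff : ∃ S, 0 < S ∧ ∀ s : ℝ, |s * deriv cutoff s| ≤ S := by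
  have hc : HasCompactSupport (fun s : ℝ => s * deriv cutoff s) := by
    refine HasCompactSupport.of_support_subset_isCompact (isCompact_Icc (a := (1 : ℝ)) (b := 2)) ?_
    intro s hs
    by_contra hn
    apply hs
    simp only [mem_Icc, not_and_or, not_le] at hn
    rcases hn with h | h
    · simp only [deriv_cutoff_of_lt h, mul_zero]
    · simp only [deriv_cutoff_of_gt h, mul_zero]
  have hcont : Continuous (fun s : ℝ => s * deriv cutoff s) :=
    continuous_id.mul contDiff_deriv_cutoff.continuous
  obtain ⟨K, hK⟩ := hc.exists_bound_of_continuous hcont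
  exact ⟨max K 1, by positivity, fun s => (hK s).trans (le_max_left _ _)⟩

/-- `s ↦ s cutoff' s` at `v² |z|²`. -/
def cutGrad (v : ℝ) (z : 𝔼) : ℝ := (v * ‖z‖) ^ 2 * deriv cutoff ((v * ‖z‖) ^ 2)

theorem cutGrad_of_lt {v : ℝ} (hv : 0 ≤ v) {z : 𝔼} (h : v * ‖z‖ < 1) : cutGrad v z = 0 := by
  rw [cutGrad, deriv_cutoff_of_lt, mul_zero]
  exact pow_lt_one₀ (by positivity) h (by norm_num)

theorem cutGrad_of_ge {v : ℝ} {z : 𝔼} (h : 2 ≤ v * ‖z‖) : cutGrad v z = 0 := by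
  rw [cutGrad, deriv_cutoff_of_gt, mul_zero]
  nlinarith

theorem bump_smul_eq (v : ℝ) (z : 𝔼) : bump (v • z) = cutoff (v ^ 2 * ‖z‖ ^ 2) := by
  rw [bump, norm_smul, mul_pow, norm_eq_abs, sq_abs]

theorem hasFDerivAt_bump_smul (v : ℝ) (z : 𝔼) :
    HasFDerivAt (fun z : 𝔼 => bump (v • z))
      ((deriv cutoff ((v * ‖z‖) ^ 2) * v ^ 2) • (2 • innerSL ℝ z)) z := by
  have h1 : HasFDerivAt (fun z : 𝔼 => ‖z‖ ^ 2) (2 • innerSL ℝ z) z :=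
    (hasStrictFDerivAt_norm_sq z).hasFDerivAt
  have h2 : HasDerivAt (fun s : ℝ => cutoff (v ^ 2 * s)) (deriv cutoff ((v * ‖z‖) ^ 2) * v ^ 2)
      (‖z‖ ^ 2) := by
    have e : HasDerivAt cutoff (deriv cutoff ((v * ‖z‖) ^ 2)) (v ^ 2 * ‖z‖ ^ 2) := by
      rw [← mul_pow]
      exact ((contDiff_cutoff.differentiable (by simp)) _).hasDerivAt
    have e2 : HasDerivAt (fun s : ℝ => v ^ 2 * s) (v ^ 2) (‖z‖ ^ 2) := by
      simpa using (hasDerivAt_id (‖z‖ ^ 2)).const_mul (v ^ 2)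
    exact e.comp (‖z‖ ^ 2) e2
  have := h2.comp_hasFDerivAt z h1
  have e : (fun z : 𝔼 => bump (v • z)) = (fun s : ℝ => cutoff (v ^ 2 * s)) ∘ fun z : 𝔼 => ‖z‖ ^ 2 :=
    funext fun z => bump_smul_eq v z
  rw [e]
  exact this

theorem fderiv_bump_smul (v : ℝ) (z w : 𝔼) :
    ‖z‖ ^ 2 * fderiv ℝ (fun z : 𝔼 => bump (v • z)) z w = 2 * inner ℝ z w * cutGrad v z := by
  rw [(hasFDerivAt_bump_smul v z).fderiv, cutGrad]
  simp only [_root_.smul_apply, innerSL_apply_apply, smul_eq_mul, nsmul_eq_mul]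
  push_cast; ring

theorem fderiv_powBump (q : ℝ) (a b : ℝ) {z : 𝔼} (hz : z ≠ 0) (w : 𝔼) :
    ‖z‖ ^ 2 * fderiv ℝ (powBump q a b) z w =
      inner ℝ z w * (q * powBump q a b z + 2 * ‖z‖ ^ q * (cutGrad a z - cutGrad b z)) := by
  have hz0 : 0 < ‖z‖ := norm_pos_iff.2 hz
  have h1 : HasFDerivAt (fun z : 𝔼 => ‖z‖ ^ q) ((q * ‖z‖ ^ (q - 2)) • innerSL ℝ z) z := by
    have e1 : HasFDerivAt (fun z : 𝔼 => ‖z‖ ^ 2) (2 • innerSL ℝ z) z :=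
      (hasStrictFDerivAt_norm_sq z).hasFDerivAt
    have e2 : HasDerivAt (fun s : ℝ => s ^ (q / 2)) (q / 2 * (‖z‖ ^ 2) ^ (q / 2 - 1)) (‖z‖ ^ 2) :=
      hasDerivAt_rpow_const (Or.inl (by positivity))
    have := e2.comp_hasFDerivAt z e1
    have e3 : (fun z : 𝔼 => ‖z‖ ^ q) = (fun s : ℝ => s ^ (q / 2)) ∘ fun z : 𝔼 => ‖z‖ ^ 2 := by
      funext z
      simp only [Function.comp]
      rw [← rpow_natCast, ← rpow_mul (norm_nonneg z)]
      push_cast; congr 1; ring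
    rw [e3]
    refine this.congr_fderiv ?_
    have e4 : (‖z‖ ^ 2) ^ (q / 2 - 1) = ‖z‖ ^ (q - 2) := by
      rw [← rpow_natCast, ← rpow_mul (norm_nonneg z)]
      push_cast; congr 1; ring
    rw [e4]
    ext w
    simp only [_root_.smul_apply, innerSL_apply_apply, smul_eq_mul, nsmul_eq_mul]
    push_cast; ring
  have h2 := h1.mul ((hasFDerivAt_bump_smul a z).sub (hasFDerivAt_bump_smul b z))
  have h3 : HasFDerivAt (powBump q a b) _ z := h2
  rw [h3.fderiv, powBump, cutGrad, cutGrad]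
  have e : ‖z‖ ^ q = ‖z‖ ^ (q - 2) * ‖z‖ ^ 2 := by
    rw [← rpow_natCast, ← rpow_add hz0]; congr 1; push_cast; ring
  simp only [_root_.add_apply, _root_.sub_apply,
    _root_.smul_apply, innerSL_apply_apply, smul_eq_mul, nsmul_eq_mul, Pi.sub_apply]
  rw [e]; push_cast; ring

theorem abs_bump_sub_le (a b : ℝ) (z : 𝔼) : |bump (a • z) - bump (b • z)| ≤ 1 := by
  rw [abs_le]
  constructor <;> linarith [bump_nonneg (a • z), bump_le_one (a • z), bump_nonneg (b • z),
    bump_le_one (b • z)]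

/-- The constant is independent of the cutoffs because `s * deriv cutoff s` is bounded:
differentiating a dilated bump costs `1/‖z‖`, whatever the dilation. -/
theorem exists_bound_fderiv_powBump (q : ℝ) : ∃ K, 0 < K ∧ ∀ a b : ℝ, 0 < a → a ≤ b → ∀ z w : 𝔼,
    |fderiv ℝ (powBump q a b) z w| ≤ K * (‖w‖ * ‖z‖ ^ (q - 1)) := by
  obtain ⟨S, hS, hSb⟩ := exists_bound_mul_deriv_cutoff
  refine ⟨|q| + 4 * S, by positivity, fun a b ha hab z w => ?_⟩
  rcases eq_or_ne z 0 with rfl | hz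
  · have : (powBump q a b : 𝔼 → ℝ) =ᶠ[𝓝 0] fun _ => 0 := by
      filter_upwards [Metric.closedBall_mem_nhds (0 : 𝔼) (inv_pos.2 (ha.trans_le hab))] with z hz
      exact powBump_eq_zero_of_le ha hab (by simpa using hz)
    rw [this.fderiv_eq]
    simp only [fderiv_fun_const, Pi.zero_apply, _root_.zero_apply, abs_zero]
    positivity
  have hz0 : 0 < ‖z‖ := norm_pos_iff.2 hz
  have h := fderiv_powBump q a b hz w
  have h1 : |powBump q a b z| ≤ ‖z‖ ^ q := by
    rw [powBump, abs_mul, abs_of_nonneg (by positivity)]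
    exact mul_le_of_le_one_right (by positivity) (abs_bump_sub_le a b z)
  have h2 : ∀ v : ℝ, |cutGrad v z| ≤ S := fun v => hSb _
  have h3 : |q * powBump q a b z + 2 * ‖z‖ ^ q * (cutGrad a z - cutGrad b z)| ≤
      (|q| + 4 * S) * ‖z‖ ^ q := by
    refine (abs_add_le _ _).trans ?_
    rw [abs_mul, abs_mul, abs_of_nonneg (by positivity : 0 ≤ 2 * ‖z‖ ^ q)]
    have : |cutGrad a z - cutGrad b z| ≤ 2 * S :=
      (abs_sub _ _).trans (by linarith [h2 a, h2 b])
    calc _ ≤ |q| * ‖z‖ ^ q + 2 * ‖z‖ ^ q * (2 * S) := by gcongr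
      _ = _ := by ring
  have h4 : ‖z‖ ^ 2 * |fderiv ℝ (powBump q a b) z w| ≤ ‖z‖ ^ 2 * ((|q| + 4 * S) * (‖w‖ * ‖z‖ ^ (q - 1))) := by
    calc ‖z‖ ^ 2 * |fderiv ℝ (powBump q a b) z w| = |‖z‖ ^ 2 * fderiv ℝ (powBump q a b) z w| := by
          rw [abs_mul, abs_of_nonneg (by positivity : 0 ≤ ‖z‖ ^ 2)]
      _ = |inner ℝ z w| * |q * powBump q a b z + 2 * ‖z‖ ^ q * (cutGrad a z - cutGrad b z)| := by
          rw [h, abs_mul]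
      _ ≤ (‖z‖ * ‖w‖) * ((|q| + 4 * S) * ‖z‖ ^ q) := by
          gcongr
          exact abs_real_inner_le_norm z w
      _ = _ := by
          have : ‖z‖ ^ q = ‖z‖ ^ (q - 1) * ‖z‖ := by
            rw [← rpow_add_one hz0.ne']; ring_nf
          rw [this]; ring
  exact le_of_mul_le_mul_left h4 (by positivity)

theorem abs_powBump_sub_le {p α : ℝ} (hp : 0 < p) (hpα : p < α) {a b : ℝ} (ha : 0 < a)
    (hab : a ≤ b) (z : 𝔼) : |powBump p a b z - ‖z‖ ^ p| ≤ 2 ^ p * b ^ (-p) + tail p α a z := by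
  have hb : 0 < b := ha.trans_le hab
  have e : powBump p a b z - ‖z‖ ^ p = -(‖z‖ ^ p * (1 - bump (a • z))) - ‖z‖ ^ p * bump (b • z) := by
    rw [powBump]; ring
  have h0 := bump_le_one (a • z)
  have h0' := bump_nonneg (a • z)
  have h0'' := bump_nonneg (b • z)
  have h1 : ‖z‖ ^ p * (1 - bump (a • z)) ≤ tail p α a z := by
    by_cases h : 1 ≤ a * ‖z‖
    · rw [tail_of_ge hpα h]
      exact mul_le_of_le_one_right (by positivity) (by linarith)
    · rw [bump_of_le, sub_self, mul_zero]
      · exact tail_nonneg p α ha.le z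
      · rw [norm_smul, norm_of_nonneg ha.le]; exact (not_le.1 h).le
  have h2 : ‖z‖ ^ p * bump (b • z) ≤ 2 ^ p * b ^ (-p) := by
    by_cases h : b * ‖z‖ ≤ 2
    · have hz : ‖z‖ ≤ 2 * b⁻¹ := by rw [← div_eq_mul_inv, le_div_iff₀ hb]; linarith
      calc ‖z‖ ^ p * bump (b • z) ≤ (2 * b⁻¹) ^ p * 1 := by
            gcongr; exact bump_le_one _
        _ = _ := by rw [mul_one, mul_rpow (by norm_num) (by positivity), inv_rpow hb.le,
            rpow_neg hb.le]
    · rw [bump_of_ge, mul_zero]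
      · positivity
      · rw [norm_smul, norm_of_nonneg hb.le]; linarith [not_le.1 h]
  rw [e]
  refine (abs_sub _ _).trans ?_
  rw [abs_neg, abs_of_nonneg (mul_nonneg (by positivity) (by linarith)),
    abs_of_nonneg (mul_nonneg (by positivity) h0'')]
  linarith

/-- Euler's identity `z⬝∇|z|^p = p |z|^p`, with errors only where a cutoff acts: the outer cutoff is
dominated by `tail`, and near the origin `‖z‖^p` is at most a multiple of `b^(-p)`. -/
theorem exists_bound_fderiv_powBump_self {p α : ℝ} (hp : 0 < p) (hpα : p < α) :
    ∃ K, 0 < K ∧ ∀ a b : ℝ, 0 < a → a ≤ b → ∀ z : 𝔼,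
      |fderiv ℝ (powBump p a b) z z - p * ‖z‖ ^ p| ≤ K * (b ^ (-p) + tail p α a z) := by
  obtain ⟨S, hS, hSb⟩ := exists_bound_mul_deriv_cutoff
  refine ⟨p * (2 ^ p + 1) + 2 * S * (2 ^ p + 1), by positivity, fun a b ha hab z => ?_⟩
  have hb : 0 < b := ha.trans_le hab
  have htail := tail_nonneg p α ha.le z
  rcases eq_or_ne z 0 with rfl | hz
  · rw [map_zero, norm_zero, zero_rpow hp.ne', mul_zero, sub_zero, abs_zero]
    positivity
  have hz0 : 0 < ‖z‖ := norm_pos_iff.2 hz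
  have h := fderiv_powBump p a b hz z
  rw [real_inner_self_eq_norm_sq] at h
  have h' := mul_left_cancel₀ (by positivity) h
  have e : fderiv ℝ (powBump p a b) z z - p * ‖z‖ ^ p = p * (powBump p a b z - ‖z‖ ^ p) +
      (2 * (‖z‖ ^ p * cutGrad a z) - 2 * (‖z‖ ^ p * cutGrad b z)) := by rw [h']; ring
  have h1 : |‖z‖ ^ p * cutGrad a z| ≤ S * tail p α a z := by
    by_cases h : 1 ≤ a * ‖z‖
    · rw [tail_of_ge hpα h, abs_mul, abs_of_nonneg (by positivity), mul_comm]
      gcongr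
      exact hSb _
    · rw [cutGrad_of_lt ha.le (not_le.1 h), mul_zero, abs_zero]
      positivity
  have h2 : |‖z‖ ^ p * cutGrad b z| ≤ S * (2 ^ p * b ^ (-p)) := by
    by_cases h : b * ‖z‖ ≤ 2
    · have hz : ‖z‖ ≤ 2 * b⁻¹ := by rw [← div_eq_mul_inv, le_div_iff₀ hb]; linarith
      rw [abs_mul, abs_of_nonneg (by positivity), mul_comm]
      calc |cutGrad b z| * ‖z‖ ^ p ≤ S * (2 * b⁻¹) ^ p := by
            gcongr; exact hSb _
        _ = _ := by rw [mul_rpow (by norm_num) (by positivity), inv_rpow hb.le,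
            rpow_neg hb.le]
    · rw [cutGrad_of_ge (not_le.1 h).le, mul_zero, abs_zero]
      positivity
  rw [e]
  have h3 := abs_powBump_sub_le hp hpα ha hab z
  have hA : 0 ≤ b ^ (-p) := by positivity
  have hB : (0 : ℝ) ≤ 2 ^ p := by positivity
  calc _ ≤ p * |powBump p a b z - ‖z‖ ^ p| + (2 * |‖z‖ ^ p * cutGrad a z| +
        2 * |‖z‖ ^ p * cutGrad b z|) := by
        refine (abs_add_le _ _).trans ?_
        rw [abs_mul, abs_of_pos hp]
        gcongr
        refine (abs_sub _ _).trans ?_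
        rw [abs_mul, abs_mul]; norm_num
    _ ≤ p * (2 ^ p * b ^ (-p) + tail p α a z) + (2 * (S * tail p α a z) +
        2 * (S * (2 ^ p * b ^ (-p)))) := by gcongr
    _ ≤ _ := by
      have e1 : 0 ≤ p * b ^ (-p) := by positivity
      have e2 : 0 ≤ p * 2 ^ p * tail p α a z := by positivity
      have e3 : 0 ≤ S * b ^ (-p) := by positivity
      have e4 : 0 ≤ S * 2 ^ p * tail p α a z := by positivity
      nlinarith

/-! ### Elementary inequalities for the weight `|x̄ - x|^α` -/

/-- This is Bernoulli's inequality for `1 + (y/x - 1)`, multiplied by `x^α`. -/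
theorem rpow_sub_rpow_le {x y α : ℝ} (hy : 0 ≤ y) (hyx : y ≤ x) (hα : 1 ≤ α) :
    x ^ α - y ^ α ≤ α * x ^ (α - 1) * (x - y) := by
  rcases eq_or_lt_of_le (hy.trans hyx) with h | hx
  · have : y = 0 := by linarith
    rw [← h, this]; simp
  have h := one_add_mul_self_le_rpow_one_add (s := y / x - 1) (by linarith [div_nonneg hy hx.le]) hα
  have e : (1 + (y / x - 1)) ^ α = y ^ α / x ^ α := by
    rw [add_sub_cancel, div_rpow hy hx.le]
  rw [e, le_div_iff₀ (rpow_pos_of_pos hx α)] at h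
  have e2 : x ^ α = x ^ (α - 1) * x := by rw [← rpow_add_one hx.ne']; ring_nf
  have e3 : (1 + α * (y / x - 1)) * x ^ α = x ^ α + α * x ^ (α - 1) * (y - x) := by
    rw [e2]; field_simp
  linarith

/-- Convexity bounds the difference by `α r^(α-1) ‖w‖` with `r ≤ ‖w‖ + ‖z‖`; since `α - 1 ≤ 1`, the
power `r^(α-1)` is subadditive. -/
theorem abs_norm_rpow_sub_le {α : ℝ} (hα : 1 < α) (hα2 : α < 2) (w z : 𝔼) :
    |‖w - z‖ ^ α - ‖z‖ ^ α| ≤ α * (‖w‖ ^ α + ‖w‖ * ‖z‖ ^ (α - 1)) := by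
  have key : ∀ s r : ℝ, 0 ≤ s → s ≤ r → r - s ≤ ‖w‖ → r ≤ ‖w‖ + ‖z‖ →
      r ^ α - s ^ α ≤ α * (‖w‖ ^ α + ‖w‖ * ‖z‖ ^ (α - 1)) := by
    intro s r hs hsr h1 h2
    have hr : 0 ≤ r := hs.trans hsr
    have e : ‖w‖ ^ α = ‖w‖ ^ (α - 1) * ‖w‖ := by
      rcases eq_or_lt_of_le (norm_nonneg w) with h | h
      · rw [← h, zero_rpow (by linarith), mul_zero]
      · rw [← rpow_add_one h.ne']; ring_nf
    calc r ^ α - s ^ α ≤ α * r ^ (α - 1) * (r - s) := rpow_sub_rpow_le hs hsr hα.le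
      _ ≤ α * (‖w‖ + ‖z‖) ^ (α - 1) * ‖w‖ := by gcongr
      _ ≤ α * (‖w‖ ^ (α - 1) + ‖z‖ ^ (α - 1)) * ‖w‖ := by
          gcongr
          exact rpow_add_le_add_rpow (norm_nonneg _) (norm_nonneg _) (by linarith) (by linarith)
      _ = _ := by rw [e]; ring
  have t1 : ‖w - z‖ ≤ ‖w‖ + ‖z‖ := norm_sub_le w z
  have t2 : ‖z‖ ≤ ‖w‖ + ‖w - z‖ := by
    have := norm_sub_le w (w - z); rwa [sub_sub_cancel] at this
  rw [abs_le']
  constructor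
  · rcases le_total ‖z‖ ‖w - z‖ with h | h
    · exact key _ _ (norm_nonneg _) h (by linarith) t1
    · have := rpow_le_rpow (norm_nonneg _) h (by linarith : 0 ≤ α)
      have : 0 ≤ α * (‖w‖ ^ α + ‖w‖ * ‖z‖ ^ (α - 1)) := by positivity
      linarith
  · rw [neg_sub]
    rcases le_total ‖w - z‖ ‖z‖ with h | h
    · exact key _ _ (norm_nonneg _) h (by linarith) (by linarith [norm_nonneg w])
    · have := rpow_le_rpow (norm_nonneg _) h (by linarith : 0 ≤ α)
      have : 0 ≤ α * (‖w‖ ^ α + ‖w‖ * ‖z‖ ^ (α - 1)) := by positivity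
      linarith

theorem norm_sub_rpow_le {α : ℝ} (hα : 0 < α) (hα2 : α < 2) (w z : 𝔼) :
    ‖w - z‖ ^ α ≤ 4 * (‖w‖ ^ α + ‖z‖ ^ α) := by
  have h1 : ‖w - z‖ ≤ 2 * max ‖w‖ ‖z‖ :=
    (norm_sub_le w z).trans (by linarith [le_max_left ‖w‖ ‖z‖, le_max_right ‖w‖ ‖z‖])
  have h2 : max ‖w‖ ‖z‖ ^ α ≤ ‖w‖ ^ α + ‖z‖ ^ α := by
    rcases le_total ‖w‖ ‖z‖ with h | h
    · rw [max_eq_right h]; linarith [rpow_nonneg (norm_nonneg w) α]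
    · rw [max_eq_left h]; linarith [rpow_nonneg (norm_nonneg z) α]
  have h3 : (2 : ℝ) ^ α ≤ 4 := by
    have := rpow_le_rpow_of_exponent_le (by norm_num : (1 : ℝ) ≤ 2) hα2.le
    rw [rpow_two] at this; linarith
  calc ‖w - z‖ ^ α ≤ (2 * max ‖w‖ ‖z‖) ^ α := by gcongr
    _ = 2 ^ α * max ‖w‖ ‖z‖ ^ α := mul_rpow (by norm_num) (by positivity)
    _ ≤ _ := by gcongr


/-! ### The generator on truncated powers -/

/-- The generator of the equation with consensus point `w`, applied to `φ`. -/
def generator (α ν γ : ℝ) (φ : 𝔼 → ℝ) (w z : 𝔼) : ℝ :=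
  ν * fderiv ℝ φ z (w - z) - γ ^ α * (‖w - z‖ ^ α * fracLaplacian α φ z)

/-- At `w = 0` Euler's identity and the identity for `(-Δ)^{α/2} |z|^p` give `-C ‖z‖^p` up to
truncation errors. Moving the centre to `w` costs terms bounded by the `p`-th moment, because
`‖z‖^(α-1) ‖z‖^(p-α) = ‖z‖^(p-1)`, and the single singular term `‖w‖^α reg^(p-α)`. -/
theorem exists_bound_generator_powBump [NeZero d] {α p ν γ : ℝ} (hp : 1 < p) (hpα : p < α)
    (hα2 : α < 2) (hν : 0 < ν) (hγ : 0 < γ) : ∃ K, 0 < K ∧ ∀ a b : ℝ, 0 < a → a ≤ b → ∀ w z : 𝔼,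
      |generator α ν γ (powBump p a b) w z + Cconst d p α ν γ * ‖z‖ ^ p| ≤
        K * (b ^ (-p) + tail p α a z + ‖w‖ * (1 + ‖z‖ ^ p) + ‖w‖ ^ α * reg b z ^ (p - α)) := by
  have hp0 : 0 < p := by linarith
  have hα : 1 < α := by linarith
  obtain ⟨K₁, hK₁, h₁⟩ := exists_bound_fderiv_powBump (d := d) p
  obtain ⟨K₂, hK₂, h₂⟩ := exists_bound_fderiv_powBump_self (d := d) hp0 hpα
  obtain ⟨K₃, hK₃, h₃⟩ := exists_bound_fracLaplacian_powBump (d := d) hp0 hpα hα2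
  obtain ⟨K₄, hK₄, h₄⟩ := exists_bound_fracLaplacian_powBump_add (d := d) hp hpα hα2
  have hγα : 0 < γ ^ α := rpow_pos_of_pos hγ α
  refine ⟨ν * K₁ + ν * K₂ + γ ^ α * K₄ + γ ^ α * α * K₃, by positivity, fun a b ha hab w z => ?_⟩
  have hb : 0 < b := ha.trans_le hab
  have hr := reg_pos hb z
  have hpow : ‖z‖ ^ (p - 1) ≤ 1 + ‖z‖ ^ p := by
    rcases le_total ‖z‖ 1 with h | h
    · have := rpow_le_one (norm_nonneg z) h (by linarith : 0 ≤ p - 1)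
      have : 0 ≤ ‖z‖ ^ p := by positivity
      linarith
    · have := rpow_le_rpow_of_exponent_le h (by linarith : p - 1 ≤ p)
      linarith
  have hmix : ‖z‖ ^ (α - 1) * reg b z ^ (p - α) ≤ 1 + ‖z‖ ^ p := by
    rcases eq_or_ne z 0 with rfl | hz
    · rw [norm_zero, zero_rpow (by linarith), zero_mul]; positivity
    · refine le_trans ?_ hpow
      calc ‖z‖ ^ (α - 1) * reg b z ^ (p - α) ≤ ‖z‖ ^ (α - 1) * ‖z‖ ^ (p - α) :=
            mul_le_mul_of_nonneg_left (reg_rpow_le_norm (by linarith) hz) (by positivity)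
        _ = _ := by rw [← rpow_add (norm_pos_iff.2 hz)]; ring_nf
  set G := fracLaplacian α (powBump p a b) z with hG
  have e : generator α ν γ (powBump p a b) w z + Cconst d p α ν γ * ‖z‖ ^ p =
      ν * fderiv ℝ (powBump p a b) z w - ν * (fderiv ℝ (powBump p a b) z z - p * ‖z‖ ^ p)
      - γ ^ α * (‖z‖ ^ α * G + Bconst d p α * ‖z‖ ^ p)
      - γ ^ α * ((‖w - z‖ ^ α - ‖z‖ ^ α) * G) := by
    rw [generator, Cconst, map_sub]; ring
  set X := b ^ (-p) + tail p α a z with hX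
  set Y := ‖w‖ * (1 + ‖z‖ ^ p) with hY
  set Z := ‖w‖ ^ α * reg b z ^ (p - α) with hZ
  have hX0 : 0 ≤ X := add_nonneg (by positivity) (tail_nonneg p α ha.le z)
  have hY0 : 0 ≤ Y := by positivity
  have hZ0 : 0 ≤ Z := by positivity
  have t1 : |ν * fderiv ℝ (powBump p a b) z w| ≤ ν * K₁ * Y := by
    rw [abs_mul, abs_of_pos hν, mul_assoc]
    gcongr
    refine (h₁ a b ha hab z w).trans ?_
    rw [hY]
    gcongr
  have t2 : |ν * (fderiv ℝ (powBump p a b) z z - p * ‖z‖ ^ p)| ≤ ν * K₂ * X := by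
    rw [abs_mul, abs_of_pos hν, mul_assoc]
    gcongr
    exact h₂ a b ha hab z
  have t3 : |γ ^ α * (‖z‖ ^ α * G + Bconst d p α * ‖z‖ ^ p)| ≤ γ ^ α * K₄ * X := by
    rw [abs_mul, abs_of_pos hγα, mul_assoc]
    gcongr
    exact h₄ a b ha hab z
  have t4 : |γ ^ α * ((‖w - z‖ ^ α - ‖z‖ ^ α) * G)| ≤ γ ^ α * α * K₃ * (Y + Z) := by
    rw [abs_mul, abs_of_pos hγα, abs_mul, mul_assoc, mul_assoc]
    refine mul_le_mul_of_nonneg_left ?_ hγα.le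
    calc |‖w - z‖ ^ α - ‖z‖ ^ α| * |G| ≤
          (α * (‖w‖ ^ α + ‖w‖ * ‖z‖ ^ (α - 1))) * (K₃ * reg b z ^ (p - α)) := by
          gcongr
          · exact abs_norm_rpow_sub_le hα hα2 w z
          · exact h₃ a b ha hab z
      _ = α * (K₃ * (‖w‖ * (‖z‖ ^ (α - 1) * reg b z ^ (p - α)) + Z)) := by rw [hZ]; ring
      _ ≤ _ := by rw [hY]; gcongr
  rw [e]
  have t5 : ∀ A B C D : ℝ, |A - B - C - D| ≤ |A| + |B| + |C| + |D| := fun A B C D =>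
    (abs_sub _ _).trans (add_le_add_left ((abs_sub _ _).trans (add_le_add_left (abs_sub _ _) _)) _)
  refine (t5 _ _ _ _).trans ?_
  have q1 : 0 ≤ ν * K₁ * (X + Z) := by positivity
  have q2 : 0 ≤ ν * K₂ * (Y + Z) := by positivity
  have q3 : 0 ≤ γ ^ α * K₄ * (Y + Z) := by positivity
  have q4 : 0 ≤ γ ^ α * α * K₃ * X := by positivity
  nlinarith

/-! ### Test functions for the negative moment -/

/-- A smooth function comparable with `reg b z ^ q` for `q < 0` near the origin is
`regBump q b z + powBump q 1 b z`. -/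
def regBump (q b : ℝ) (z : 𝔼) : ℝ := b ^ (-q) * bump (b • z)

theorem contDiff_regBump (q b : ℝ) : ContDiff ℝ ∞ (regBump q b : 𝔼 → ℝ) :=
  contDiff_const.mul (contDiff_comp_smul contDiff_bump b)

theorem hasCompactSupport_regBump (q : ℝ) {b : ℝ} (hb : 0 < b) :
    HasCompactSupport (regBump q b : 𝔼 → ℝ) :=
  HasCompactSupport.mul_left (hasCompactSupport_comp_smul hasCompactSupport_bump hb.ne')

theorem powBump_nonneg {q a b : ℝ} (ha : 0 < a) {z : 𝔼}
    (h : ‖z‖ ≤ a⁻¹) : 0 ≤ powBump q a b z := by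
  rw [powBump, bump_of_le (x := a • z)]
  · exact mul_nonneg (by positivity) (by linarith [bump_le_one (b • z)])
  · rw [norm_smul, norm_of_nonneg ha.le]
    calc a * ‖z‖ ≤ a * a⁻¹ := by gcongr
      _ = 1 := mul_inv_cancel₀ ha.ne'

theorem regBump_add_powBump_eq (q b : ℝ) (z : 𝔼) : regBump q b z + powBump q 1 b z =
    (b ^ (-q) - ‖z‖ ^ q) * bump (b • z) + ‖z‖ ^ q * bump z := by
  rw [regBump, powBump, one_smul]; ring

/-- The added `1` accounts for `‖z‖ ≥ 1`, where the left side is at most `1` while the test function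
may vanish. -/
theorem reg_rpow_le_regBump_add {q b : ℝ} (hq : q < 0) (hb : 1 ≤ b) (z : 𝔼) :
    reg b z ^ q ≤ regBump q b z + powBump q 1 b z + 1 := by
  have hb0 : 0 < b := by linarith
  have h0 := bump_nonneg (b • z)
  have h0' := bump_nonneg z
  rcases le_total ‖z‖ b⁻¹ with h | h
  · have h1 : ‖b • z‖ ≤ 1 := by
      rw [norm_smul, norm_of_nonneg hb0.le]
      calc b * ‖z‖ ≤ b * b⁻¹ := by gcongr
        _ = 1 := mul_inv_cancel₀ hb0.ne'
    have h2 : powBump q 1 b z = 0 := powBump_eq_zero_of_le one_pos hb h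
    rw [reg_rpow_of_le hb0 q h, h2, regBump, bump_of_le h1]
    linarith
  · have hz : 0 < ‖z‖ := (inv_pos.2 hb0).trans_le h
    rw [reg_rpow_of_ge q h, regBump_add_powBump_eq]
    have h3 : ‖z‖ ^ q ≤ b ^ (-q) := by
      have := rpow_le_rpow_of_nonpos (inv_pos.2 hb0) h hq.le
      rwa [inv_rpow hb0.le, ← rpow_neg hb0.le] at this
    have h4 : 0 ≤ (b ^ (-q) - ‖z‖ ^ q) * bump (b • z) := mul_nonneg (by linarith) h0
    rcases le_total ‖z‖ 1 with h5 | h5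
    · rw [bump_of_le h5]; linarith
    · have := rpow_le_one_of_one_le_of_nonpos h5 hq.le
      have : 0 ≤ ‖z‖ ^ q * bump z := by positivity
      linarith

theorem regBump_add_powBump_nonneg {q b : ℝ} (hq : q < 0) (hb : 1 ≤ b) (z : 𝔼) :
    0 ≤ regBump q b z + powBump q 1 b z := by
  have hb0 : 0 < b := by linarith
  have h0 := bump_nonneg (b • z)
  have h0' := bump_nonneg z
  rcases le_total ‖z‖ 1 with h | h
  · exact add_nonneg (mul_nonneg (by positivity) h0) (powBump_nonneg one_pos (by simpa))
  · rw [regBump_add_powBump_eq]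
    have h3 : ‖z‖ ^ q ≤ b ^ (-q) :=
      (rpow_le_one_of_one_le_of_nonpos h hq.le).trans (one_le_rpow hb (by linarith))
    have : 0 ≤ (b ^ (-q) - ‖z‖ ^ q) * bump (b • z) := mul_nonneg (by linarith) h0
    positivity

theorem rpow_neg_le_reg {q b : ℝ} (hq : q < 0) (hb : 0 < b) {z : 𝔼} (h : b * ‖z‖ ≤ 2) :
    b ^ (-q) ≤ 2 ^ (-q) * reg b z ^ q := by
  have h1 : reg b z ≤ 2 * b⁻¹ := by
    refine max_le ?_ ?_
    · have := inv_pos.2 hb; linarith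
    · rw [← div_eq_mul_inv, le_div_iff₀ hb]; linarith
  have h2 := rpow_le_rpow_of_nonpos (reg_pos hb z) h1 hq.le
  rw [mul_rpow (by norm_num) (by positivity), inv_rpow hb.le, ← rpow_neg hb.le] at h2
  calc b ^ (-q) = 2 ^ (-q) * (2 ^ q * b ^ (-q)) := by
        rw [← mul_assoc, ← rpow_add (by norm_num)]; simp
    _ ≤ _ := by gcongr

theorem regBump_le {q b : ℝ} (hq : q < 0) (hb : 0 < b) (z : 𝔼) :
    regBump q b z ≤ 2 ^ (-q) * reg b z ^ q := by
  have := reg_pos hb z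
  by_cases h : b * ‖z‖ ≤ 2
  · exact (mul_le_of_le_one_right (by positivity) (bump_le_one _)).trans (rpow_neg_le_reg hq hb h)
  · rw [regBump, bump_of_ge, mul_zero]
    · positivity
    · rw [norm_smul, norm_of_nonneg hb.le]; exact (not_le.1 h).le

theorem abs_powBump_le_reg {q b : ℝ} (hb : 1 ≤ b) (z : 𝔼) :
    |powBump q 1 b z| ≤ reg b z ^ q := by
  have hb0 : 0 < b := by linarith
  rcases le_total ‖z‖ b⁻¹ with h | h
  · rw [powBump_eq_zero_of_le one_pos hb h, abs_zero]
    have := reg_pos hb0 z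
    positivity
  · rw [reg_rpow_of_ge q h, powBump, abs_mul, abs_of_nonneg (by positivity)]
    exact mul_le_of_le_one_right (by positivity) (abs_bump_sub_le 1 b z)

theorem abs_generator_le {α ν γ : ℝ} (hα : 0 < α) (hα2 : α < 2) (hν : 0 < ν) (hγ : 0 < γ)
    (φ : 𝔼 → ℝ) (w z : 𝔼) {D₁ D₂ L₁ L₂ : ℝ} (h1 : |fderiv ℝ φ z w| ≤ ‖w‖ * D₁)
    (h2 : |fderiv ℝ φ z z| ≤ D₂) (h3 : |fracLaplacian α φ z| ≤ L₁)
    (h4 : ‖z‖ ^ α * |fracLaplacian α φ z| ≤ L₂) :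
    |generator α ν γ φ w z| ≤ ν * (‖w‖ * D₁ + D₂) + γ ^ α * (4 * (‖w‖ ^ α * L₁ + L₂)) := by
  have hγα : 0 < γ ^ α := rpow_pos_of_pos hγ α
  rw [generator]
  refine (abs_sub _ _).trans ?_
  rw [abs_mul, abs_mul, abs_of_pos hν, abs_of_pos hγα, abs_mul, abs_of_nonneg (by positivity :
    0 ≤ ‖w - z‖ ^ α), map_sub]
  refine add_le_add (mul_le_mul_of_nonneg_left ?_ hν.le) (mul_le_mul_of_nonneg_left ?_ hγα.le)
  · exact (abs_sub _ _).trans (add_le_add h1 h2)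
  · calc ‖w - z‖ ^ α * |fracLaplacian α φ z| ≤ 4 * (‖w‖ ^ α + ‖z‖ ^ α) * |fracLaplacian α φ z| := by
          gcongr
          exact norm_sub_rpow_le hα hα2 w z
      _ = 4 * (‖w‖ ^ α * |fracLaplacian α φ z| + ‖z‖ ^ α * |fracLaplacian α φ z|) := by ring
      _ ≤ _ := by gcongr

/-- The gradient costs a factor `1 / reg ≤ b` and the operator of order `α` a factor `b^α`; these
multiply the powers of `w`. The part of the generator with `w = 0` is invariant under dilations and
costs no derivative, only the maximal size `b^(α-p)` of the function. -/
theorem exists_bound_generator_powBump_sub [NeZero d] {α p ν γ : ℝ} (hp : 0 < p) (hpα : p < α)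
    (hα2 : α < 2) (hν : 0 < ν) (hγ : 0 < γ) : ∃ K, 0 < K ∧ ∀ b : ℝ, 1 ≤ b → ∀ w z : 𝔼,
      |generator α ν γ (powBump (p - α) 1 b) w z| ≤
        K * ((‖w‖ * b + ‖w‖ ^ α * b ^ α) * reg b z ^ (p - α) + b ^ (α - p)) := by
  have hα : 0 < α := by linarith
  obtain ⟨K₁, hK₁, h₁⟩ := exists_bound_fderiv_powBump (d := d) (p - α)
  obtain ⟨K₂, hK₂, h₂⟩ := exists_bound_fracLaplacian_powBump_sub (d := d) hp hpα hα2
  have hγα : 0 < γ ^ α := rpow_pos_of_pos hγ α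
  refine ⟨ν * K₁ + 4 * (γ ^ α * K₂), by positivity, fun b hb w z => ?_⟩
  have hb0 : 0 < b := by linarith
  have hr := reg_pos hb0 z
  have hgrad : ∀ u : 𝔼, |fderiv ℝ (powBump (p - α) 1 b) z u| ≤
      K₁ * (‖u‖ * (reg b z ^ (p - α) / reg b z)) := by
    intro u
    rcases lt_or_ge ‖z‖ b⁻¹ with h | h
    · have : (powBump (p - α) 1 b : 𝔼 → ℝ) =ᶠ[𝓝 z] fun _ => 0 := by
        have ho : IsOpen {y : 𝔼 | ‖y‖ < b⁻¹} := isOpen_lt continuous_norm continuous_const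
        filter_upwards [ho.mem_nhds h] with y hy
        exact powBump_eq_zero_of_le one_pos hb (le_of_lt hy)
      rw [this.fderiv_eq]
      simp only [fderiv_fun_const, Pi.zero_apply, _root_.zero_apply, abs_zero]
      positivity
    · have hz : 0 < ‖z‖ := (inv_pos.2 hb0).trans_le h
      have := h₁ 1 b one_pos hb z u
      rwa [rpow_sub_one hz.ne', ← reg_rpow_of_ge (p - α) h, show ‖z‖ = reg b z from
        (max_eq_right h).symm] at this
  have hinv : (reg b z)⁻¹ ≤ b := inv_le_of_inv_le₀ hb0 (le_max_left _ _)
  have g1 : |fderiv ℝ (powBump (p - α) 1 b) z w| ≤ ‖w‖ * (K₁ * (reg b z ^ (p - α) * b)) := by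
    refine (hgrad w).trans ?_
    rw [div_eq_mul_inv, mul_left_comm]
    gcongr
  have g2 : |fderiv ℝ (powBump (p - α) 1 b) z z| ≤ K₁ * b ^ (α - p) := by
    refine (hgrad z).trans ?_
    gcongr
    have e1 : ‖z‖ * (reg b z ^ (p - α) / reg b z) ≤ reg b z ^ (p - α) := by
      rw [mul_div_left_comm]
      exact mul_le_of_le_one_right (by positivity) ((div_le_one hr).2 (le_max_right _ _))
    have e2 := reg_rpow_le hb0 (show p - α ≤ 0 by linarith) z
    rw [neg_sub] at e2
    exact e1.trans e2
  obtain ⟨l1, l2⟩ := h₂ b hb z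
  refine (abs_generator_le hα hα2 hν hγ _ w z g1 g2 l1 l2).trans ?_
  set X := ‖w‖ * b * reg b z ^ (p - α) with hX
  set Y := ‖w‖ ^ α * b ^ α * reg b z ^ (p - α) with hY
  set Z := b ^ (α - p) with hZ
  have q1 : 0 ≤ ν * K₁ * Y := by positivity
  have q2 : 0 ≤ γ ^ α * K₂ * X := by positivity
  calc _ = ν * K₁ * (X + Z) + 4 * (γ ^ α * K₂) * (Y + Z) := by rw [hX, hY]; ring
    _ ≤ (ν * K₁ + 4 * (γ ^ α * K₂)) * (X + Y + Z) := by nlinarith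
    _ = _ := by rw [hX, hY]; ring

/-- The same bound as for the truncated negative power, obtained here by rescaling one fixed bump.
Its gradient lives on `1 ≤ b ‖z‖ ≤ 2`, where `b^(α-p)` and `reg^(p-α)` are comparable. -/
theorem exists_bound_generator_regBump {α p ν γ : ℝ} (hp : 0 < p) (hpα : p < α)
    (hα2 : α < 2) (hν : 0 < ν) (hγ : 0 < γ) : ∃ K, 0 < K ∧ ∀ b : ℝ, 1 ≤ b → ∀ w z : 𝔼,
      |generator α ν γ (regBump (p - α) b) w z| ≤
        K * ((‖w‖ * b + ‖w‖ ^ α * b ^ α) * reg b z ^ (p - α) + b ^ (α - p)) := by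
  have hα : 0 < α := by linarith
  obtain ⟨S, hS, hSb⟩ := exists_bound_mul_deriv_cutoff
  obtain ⟨K, hK, hbd⟩ := exists_decay_fracLaplacian hα hα2 (contDiff_bump (d := d))
    hasCompactSupport_bump
  have hγα : 0 < γ ^ α := rpow_pos_of_pos hγ α
  refine ⟨ν * (2 * S * 2 ^ (α - p)) + 4 * (γ ^ α * K), by positivity, fun b hb w z => ?_⟩
  have hb0 : 0 < b := by linarith
  have hr := reg_pos hb0 z
  have hdef : (regBump (p - α) b : 𝔼 → ℝ) = fun z => b ^ (α - p) * bump (b • z) := by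
    funext z; rw [regBump, neg_sub]
  have hfd : ∀ u : 𝔼, fderiv ℝ (regBump (p - α) b) z u =
      b ^ (α - p) * fderiv ℝ (fun z : 𝔼 => bump (b • z)) z u := by
    intro u
    rw [hdef, fderiv_const_mul (((contDiff_comp_smul contDiff_bump b).differentiable (by simp)) z)]
    rfl
  have hgrad : ∀ u : 𝔼, ‖z‖ * |fderiv ℝ (regBump (p - α) b) z u| ≤
      b ^ (α - p) * (2 * S * ‖u‖) := by
    intro u
    rcases eq_or_ne z 0 with rfl | hz
    · rw [norm_zero, zero_mul]; positivity
    have hz0 : 0 < ‖z‖ := norm_pos_iff.2 hz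
    have h := fderiv_bump_smul b z u
    have h2 : ‖z‖ * (‖z‖ * |fderiv ℝ (fun z : 𝔼 => bump (b • z)) z u|) ≤ ‖z‖ * (2 * S * ‖u‖) := by
      calc _ = |‖z‖ ^ 2 * fderiv ℝ (fun z : 𝔼 => bump (b • z)) z u| := by
            rw [abs_mul, abs_of_nonneg (by positivity : 0 ≤ ‖z‖ ^ 2)]; ring
        _ = 2 * |inner ℝ z u| * |cutGrad b z| := by
            rw [h, abs_mul, abs_mul]; norm_num
        _ ≤ 2 * (‖z‖ * ‖u‖) * S := by
            gcongr
            · exact abs_real_inner_le_norm z u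
            · exact hSb _
        _ = _ := by ring
    have h3 := le_of_mul_le_mul_left h2 hz0
    rw [hfd, abs_mul, abs_of_nonneg (by positivity : 0 ≤ b ^ (α - p)), mul_left_comm]
    gcongr
  have hzero : ∀ u : 𝔼, (b * ‖z‖ < 1 ∨ 2 < b * ‖z‖) → fderiv ℝ (regBump (p - α) b) z u = 0 := by
    intro u h
    rw [hfd, (hasFDerivAt_bump_smul b z).fderiv]
    have : deriv cutoff ((b * ‖z‖) ^ 2) = 0 := by
      rcases h with h | h
      · exact deriv_cutoff_of_lt (pow_lt_one₀ (by positivity) h (by norm_num))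
      · exact deriv_cutoff_of_gt (by nlinarith)
    rw [this]; simp
  have hpb := fun h => rpow_neg_le_reg (q := p - α) (b := b) (z := z) (by linarith) hb0 h
  simp only [neg_sub] at hpb
  have g1 : |fderiv ℝ (regBump (p - α) b) z w| ≤
      ‖w‖ * (2 * S * 2 ^ (α - p) * (b * reg b z ^ (p - α))) := by
    by_cases h : b * ‖z‖ < 1 ∨ 2 < b * ‖z‖
    · rw [hzero w h, abs_zero]; positivity
    · push Not at h
      have h1 : |fderiv ℝ (regBump (p - α) b) z w| ≤
          b * (‖z‖ * |fderiv ℝ (regBump (p - α) b) z w|) := by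
        rw [← mul_assoc]; exact le_mul_of_one_le_left (abs_nonneg _) h.1
      calc _ ≤ b * (b ^ (α - p) * (2 * S * ‖w‖)) := h1.trans (mul_le_mul_of_nonneg_left (hgrad w) hb0.le)
        _ ≤ b * (2 ^ (α - p) * reg b z ^ (p - α) * (2 * S * ‖w‖)) := by gcongr; exact hpb h.2
        _ = _ := by ring
  have g2 : |fderiv ℝ (regBump (p - α) b) z z| ≤ 2 * S * 2 ^ (α - p) * b ^ (α - p) := by
    rcases eq_or_ne z 0 with rfl | hz
    · rw [map_zero, abs_zero]; positivity
    have hz0 : 0 < ‖z‖ := norm_pos_iff.2 hz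
    have h1 : |fderiv ℝ (regBump (p - α) b) z z| ≤ b ^ (α - p) * (2 * S) := by
      refine le_of_mul_le_mul_left ((hgrad z).trans (le_of_eq ?_)) hz0
      ring
    have h2 : (1 : ℝ) ≤ 2 ^ (α - p) := one_le_rpow (by norm_num) (by linarith)
    calc _ ≤ b ^ (α - p) * (2 * S) := h1
      _ ≤ 2 ^ (α - p) * (b ^ (α - p) * (2 * S)) := le_mul_of_one_le_left (by positivity) h2
      _ = _ := by ring
  have hL : fracLaplacian α (regBump (p - α) b) z =
      b ^ (α - p) * (b ^ α * fracLaplacian α bump (b • z)) := by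
    rw [← fracLaplacian_comp_smul hα hα2 contDiff_bump hasCompactSupport_bump hb0,
      fracLaplacian_eq_heat hα hα2 (contDiff_regBump _ b) (hasCompactSupport_regBump _ hb0),
      fracLaplacian_eq_heat hα hα2 (contDiff_comp_smul contDiff_bump b)
        (hasCompactSupport_comp_smul hasCompactSupport_bump hb0.ne'), hdef, mul_left_comm]
    congr 1
    rw [← integral_const_mul]
    congr 1; ext v
    rw [mul_left_comm]
    congr 1
    rw [← integral_const_mul]
    congr 1; ext y; ring
  obtain ⟨k1, k2⟩ := hbd (b • z)
  rw [norm_smul, norm_of_nonneg hb0.le] at k2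
  have habs : |fracLaplacian α (regBump (p - α) b) z| =
      b ^ (α - p) * (b ^ α * |fracLaplacian α bump (b • z)|) := by
    rw [hL, abs_mul, abs_mul, abs_of_nonneg (by positivity), abs_of_nonneg (by positivity)]
  have l1 : |fracLaplacian α (regBump (p - α) b) z| ≤ K * (b ^ α * reg b z ^ (p - α)) := by
    rw [habs]
    have : b ^ (α - p) * |fracLaplacian α bump (b • z)| ≤ K * reg b z ^ (p - α) := by
      rcases le_total ‖z‖ b⁻¹ with h | h
      · rw [reg_rpow_of_le hb0 _ h, neg_sub, mul_comm]
        gcongr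
      · have hz : 0 < ‖z‖ := (inv_pos.2 hb0).trans_le h
        have hbz : 1 ≤ b * ‖z‖ := by
          calc 1 = b * b⁻¹ := (mul_inv_cancel₀ hb0.ne').symm
            _ ≤ _ := by gcongr
        have e1 : b ^ (α - p) = (b * ‖z‖) ^ (α - p) * ‖z‖ ^ (p - α) := by
          rw [mul_rpow hb0.le hz.le, mul_assoc, ← rpow_add hz]; simp
        -- Away from the origin the decay of `fracLaplacian α bump` is stronger than needed, and a
        -- power of `b ‖z‖ ≥ 1` may be given away.
        have e2 : (b * ‖z‖) ^ (α - p) ≤ (b * ‖z‖) ^ α :=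
          rpow_le_rpow_of_exponent_le hbz (by linarith)
        rw [reg_rpow_of_ge _ h, e1]
        calc _ = ((b * ‖z‖) ^ (α - p) * |fracLaplacian α bump (b • z)|) * ‖z‖ ^ (p - α) := by ring
          _ ≤ ((b * ‖z‖) ^ α * |fracLaplacian α bump (b • z)|) * ‖z‖ ^ (p - α) := by gcongr
          _ ≤ _ := by gcongr
    calc _ = b ^ α * (b ^ (α - p) * |fracLaplacian α bump (b • z)|) := by ring
      _ ≤ b ^ α * (K * reg b z ^ (p - α)) := by gcongr
      _ = _ := by ring
  have l2 : ‖z‖ ^ α * |fracLaplacian α (regBump (p - α) b) z| ≤ K * b ^ (α - p) := by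
    rw [mul_rpow hb0.le (norm_nonneg z)] at k2
    rw [habs]
    calc _ = (b ^ α * ‖z‖ ^ α * |fracLaplacian α bump (b • z)|) * b ^ (α - p) := by ring
      _ ≤ _ := by gcongr
  refine (abs_generator_le hα hα2 hν hγ _ w z g1 g2 l1 l2).trans ?_
  set X := ‖w‖ * b * reg b z ^ (p - α) with hX
  set Y := ‖w‖ ^ α * b ^ α * reg b z ^ (p - α) with hY
  set Z := b ^ (α - p) with hZ
  set K₁ := 2 * S * 2 ^ (α - p) with hK₁
  have q1 : 0 ≤ ν * K₁ * Y := by positivity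
  have q2 : 0 ≤ γ ^ α * K * X := by positivity
  calc _ = ν * K₁ * (X + Z) + 4 * (γ ^ α * K) * (Y + Z) := by rw [hX, hY]; ring
    _ ≤ (ν * K₁ + 4 * (γ ^ α * K)) * (X + Y + Z) := by nlinarith
    _ = _ := by rw [hX, hY]; ring


/-! ### The weak formulation -/

theorem integrable_of_continuous_of_bound {ρ : Measure 𝔼} [IsFiniteMeasure ρ] {g : 𝔼 → ℝ}
    (hg : Continuous g) {K : ℝ} (hK : ∀ x, |g x| ≤ K) (xs : 𝔼) :
    Integrable (fun x => g (x - xs)) ρ :=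
  Integrable.of_bound (hg.comp (by fun_prop)).aestronglyMeasurable K
    (ae_of_all _ fun x => hK _)

theorem integrable_test_measure {ρ : Measure 𝔼} [IsFiniteMeasure ρ] {φ : 𝔼 → ℝ}
    (hφ : Continuous φ) (hc : HasCompactSupport φ) (xs : 𝔼) :
    Integrable (fun x => φ (x - xs)) ρ := by
  obtain ⟨K, -, hK⟩ := exists_bound_of_test hφ hc
  exact integrable_of_continuous_of_bound hφ hK xs

theorem integrable_drift_and_diffusion {α : ℝ} (hα : 0 < α) (hα2 : α < 2) {φ : 𝔼 → ℝ}
    (hφ : ContDiff ℝ ∞ φ) (hc : HasCompactSupport φ) (ρ : Measure 𝔼) [IsFiniteMeasure ρ]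
    (w xs : 𝔼) : Integrable (fun x => fderiv ℝ φ (x - xs) (w - (x - xs))) ρ ∧
      Integrable (fun x => ‖w - (x - xs)‖ ^ α * fracLaplacian α φ (x - xs)) ρ := by
  constructor
  · have h2 : Continuous (fun z => fderiv ℝ φ z (w - z)) :=
      (hφ.continuous_fderiv (by simp)).clm_apply (by fun_prop)
    have h3 : HasCompactSupport (fun z => fderiv ℝ φ z (w - z)) := by
      refine (hc.fderiv ℝ).mono fun z hz => ?_
      rw [Function.mem_support] at hz ⊢
      contrapose! hz
      rw [hz]; rfl
    exact integrable_test_measure h2 h3 xs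
  · have h1 := continuous_fracLaplacian hα hα2 hφ hc
    have h3 : Continuous (fun z : 𝔼 => ‖w - z‖ ^ α) :=
      (continuous_const.sub continuous_id).norm.rpow_const fun _ => Or.inr hα.le
    obtain ⟨K, hK, hb⟩ := exists_decay_fracLaplacian hα hα2 hφ hc
    refine integrable_of_continuous_of_bound (K := 4 * (‖w‖ ^ α * K + K)) (h3.mul h1) (fun z => ?_) xs
    obtain ⟨b1, b2⟩ := hb z
    change |‖w - z‖ ^ α * fracLaplacian α φ z| ≤ _
    rw [abs_mul, abs_of_nonneg (by positivity)]
    calc _ ≤ 4 * (‖w‖ ^ α + ‖z‖ ^ α) * |fracLaplacian α φ z| :=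
          mul_le_mul_of_nonneg_right (norm_sub_rpow_le hα hα2 w z) (abs_nonneg _)
      _ = 4 * (‖w‖ ^ α * |fracLaplacian α φ z| + ‖z‖ ^ α * |fracLaplacian α φ z|) := by ring
      _ ≤ _ := by gcongr

theorem integrable_generator {α ν γ : ℝ} (hα : 0 < α) (hα2 : α < 2) {φ : 𝔼 → ℝ}
    (hφ : ContDiff ℝ ∞ φ) (hc : HasCompactSupport φ) (ρ : Measure 𝔼) [IsFiniteMeasure ρ]
    (w xs : 𝔼) : Integrable (fun x => generator α ν γ φ w (x - xs)) ρ := by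
  obtain ⟨h1, h2⟩ := integrable_drift_and_diffusion hα hα2 hφ hc ρ w xs
  exact (h1.const_mul ν).sub (h2.const_mul (γ ^ α))

/-- Testing with translates of `φ` puts the minimizer at the origin, since both operators commute
with translations. -/
theorem IsWeakSolution.hasDerivWithinAt_generator {𝓔 : 𝔼 → ℝ} {xs : 𝔼} {p α ν γ β T : ℝ}
    {f₀ : Measure 𝔼} {f : ℝ → Measure 𝔼} (h : IsWeakSolution 𝓔 xs p α ν γ β T f₀ f)
    (hα : 0 < α) (hα2 : α < 2) {φ : 𝔼 → ℝ} (hφ : ContDiff ℝ ∞ φ) (hc : HasCompactSupport φ)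
    {t : ℝ} (ht : t ∈ Icc 0 T) :
    HasDerivWithinAt (fun s => ∫ x, φ (x - xs) ∂(f s))
      (∫ x, generator α ν γ φ (consensusPoint 𝓔 β (f t) - xs) (x - xs) ∂(f t)) (Icc 0 T) t := by
  have := h.prob t ht
  have hφ' : ContDiff ℝ ∞ (fun x => φ (x - xs)) := hφ.comp (contDiff_id.sub contDiff_const)
  have hc' : HasCompactSupport (fun x => φ (x - xs)) :=
    hc.comp_homeomorph (Homeomorph.subRight xs)
  have hw := h.weak _ hφ' hc' t ht
  obtain ⟨h1, h2⟩ := integrable_drift_and_diffusion hα hα2 hφ hc (f t)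
    (consensusPoint 𝓔 β (f t) - xs) xs
  refine hw.congr_deriv ?_
  simp only [generator]
  rw [integral_sub (h1.const_mul ν) (h2.const_mul (γ ^ α)), integral_const_mul, integral_const_mul]
  simp_rw [fracLaplacian_comp_sub, fderiv_comp_sub, sub_sub_sub_cancel_right]

/-! ### The consensus point -/

theorem norm_le_one_add_rpow {p : ℝ} (hp : 1 ≤ p) (z : 𝔼) : ‖z‖ ≤ 1 + ‖z‖ ^ p := by
  rcases le_total ‖z‖ 1 with h | h
  · have : 0 ≤ ‖z‖ ^ p := by positivity
    linarith
  · have := rpow_le_rpow_of_exponent_le h hp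
    rw [rpow_one] at this; linarith

theorem integrable_norm_of_rpow {p : ℝ} (hp : 1 ≤ p) {ρ : Measure 𝔼} [IsFiniteMeasure ρ] {xs : 𝔼}
    (h : Integrable (fun x => ‖x - xs‖ ^ p) ρ) : Integrable (fun x => ‖x - xs‖) ρ := by
  refine Integrable.mono' ((integrable_const (1 : ℝ)).add h)
    (by apply Continuous.aestronglyMeasurable; fun_prop) (ae_of_all _ fun x => ?_)
  rw [norm_norm]
  exact norm_le_one_add_rpow hp _

/-- Quantitative Laplace principle. The sublevel set of height `q` lies within distance `η` and
contributes at most `η`. Outside it the weight is at most `e^{-βq}` relative to the minimum, while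
the normalization is at least `m e^{-βq/2}` because of the mass near `xs`. -/
theorem norm_consensusPoint_sub_le {𝓔 : 𝔼 → ℝ} {xs : 𝔼} (h𝓔 : Continuous 𝓔)
    (hmin : ∀ x, 𝓔 xs ≤ 𝓔 x) {q η r β : ℝ} (hη : 0 ≤ η) (hβ : 0 < β)
    (hq : ∀ x, 𝓔 x - 𝓔 xs ≤ q → ‖x - xs‖ ≤ η)
    (hr : ∀ x ∈ Metric.ball xs r, 𝓔 x - 𝓔 xs ≤ q / 2) {ρ : Measure 𝔼} [IsProbabilityMeasure ρ]
    (hρ : Integrable (fun x => ‖x - xs‖) ρ) {m : ℝ} (hm : 0 < m)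
    (hmr : m ≤ ρ.real (Metric.ball xs r)) :
    ‖consensusPoint 𝓔 β ρ - xs‖ ≤ η + Real.exp (-(β * q / 2)) * (∫ x, ‖x - xs‖ ∂ρ) / m := by
  set g : 𝔼 → ℝ := fun x => Real.exp (-β * 𝓔 x) with hg
  have hgc : Continuous g := by fun_prop
  have hgpos : ∀ x, 0 < g x := fun x => Real.exp_pos _
  have hgb : ∀ x, ‖g x‖ ≤ Real.exp (-β * 𝓔 xs) := fun x => by
    rw [norm_of_nonneg (hgpos x).le]
    refine Real.exp_le_exp.2 ?_
    nlinarith [hmin x]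
  have hgi : Integrable g ρ := Integrable.of_bound hgc.aestronglyMeasurable _ (ae_of_all _ hgb)
  have hgx : Integrable (fun x => g x • (x - xs)) ρ := by
    have : Integrable (fun x => x - xs) ρ :=
      (integrable_norm_iff (by apply Continuous.aestronglyMeasurable; fun_prop)).1 hρ
    exact this.bdd_smul (Real.exp (-β * 𝓔 xs)) hgc.aestronglyMeasurable (ae_of_all _ hgb)
  set Z := ∫ x, g x ∂ρ with hZ
  have hZm : Real.exp (-β * (𝓔 xs + q / 2)) * m ≤ Z := by
    calc Real.exp (-β * (𝓔 xs + q / 2)) * m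
        ≤ Real.exp (-β * (𝓔 xs + q / 2)) * ρ.real (Metric.ball xs r) := by gcongr
      _ = ∫ x in Metric.ball xs r, Real.exp (-β * (𝓔 xs + q / 2)) ∂ρ := by
          rw [setIntegral_const, smul_eq_mul, mul_comm]
      _ ≤ ∫ x in Metric.ball xs r, g x ∂ρ := by
          refine setIntegral_mono_on (integrable_const _).integrableOn hgi.integrableOn
            Metric.isOpen_ball.measurableSet fun x hx => ?_
          refine Real.exp_le_exp.2 ?_
          nlinarith [hr x hx]
      _ ≤ Z := setIntegral_le_integral hgi (ae_of_all _ fun x => (hgpos x).le)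
  have hZpos : 0 < Z := lt_of_lt_of_le (by positivity) hZm
  have hc : consensusPoint 𝓔 β ρ - xs = Z⁻¹ • ∫ x, g x • (x - xs) ∂ρ := by
    have hgx' : Integrable (fun x => g x • x) ρ := by
      have := hgx.add (hgi.smul_const xs)
      refine this.congr (ae_of_all _ fun x => ?_)
      simp only [Pi.add_apply]
      rw [← smul_add, sub_add_cancel]
    simp_rw [smul_sub]
    rw [integral_sub hgx' (hgi.smul_const xs), integral_smul_const, smul_sub, smul_smul,
      inv_mul_cancel₀ hZpos.ne', one_smul]
    rfl
  have hpt : ∀ x, ‖g x • (x - xs)‖ ≤ η * g x + Real.exp (-β * (𝓔 xs + q)) * ‖x - xs‖ := by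
    intro x
    rw [norm_smul, norm_of_nonneg (hgpos x).le]
    rcases le_total (𝓔 x - 𝓔 xs) q with h | h
    · have h1 : g x * ‖x - xs‖ ≤ η * g x := by
        rw [mul_comm]; exact mul_le_mul_of_nonneg_right (hq x h) (hgpos x).le
      have : 0 ≤ Real.exp (-β * (𝓔 xs + q)) * ‖x - xs‖ := by positivity
      linarith
    · have h1 : g x ≤ Real.exp (-β * (𝓔 xs + q)) := Real.exp_le_exp.2 (by nlinarith)
      have h2 := mul_le_mul_of_nonneg_right h1 (norm_nonneg (x - xs))
      have : 0 ≤ η * g x := mul_nonneg hη (hgpos x).le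
      linarith
  have hnorm : ‖∫ x, g x • (x - xs) ∂ρ‖ ≤
      η * Z + Real.exp (-β * (𝓔 xs + q)) * ∫ x, ‖x - xs‖ ∂ρ := by
    refine (norm_integral_le_of_norm_le ((hgi.const_mul η).add (hρ.const_mul _))
      (ae_of_all _ hpt)).trans (le_of_eq ?_)
    simp only [Pi.add_apply]
    rw [integral_add (hgi.const_mul η) (hρ.const_mul _), integral_const_mul, integral_const_mul]
  have hI : 0 ≤ ∫ x, ‖x - xs‖ ∂ρ := integral_nonneg fun x => norm_nonneg _
  rw [hc, norm_smul, norm_inv, norm_of_nonneg hZpos.le]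
  calc Z⁻¹ * ‖∫ x, g x • (x - xs) ∂ρ‖
      ≤ Z⁻¹ * (η * Z + Real.exp (-β * (𝓔 xs + q)) * ∫ x, ‖x - xs‖ ∂ρ) := by gcongr
    _ = η + Real.exp (-β * (𝓔 xs + q)) * (∫ x, ‖x - xs‖ ∂ρ) / Z := by field_simp
    _ ≤ η + Real.exp (-β * (𝓔 xs + q)) * (∫ x, ‖x - xs‖ ∂ρ) /
        (Real.exp (-β * (𝓔 xs + q / 2)) * m) := by gcongr
    _ = _ := by
      have : Real.exp (-β * (𝓔 xs + q)) =
          Real.exp (-β * (𝓔 xs + q / 2)) * Real.exp (-(β * q / 2)) := by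
        rw [← Real.exp_add]; congr 1; ring
      rw [this, mul_assoc, mul_div_mul_left _ _ (Real.exp_pos _).ne']

theorem exists_consensusPoint_close {𝓔 : 𝔼 → ℝ} {xs : 𝔼} (h𝓔 : Continuous 𝓔)
    (hgrowth : GrowthAssumption 𝓔 xs) {p : ℝ} (hp : 1 ≤ p) {m : ℝ → ℝ} (hm : ∀ r, 0 < r → 0 < m r)
    {A η : ℝ} (hA : 0 ≤ A) (hη : 0 < η) :
    ∃ β₀ : ℝ, 0 < β₀ ∧ ∀ β, β₀ < β → ∀ ρ : Measure 𝔼, IsProbabilityMeasure ρ →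
      Integrable (fun x => ‖x - xs‖ ^ p) ρ → Vmoment p xs ρ ≤ A →
      (∀ r, 0 < r → m r ≤ ρ.real (Metric.ball xs r)) → ‖consensusPoint 𝓔 β ρ - xs‖ ≤ η := by
  obtain ⟨hmin, Einf, R₀, ζ, μ, hE, hR, hζ, hμ, hnear, hfar⟩ := hgrowth
  -- The first entry forces the sublevel set into the ball of radius `R₀`; the second inverts the
  -- growth condition at distance `η / 2`.
  set q : ℝ := min Einf ((ζ * (η / 2)) ^ μ⁻¹) with hq
  have hq0 : 0 < q := lt_min hE (by positivity)
  have hqη : ∀ x, 𝓔 x - 𝓔 xs ≤ q → ‖x - xs‖ ≤ η / 2 := by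
    intro x hx
    have hxb : x ∈ Metric.ball xs R₀ := by
      by_contra hn
      exact absurd (hfar x hn) (not_lt.2 (hx.trans (min_le_left _ _)))
    refine (hnear x hxb).trans ?_
    rw [div_le_iff₀ hζ]
    calc (𝓔 x - 𝓔 xs) ^ μ ≤ ((ζ * (η / 2)) ^ μ⁻¹) ^ μ :=
          rpow_le_rpow (by linarith [hmin x]) (hx.trans (min_le_right _ _)) hμ.le
      _ = η / 2 * ζ := by
          rw [← rpow_mul (by positivity), inv_mul_cancel₀ hμ.ne', rpow_one, mul_comm]
  obtain ⟨r, hr, hball⟩ : ∃ r, 0 < r ∧ ∀ x ∈ Metric.ball xs r, 𝓔 x - 𝓔 xs ≤ q / 2 := by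
    have : ∀ᶠ x in 𝓝 xs, 𝓔 x < 𝓔 xs + q / 2 :=
      h𝓔.continuousAt.eventually_lt continuousAt_const (by linarith)
    obtain ⟨r, hr, h⟩ := Metric.eventually_nhds_iff_ball.1 this
    exact ⟨r, hr, fun x hx => by linarith [h x hx]⟩
  have hmr := hm r hr
  -- The threshold makes the exponential remainder at most `η / 2`, using only `e^{-x} ≤ 1/x` and a
  -- first moment of at most `1 + A`.
  refine ⟨4 * (1 + A) / (m r * η * q), by positivity, fun β hβ ρ hρ hint hV hmass => ?_⟩
  have hβ0 : 0 < β := lt_trans (by positivity) hβ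
  refine (norm_consensusPoint_sub_le h𝓔 hmin (by linarith) hβ0 hqη hball
    (integrable_norm_of_rpow hp hint) hmr (hmass r hr)).trans ?_
  have hI : ∫ x, ‖x - xs‖ ∂ρ ≤ 1 + A := by
    calc ∫ x, ‖x - xs‖ ∂ρ ≤ ∫ x, (1 + ‖x - xs‖ ^ p) ∂ρ :=
          integral_mono (integrable_norm_of_rpow hp hint) ((integrable_const _).add hint)
            fun x => norm_le_one_add_rpow hp _
      _ = 1 + Vmoment p xs ρ := by
          rw [integral_add (integrable_const _) hint]; simp [Vmoment]
      _ ≤ _ := by linarith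
  have hexp : Real.exp (-(β * q / 2)) ≤ (β * q / 2)⁻¹ := by
    rw [Real.exp_neg]
    have := Real.add_one_le_exp (β * q / 2)
    exact inv_anti₀ (by positivity) (by linarith)
  have h1 : Real.exp (-(β * q / 2)) * (∫ x, ‖x - xs‖ ∂ρ) / m r ≤ (β * q / 2)⁻¹ * (1 + A) / m r := by
    gcongr
  have h2 : (β * q / 2)⁻¹ * (1 + A) / m r ≤ η / 2 := by
    rw [div_lt_iff₀ (by positivity)] at hβ
    rw [div_le_iff₀ hmr, inv_mul_le_iff₀ (by positivity)]
    nlinarith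
  linarith

/-! ### Uniform integrability in time -/

theorem exists_integral_tail_le {p α : ℝ} (hpα : p < α) {ρ : Measure 𝔼} {xs : 𝔼}
    (hρ : Integrable (fun x => ‖x - xs‖ ^ p) ρ) {κ : ℝ} (hκ : 0 < κ) :
    ∃ a, 0 < a ∧ a ≤ 1 ∧ ∫ x, tail p α a (x - xs) ∂ρ ≤ κ := by
  have hlim : Tendsto (fun n : ℕ => ∫ x, tail p α (1 / ((n : ℝ) + 1)) (x - xs) ∂ρ) atTop
      (𝓝 (∫ _, (0 : ℝ) ∂ρ)) := by
    refine tendsto_integral_of_dominated_convergence (fun x => ‖x - xs‖ ^ p) (fun n => ?_) hρ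
      (fun n => ae_of_all _ fun x => ?_) (ae_of_all _ fun x => ?_)
    · apply Measurable.aestronglyMeasurable
      unfold tail; fun_prop
    · rw [norm_of_nonneg (tail_nonneg _ _ (by positivity) _)]
      exact tail_le _ _ _ _
    · have h1 : Tendsto (fun n : ℕ => (1 / ((n : ℝ) + 1) * ‖x - xs‖) ^ (α - p)) atTop (𝓝 0) := by
        have h2 := (tendsto_one_div_add_atTop_nhds_zero_nat (𝕜 := ℝ)).mul_const ‖x - xs‖
        rw [zero_mul] at h2
        have h3 := h2.rpow_const (p := α - p) (Or.inr (by linarith))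
        rwa [zero_rpow (by linarith)] at h3
      have h4 := ((tendsto_const_nhds (x := (1 : ℝ))).min h1).const_mul (‖x - xs‖ ^ p)
      rw [min_eq_right zero_le_one, mul_zero] at h4
      exact h4
  rw [integral_zero] at hlim
  obtain ⟨n, hn⟩ := (hlim.eventually (gt_mem_nhds hκ)).exists
  refine ⟨1 / ((n : ℝ) + 1), by positivity, ?_, hn.le⟩
  rw [div_le_one (by positivity)]
  linarith [n.cast_nonneg (α := ℝ)]

theorem integrable_tail {p α a : ℝ} {ρ : Measure 𝔼} {xs : 𝔼} (ha : 0 ≤ a)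
    (hρ : Integrable (fun x => ‖x - xs‖ ^ p) ρ) : Integrable (fun x => tail p α a (x - xs)) ρ := by
  refine Integrable.mono' hρ ?_ (ae_of_all _ fun x => ?_)
  · apply Measurable.aestronglyMeasurable
    unfold tail; fun_prop
  · rw [norm_of_nonneg (tail_nonneg _ _ ha _)]
    exact tail_le _ _ _ _

theorem powBump_le (q a b : ℝ) (z : 𝔼) : powBump q a b z ≤ ‖z‖ ^ q :=
  mul_le_of_le_one_right (by positivity) ((le_abs_self _).trans (abs_bump_sub_le a b z))

theorem tail_le_sub_powBump_add {p α a a₁ b : ℝ} (hp : 0 < p) (hpα : p < α) (ha : 0 < a)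
    (ha₁ : 0 < a₁) (hab : a₁ ≤ b) (z : 𝔼) :
    tail p α a z ≤ (‖z‖ ^ p - powBump p a₁ b z) + (2 * a₁⁻¹) ^ p * (a * (2 * a₁⁻¹)) ^ (α - p) := by
  rcases le_total (2 * a₁⁻¹) ‖z‖ with h | h
  · rw [powBump_of_ge ha₁ hab h, sub_zero]
    have := tail_le p α a z
    have : 0 ≤ (2 * a₁⁻¹) ^ p * (a * (2 * a₁⁻¹)) ^ (α - p) := by positivity
    linarith
  · have h1 : tail p α a z ≤ (2 * a₁⁻¹) ^ p * (a * (2 * a₁⁻¹)) ^ (α - p) := by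
      rw [tail]
      have : min 1 ((a * ‖z‖) ^ (α - p)) ≤ (a * (2 * a₁⁻¹)) ^ (α - p) :=
        (min_le_right _ _).trans (rpow_le_rpow (by positivity) (by gcongr) (by linarith))
      gcongr
    linarith [powBump_le p a₁ b z]

/-- A Dini-type argument. The part of the moment missed by one fixed test function is continuous in
time, because `V` is and because the equation applies to the test function. If it is small at `t₀`
it is small nearby, and there it controls the tails for all small `a`. Compactness of the time
interval concludes. -/
theorem IsWeakSolution.exists_tail_le {𝓔 : 𝔼 → ℝ} {xs : 𝔼} {p α ν γ β T : ℝ}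
    {f₀ : Measure 𝔼} {f : ℝ → Measure 𝔼} (h : IsWeakSolution 𝓔 xs p α ν γ β T f₀ f)
    (hp : 0 < p) (hpα : p < α) (hα2 : α < 2) {κ : ℝ} (hκ : 0 < κ) :
    ∃ a₀, 0 < a₀ ∧ ∀ a, 0 < a → a ≤ a₀ → ∀ t ∈ Icc 0 T, ∫ x, tail p α a (x - xs) ∂(f t) ≤ κ := by
  refine isCompact_Icc.induction_on (p := fun S => ∃ a₀, 0 < a₀ ∧ ∀ a, 0 < a → a ≤ a₀ →
    ∀ t ∈ S ∩ Icc 0 T, ∫ x, tail p α a (x - xs) ∂(f t) ≤ κ) ?_ ?_ ?_ ?_ |>.imp fun a₀ h =>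
    ⟨h.1, fun a ha haa t ht => h.2 a ha haa t ⟨ht, ht⟩⟩
  · exact ⟨1, one_pos, fun _ _ _ t ht => absurd ht.1 (notMem_empty t)⟩
  · rintro S S' hS ⟨a₀, h1, h2⟩
    exact ⟨a₀, h1, fun a ha haa t ht => h2 a ha haa t ⟨hS ht.1, ht.2⟩⟩
  · rintro S S' ⟨a₀, h1, h2⟩ ⟨a₁, h3, h4⟩
    refine ⟨min a₀ a₁, lt_min h1 h3, fun a ha haa t ht => ?_⟩
    rcases ht.1 with h5 | h5
    · exact h2 a ha (haa.trans (min_le_left _ _)) t ⟨h5, ht.2⟩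
    · exact h4 a ha (haa.trans (min_le_right _ _)) t ⟨h5, ht.2⟩
  · intro t₀ ht₀
    have hprob := h.prob t₀ ht₀
    have hα : 0 < α := by linarith
    obtain ⟨a₁, ha₁, ha₁1, htail⟩ := exists_integral_tail_le hpα (h.moment t₀ ht₀)
      (show 0 < κ / 8 by linarith)
    obtain ⟨b, hb1, hb⟩ : ∃ b : ℝ, 1 ≤ b ∧ 2 ^ p * b ^ (-p) ≤ κ / 8 := by
      have h1 : Tendsto (fun b : ℝ => 2 ^ p * b ^ (-p)) atTop (𝓝 0) := by
        simpa using (tendsto_rpow_neg_atTop hp).const_mul ((2 : ℝ) ^ p)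
      obtain ⟨b, hb⟩ := ((eventually_ge_atTop (1 : ℝ)).and
        (h1.eventually (gt_mem_nhds (show 0 < κ / 8 by linarith)))).exists
      exact ⟨b, hb.1, hb.2.le⟩
    have hab : a₁ ≤ b := ha₁1.trans hb1
    have hsm := contDiff_powBump (d := d) p ha₁ hab
    have hcs := hasCompactSupport_powBump (d := d) p ha₁ hab
    set D : ℝ → ℝ := fun t => Vmoment p xs (f t) - ∫ x, powBump p a₁ b (x - xs) ∂(f t) with hD
    have hDc : ContinuousOn D (Icc 0 T) := h.moment_cont.sub fun t ht =>
      (h.hasDerivWithinAt_generator hα hα2 hsm hcs ht).continuousWithinAt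
    have hint : ∀ t ∈ Icc 0 T, Integrable (fun x => powBump p a₁ b (x - xs)) (f t) := fun t ht =>
      have := h.prob t ht
      integrable_test_measure hsm.continuous hcs xs
    have hDeq : ∀ t ∈ Icc 0 T, D t = ∫ x, (‖x - xs‖ ^ p - powBump p a₁ b (x - xs)) ∂(f t) := by
      intro t ht
      rw [integral_sub (h.moment t ht) (hint t ht)]; rfl
    have hD0 : D t₀ ≤ κ / 4 := by
      rw [hDeq t₀ ht₀]
      calc _ ≤ ∫ x, (2 ^ p * b ^ (-p) + tail p α a₁ (x - xs)) ∂(f t₀) := by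
            refine integral_mono ((h.moment t₀ ht₀).sub (hint t₀ ht₀))
              ((integrable_const _).add (integrable_tail ha₁.le (h.moment t₀ ht₀))) fun x => ?_
            have := (abs_le.1 (abs_powBump_sub_le hp hpα ha₁ hab (x - xs))).1
            simp only
            linarith
        _ = 2 ^ p * b ^ (-p) + ∫ x, tail p α a₁ (x - xs) ∂(f t₀) := by
            rw [integral_add (integrable_const _) (integrable_tail ha₁.le (h.moment t₀ ht₀))]
            simp
        _ ≤ _ := by linarith
    have hev : ∀ᶠ t in 𝓝[Icc 0 T] t₀, D t < κ / 2 :=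
      (hDc t₀ ht₀).eventually (gt_mem_nhds (by linarith))
    obtain ⟨a₀, ha₀, hsmall⟩ : ∃ a₀ : ℝ, 0 < a₀ ∧ ∀ a, 0 < a → a ≤ a₀ →
        (2 * a₁⁻¹) ^ p * (a * (2 * a₁⁻¹)) ^ (α - p) ≤ κ / 2 := by
      have h1 : Tendsto (fun a : ℝ => (2 * a₁⁻¹) ^ p * (a * (2 * a₁⁻¹)) ^ (α - p)) (𝓝 0) (𝓝 0) := by
        have h2 : Tendsto (fun a : ℝ => a * (2 * a₁⁻¹)) (𝓝 0) (𝓝 0) := by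
          simpa using (tendsto_id (α := ℝ) (x := 𝓝 0)).mul_const (2 * a₁⁻¹)
        have h3 := (h2.rpow_const (p := α - p) (Or.inr (by linarith))).const_mul ((2 * a₁⁻¹) ^ p)
        rwa [zero_rpow (by linarith), mul_zero] at h3
      obtain ⟨δ, hδ, hδ2⟩ := Metric.eventually_nhds_iff_ball.1
        (h1.eventually (gt_mem_nhds (show 0 < κ / 2 by linarith)))
      refine ⟨δ / 2, by linarith, fun a ha haa => (hδ2 a ?_).le⟩
      rw [mem_ball_zero_iff, norm_of_nonneg ha.le]; linarith
    refine ⟨{t | D t < κ / 2}, hev, a₀, ha₀, fun a ha haa t ht => ?_⟩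
    have hprob := h.prob t ht.2
    have hDt : D t < κ / 2 := ht.1
    rw [hDeq t ht.2] at hDt
    have hs : Integrable (fun x => ‖x - xs‖ ^ p - powBump p a₁ b (x - xs)) (f t) :=
      (h.moment t ht.2).sub (hint t ht.2)
    calc _ ≤ ∫ x, ((‖x - xs‖ ^ p - powBump p a₁ b (x - xs)) +
          (2 * a₁⁻¹) ^ p * (a * (2 * a₁⁻¹)) ^ (α - p)) ∂(f t) :=
          integral_mono (integrable_tail ha.le (h.moment t ht.2))
            (hs.add (integrable_const _))
            fun x => tail_le_sub_powBump_add hp hpα ha ha₁ hab _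
      _ = (∫ x, (‖x - xs‖ ^ p - powBump p a₁ b (x - xs)) ∂(f t)) +
          (2 * a₁⁻¹) ^ p * (a * (2 * a₁⁻¹)) ^ (α - p) := by
          rw [integral_add hs (integrable_const _)]; simp
      _ ≤ κ := by linarith [hsmall a ha haa]


/-! ### Differential inequalities along weak solutions -/

/-- The regularized moment of order `p - α < 0`. -/
def regMoment (p α b : ℝ) (xs : 𝔼) (ρ : Measure 𝔼) : ℝ := ∫ x, reg b (x - xs) ^ (p - α) ∂ρ

theorem integrable_reg {p α b : ℝ} (hpα : p < α) (hb : 0 < b) (xs : 𝔼) (ρ : Measure 𝔼)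
    [IsFiniteMeasure ρ] : Integrable (fun x => reg b (x - xs) ^ (p - α)) ρ := by
  refine integrable_of_continuous_of_bound (continuous_reg_rpow hb (p - α)) (K := b ^ (α - p))
    (fun z => ?_) xs
  have h0 := reg_pos hb z
  rw [abs_of_nonneg (by positivity)]
  simpa using reg_rpow_le hb (q := p - α) (by linarith) z

theorem regMoment_nonneg {p α b : ℝ} (hb : 0 < b) (xs : 𝔼) (ρ : Measure 𝔼) :
    0 ≤ regMoment p α b xs ρ :=
  integral_nonneg fun x => (rpow_pos_of_pos (reg_pos hb (x - xs)) _).le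

theorem regMoment_le {p α b : ℝ} (hpα : p < α) (hb : 0 < b) (xs : 𝔼) (ρ : Measure 𝔼)
    [IsProbabilityMeasure ρ] : regMoment p α b xs ρ ≤ b ^ (α - p) := by
  calc regMoment p α b xs ρ ≤ ∫ _, b ^ (α - p) ∂ρ := by
        refine integral_mono (integrable_reg hpα hb xs ρ) (integrable_const _) fun x => ?_
        simpa using reg_rpow_le hb (q := p - α) (by linarith) (x - xs)
    _ = _ := by simp

theorem Vmoment_nonneg (p : ℝ) (xs : 𝔼) (ρ : Measure 𝔼) : 0 ≤ Vmoment p xs ρ :=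
  integral_nonneg fun _ => by positivity

theorem norm_rpow_mul_bump_le {p : ℝ} (hp : 0 ≤ p) {b : ℝ} (hb : 0 < b) (z : 𝔼) :
    ‖z‖ ^ p * bump (b • z) ≤ 2 ^ p * b ^ (-p) * bump (b • z) := by
  by_cases h : b * ‖z‖ ≤ 2
  · have hz : ‖z‖ ≤ 2 * b⁻¹ := by rw [← div_eq_mul_inv, le_div_iff₀ hb]; linarith
    refine mul_le_mul_of_nonneg_right ?_ (bump_nonneg _)
    calc ‖z‖ ^ p ≤ (2 * b⁻¹) ^ p := by gcongr
      _ = _ := by rw [mul_rpow (by norm_num) (by positivity), inv_rpow hb.le, rpow_neg hb.le]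
  · rw [bump_of_ge, mul_zero, mul_zero]
    rw [norm_smul, norm_of_nonneg hb.le]; linarith [not_le.1 h]

theorem norm_rpow_mul_one_sub_bump_le {p α : ℝ} (hpα : p < α) {a : ℝ} (ha : 0 < a) (z : 𝔼) :
    ‖z‖ ^ p * (1 - bump (a • z)) ≤ tail p α a z := by
  by_cases h : 1 ≤ a * ‖z‖
  · rw [tail_of_ge hpα h]
    exact mul_le_of_le_one_right (by positivity) (by linarith [bump_nonneg (a • z)])
  · rw [bump_of_le, sub_self, mul_zero]
    · exact tail_nonneg p α ha.le z
    · rw [norm_smul, norm_of_nonneg ha.le]; exact (not_le.1 h).le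

theorem norm_rpow_le_add_tail {p α : ℝ} (hp : 0 ≤ p) (hpα : p < α) {a b : ℝ} (ha : 0 < a)
    (hb : 0 < b) (z : 𝔼) : ‖z‖ ^ p ≤
      powBump p a b z + 2 ^ p * b ^ (-α) * regBump (p - α) b z + tail p α a z := by
  have e : ‖z‖ ^ p = powBump p a b z + ‖z‖ ^ p * bump (b • z) + ‖z‖ ^ p * (1 - bump (a • z)) := by
    rw [powBump]; ring
  have e2 : 2 ^ p * b ^ (-α) * regBump (p - α) b z = 2 ^ p * b ^ (-p) * bump (b • z) := by
    have : b ^ (-p) = b ^ (-α) * b ^ (-(p - α)) := by rw [← rpow_add hb]; congr 1; ring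
    rw [regBump, this]; ring
  rw [e2, e]
  linarith [norm_rpow_mul_bump_le hp hb z, norm_rpow_mul_one_sub_bump_le hpα ha z]

/-- The outer cutoff `a` depends on the solution, through its uniform integrability, and on `κ`; the
constant `K` does not depend on `a`, so the tails leave no trace except `κ`. The scale `b` stays
free and is chosen differently for long and for short times. -/
theorem exists_differential_inequality_Vmoment [NeZero d] {p α ν γ : ℝ} (hp : 1 < p)
    (hpα : p < α) (hα2 : α < 2) (hν : 0 < ν) (hγ : 0 < γ) : ∃ K, 0 < K ∧
    ∀ (𝓔 : 𝔼 → ℝ) (xs : 𝔼) (β T : ℝ) (f₀ : Measure 𝔼) (f : ℝ → Measure 𝔼),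
    IsWeakSolution 𝓔 xs p α ν γ β T f₀ f → ∀ b : ℝ, 1 ≤ b → ∀ κ : ℝ, 0 < κ →
    ∃ W W' : ℝ → ℝ, ∀ s ∈ Icc 0 T, HasDerivWithinAt W (W' s) (Icc 0 T) s ∧
      |W' s + Cconst d p α ν γ * Vmoment p xs (f s)| ≤
        K * (b ^ (-p) + ‖consensusPoint 𝓔 β (f s) - xs‖ * (1 + Vmoment p xs (f s)) +
          (‖consensusPoint 𝓔 β (f s) - xs‖ + ‖consensusPoint 𝓔 β (f s) - xs‖ ^ α) *
            regMoment p α b xs (f s)) + κ ∧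
      Vmoment p xs (f s) ≤ W s + κ ∧
      W s ≤ Vmoment p xs (f s) + K * (b ^ (-α) * regMoment p α b xs (f s)) := by
  have hp0 : 0 < p := by linarith
  have hα : 1 < α := by linarith
  have hα0 : 0 < α := by linarith
  obtain ⟨K₁, hK₁, h₁⟩ := exists_bound_generator_powBump (d := d) hp hpα hα2 hν hγ
  obtain ⟨K₂, hK₂, h₂⟩ := exists_bound_generator_regBump (d := d) hp0 hpα hα2 hν hγ
  refine ⟨K₁ + 2 ^ p * K₂ + 2 ^ p * 2 ^ (α - p), by positivity,
    fun 𝓔 xs β T f₀ f h b hb κ hκ => ?_⟩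
  have hb0 : 0 < b := by linarith
  -- Division by `K₁ + 1` makes both the tail itself and `K₁` times the tail at most `κ`.
  obtain ⟨a₀, ha₀, htail⟩ := h.exists_tail_le hp0 hpα hα2 (show 0 < κ / (K₁ + 1) by positivity)
  set a := min a₀ 1 with ha_def
  have ha : 0 < a := lt_min ha₀ one_pos
  have hab : a ≤ b := (min_le_right _ _).trans hb
  have sm1 := contDiff_powBump (d := d) p ha hab
  have cs1 := hasCompactSupport_powBump (d := d) p ha hab
  have sm2 := contDiff_regBump (d := d) (p - α) b
  have cs2 := hasCompactSupport_regBump (d := d) (p - α) hb0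
  -- The truncated power misses the mass near the origin, of size at most `2^p b^(-p)` times a bump.
  -- The second term fills this hole, so that `V ≤ W + κ` holds without an error in `b`, and it
  -- costs only `b^(-α)` times the negative moment.
  refine ⟨fun s => (∫ x, powBump p a b (x - xs) ∂(f s)) +
      2 ^ p * b ^ (-α) * ∫ x, regBump (p - α) b (x - xs) ∂(f s),
    fun s => (∫ x, generator α ν γ (powBump p a b) (consensusPoint 𝓔 β (f s) - xs) (x - xs)
      ∂(f s)) + 2 ^ p * b ^ (-α) * ∫ x, generator α ν γ (regBump (p - α) b)
        (consensusPoint 𝓔 β (f s) - xs) (x - xs) ∂(f s), fun s hs => ⟨?_, ?_, ?_, ?_⟩⟩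
  · exact (h.hasDerivWithinAt_generator hα0 hα2 sm1 cs1 hs).add
      ((h.hasDerivWithinAt_generator hα0 hα2 sm2 cs2 hs).const_mul _)
  all_goals have hprob := h.prob s hs
  all_goals have hV := h.moment s hs
  all_goals have hti := integrable_tail (p := p) (α := α) ha.le hV
  all_goals have htl := htail a ha (min_le_left _ _) s hs
  all_goals have hr := integrable_reg hpα hb0 xs (f s)
  · set w := consensusPoint 𝓔 β (f s) - xs with hw
    set V := Vmoment p xs (f s) with hVdef
    set J := regMoment p α b xs (f s) with hJdef
    have hV0 : 0 ≤ V := Vmoment_nonneg _ _ _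
    have hJ0 : 0 ≤ J := regMoment_nonneg hb0 _ _
    have g1 := integrable_generator (ν := ν) (γ := γ) hα0 hα2 sm1 cs1 (f s) w xs
    have e1 : |(∫ x, generator α ν γ (powBump p a b) w (x - xs) ∂(f s)) +
        Cconst d p α ν γ * V| ≤
        K₁ * (b ^ (-p) + κ / (K₁ + 1) + ‖w‖ * (1 + V) + ‖w‖ ^ α * J) := by
      have e : (∫ x, generator α ν γ (powBump p a b) w (x - xs) ∂(f s)) +
          Cconst d p α ν γ * V = ∫ x, (generator α ν γ (powBump p a b) w (x - xs) +
            Cconst d p α ν γ * ‖x - xs‖ ^ p) ∂(f s) := by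
        rw [integral_add g1 (hV.const_mul _), integral_const_mul]; rfl
      have i1 : Integrable (fun x => b ^ (-p) + tail p α a (x - xs)) (f s) :=
        (integrable_const _).add hti
      have i2 : Integrable (fun x => ‖w‖ * (1 + ‖x - xs‖ ^ p)) (f s) :=
        ((integrable_const _).add hV).const_mul _
      have i3 : Integrable (fun x => ‖w‖ ^ α * reg b (x - xs) ^ (p - α)) (f s) := hr.const_mul _
      have i4 : Integrable (fun x => b ^ (-p) + tail p α a (x - xs) +
        ‖w‖ * (1 + ‖x - xs‖ ^ p)) (f s) := i1.add i2
      rw [e, ← norm_eq_abs]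
      refine (norm_integral_le_of_norm_le ((i4.add i3).const_mul K₁)
        (ae_of_all _ fun x => h₁ a b ha hab w (x - xs))).trans ?_
      simp only [Pi.add_apply]
      rw [integral_const_mul, integral_add i4 i3, integral_add i1 i2,
        integral_add (integrable_const _) hti, integral_const_mul, integral_const_mul,
        integral_add (integrable_const _) hV]
      simp only [integral_const, probReal_univ, one_smul]
      change K₁ * (b ^ (-p) + _ + ‖w‖ * (1 + V) + ‖w‖ ^ α * J) ≤ _
      gcongr
    have e2 : |∫ x, generator α ν γ (regBump (p - α) b) w (x - xs) ∂(f s)| ≤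
        K₂ * ((‖w‖ * b + ‖w‖ ^ α * b ^ α) * J + b ^ (α - p)) := by
      rw [← norm_eq_abs]
      refine (norm_integral_le_of_norm_le
        (((hr.const_mul (‖w‖ * b + ‖w‖ ^ α * b ^ α)).add
          (integrable_const (b ^ (α - p)))).const_mul K₂)
        (ae_of_all _ fun x => h₂ b hb w (x - xs))).trans (le_of_eq ?_)
      simp only [Pi.add_apply]
      rw [integral_const_mul, integral_add (hr.const_mul _) (integrable_const _),
        integral_const_mul]
      simp only [integral_const, probReal_univ, one_smul]
      rfl
    have hbα : 0 < b ^ (-α) := by positivity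
    have e3 : 2 ^ p * b ^ (-α) * (K₂ * ((‖w‖ * b + ‖w‖ ^ α * b ^ α) * J + b ^ (α - p))) ≤
        2 ^ p * K₂ * (b ^ (-p) + (‖w‖ + ‖w‖ ^ α) * J) := by
      have r1 : b ^ (-α) * b ^ α = 1 := by rw [← rpow_add hb0]; simp
      have r2 : b ^ (-α) * b ^ (α - p) = b ^ (-p) := by rw [← rpow_add hb0]; congr 1; ring
      have r3 : b ^ (-α) * b ≤ 1 := by
        rw [← rpow_add_one hb0.ne']
        exact rpow_le_one_of_one_le_of_nonpos hb (by linarith)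
      have r4 : 2 ^ p * b ^ (-α) * (K₂ * ((‖w‖ * b + ‖w‖ ^ α * b ^ α) * J + b ^ (α - p))) =
          2 ^ p * K₂ * (b ^ (-α) * b ^ (α - p) +
            (‖w‖ * (b ^ (-α) * b) + ‖w‖ ^ α * (b ^ (-α) * b ^ α)) * J) := by ring
      rw [r4, r1, r2, mul_one]
      gcongr
      exact mul_le_of_le_one_right (norm_nonneg _) r3
    have e4 : K₁ * (κ / (K₁ + 1)) ≤ κ := by
      rw [mul_div_assoc', div_le_iff₀ (by positivity)]; nlinarith
    set I₁ := ∫ x, generator α ν γ (powBump p a b) w (x - xs) ∂(f s)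
    set I₂ := ∫ x, generator α ν γ (regBump (p - α) b) w (x - xs) ∂(f s)
    have hb1 : 0 < b ^ (-p) := by positivity
    have n1 : 0 ≤ ‖w‖ * (1 + V) := by positivity
    have n2 : 0 ≤ ‖w‖ * J := by positivity
    have n3 : 0 ≤ ‖w‖ ^ α * J := by positivity
    calc |I₁ + 2 ^ p * b ^ (-α) * I₂ + Cconst d p α ν γ * V|
        = |(I₁ + Cconst d p α ν γ * V) + 2 ^ p * b ^ (-α) * I₂| := by congr 1; ring
      _ ≤ |I₁ + Cconst d p α ν γ * V| + 2 ^ p * b ^ (-α) * |I₂| := by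
          refine (abs_add_le _ _).trans ?_
          rw [abs_mul _ I₂, abs_of_nonneg (show 0 ≤ 2 ^ p * b ^ (-α) by positivity)]
      _ ≤ K₁ * (b ^ (-p) + κ / (K₁ + 1) + ‖w‖ * (1 + V) + ‖w‖ ^ α * J) +
          2 ^ p * K₂ * (b ^ (-p) + (‖w‖ + ‖w‖ ^ α) * J) :=
          add_le_add e1 (le_trans (mul_le_mul_of_nonneg_left e2 (by positivity)) e3)
      _ = K₁ * (b ^ (-p) + ‖w‖ * (1 + V) + ‖w‖ ^ α * J) + K₁ * (κ / (K₁ + 1)) +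
          2 ^ p * K₂ * (b ^ (-p) + (‖w‖ + ‖w‖ ^ α) * J) := by ring
      _ ≤ K₁ * (b ^ (-p) + ‖w‖ * (1 + V) + (‖w‖ + ‖w‖ ^ α) * J) + κ +
          2 ^ p * K₂ * (b ^ (-p) + ‖w‖ * (1 + V) + (‖w‖ + ‖w‖ ^ α) * J) := by
          have q1 : b ^ (-p) + ‖w‖ * (1 + V) + ‖w‖ ^ α * J ≤
            b ^ (-p) + ‖w‖ * (1 + V) + (‖w‖ + ‖w‖ ^ α) * J := by linarith
          have q2 : b ^ (-p) + (‖w‖ + ‖w‖ ^ α) * J ≤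
            b ^ (-p) + ‖w‖ * (1 + V) + (‖w‖ + ‖w‖ ^ α) * J := by linarith
          exact add_le_add (add_le_add (mul_le_mul_of_nonneg_left q1 hK₁.le) e4)
            (mul_le_mul_of_nonneg_left q2 (by positivity))
      _ ≤ _ := by
          have : 0 ≤ 2 ^ p * 2 ^ (α - p) *
              (b ^ (-p) + ‖w‖ * (1 + V) + (‖w‖ + ‖w‖ ^ α) * J) := by positivity
          linarith
  · have g1 := integrable_test_measure (ρ := f s) sm1.continuous cs1 xs
    have g2 := integrable_test_measure (ρ := f s) sm2.continuous cs2 xs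
    have i1 : Integrable (fun x => powBump p a b (x - xs) +
      2 ^ p * b ^ (-α) * regBump (p - α) b (x - xs)) (f s) := g1.add (g2.const_mul _)
    have e1 : κ / (K₁ + 1) ≤ κ := div_le_self hκ.le (by linarith)
    calc Vmoment p xs (f s) ≤ ∫ x, (powBump p a b (x - xs) +
          2 ^ p * b ^ (-α) * regBump (p - α) b (x - xs) + tail p α a (x - xs)) ∂(f s) :=
          integral_mono hV (i1.add hti) fun x => norm_rpow_le_add_tail hp0.le hpα ha hb0 _
      _ = (∫ x, powBump p a b (x - xs) ∂(f s)) +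
          2 ^ p * b ^ (-α) * (∫ x, regBump (p - α) b (x - xs) ∂(f s)) +
            ∫ x, tail p α a (x - xs) ∂(f s) := by
          rw [integral_add i1 hti, integral_add g1 (g2.const_mul _), integral_const_mul]
      _ ≤ _ := by simp only; linarith
  · have g1 := integrable_test_measure (ρ := f s) sm1.continuous cs1 xs
    have g2 := integrable_test_measure (ρ := f s) sm2.continuous cs2 xs
    have e1 : ∫ x, powBump p a b (x - xs) ∂(f s) ≤ Vmoment p xs (f s) :=
      integral_mono g1 hV fun x => powBump_le _ _ _ _
    have e2 : ∫ x, regBump (p - α) b (x - xs) ∂(f s) ≤ 2 ^ (α - p) * regMoment p α b xs (f s) := by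
      rw [regMoment, ← integral_const_mul]
      refine integral_mono g2 (hr.const_mul _) fun x => ?_
      simpa using regBump_le (q := p - α) (by linarith) hb0 (x - xs)
    have hJ0 : 0 ≤ regMoment p α b xs (f s) := regMoment_nonneg hb0 _ _
    have e3 : 2 ^ p * b ^ (-α) * (∫ x, regBump (p - α) b (x - xs) ∂(f s)) ≤
        2 ^ p * b ^ (-α) * (2 ^ (α - p) * regMoment p α b xs (f s)) :=
      mul_le_mul_of_nonneg_left e2 (by positivity)
    have e4 : 0 ≤ (K₁ + 2 ^ p * K₂) * (b ^ (-α) * regMoment p α b xs (f s)) := by positivity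
    simp only
    linarith

/-- `regMoment` is not the integral of a test function; `X` is, and it is comparable with
`regMoment` up to constants and the additive `1`, with constants independent of `b`. -/
theorem exists_differential_inequality_regMoment [NeZero d] {p α ν γ : ℝ} (hp : 0 < p)
    (hpα : p < α) (hα2 : α < 2) (hν : 0 < ν) (hγ : 0 < γ) : ∃ K, 0 < K ∧
    ∀ (𝓔 : 𝔼 → ℝ) (xs : 𝔼) (β T : ℝ) (f₀ : Measure 𝔼) (f : ℝ → Measure 𝔼),
    IsWeakSolution 𝓔 xs p α ν γ β T f₀ f → ∀ b : ℝ, 1 ≤ b →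
    ∃ X X' : ℝ → ℝ, ∀ s ∈ Icc 0 T, HasDerivWithinAt X (X' s) (Icc 0 T) s ∧
      X' s ≤ K * ((‖consensusPoint 𝓔 β (f s) - xs‖ * b +
        ‖consensusPoint 𝓔 β (f s) - xs‖ ^ α * b ^ α) * regMoment p α b xs (f s) +
          b ^ (α - p)) ∧
      regMoment p α b xs (f s) ≤ X s + 1 ∧ 0 ≤ X s ∧
      X s ≤ K * regMoment p α b xs (f s) := by
  have hα0 : 0 < α := by linarith
  obtain ⟨K₁, hK₁, h₁⟩ := exists_bound_generator_powBump_sub (d := d) hp hpα hα2 hν hγ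
  obtain ⟨K₂, hK₂, h₂⟩ := exists_bound_generator_regBump (d := d) hp hpα hα2 hν hγ
  refine ⟨K₁ + K₂ + (2 ^ (α - p) + 1), by positivity, fun 𝓔 xs β T f₀ f h b hb => ?_⟩
  have hb0 : 0 < b := by linarith
  have sm1 := contDiff_powBump (d := d) (p - α) one_pos hb
  have cs1 := hasCompactSupport_powBump (d := d) (p - α) one_pos hb
  have sm2 := contDiff_regBump (d := d) (p - α) b
  have cs2 := hasCompactSupport_regBump (d := d) (p - α) hb0
  refine ⟨fun s => (∫ x, regBump (p - α) b (x - xs) ∂(f s)) +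
      ∫ x, powBump (p - α) 1 b (x - xs) ∂(f s),
    fun s => (∫ x, generator α ν γ (regBump (p - α) b)
        (consensusPoint 𝓔 β (f s) - xs) (x - xs) ∂(f s)) +
      ∫ x, generator α ν γ (powBump (p - α) 1 b) (consensusPoint 𝓔 β (f s) - xs) (x - xs)
        ∂(f s), fun s hs => ?_⟩
  have hprob := h.prob s hs
  have hr := integrable_reg hpα hb0 xs (f s)
  have g1 := integrable_test_measure (ρ := f s) sm1.continuous cs1 xs
  have g2 := integrable_test_measure (ρ := f s) sm2.continuous cs2 xs
  have hJ0 : 0 ≤ regMoment p α b xs (f s) := regMoment_nonneg hb0 _ _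
  refine ⟨(h.hasDerivWithinAt_generator hα0 hα2 sm2 cs2 hs).add
    (h.hasDerivWithinAt_generator hα0 hα2 sm1 cs1 hs), ?_, ?_, ?_, ?_⟩
  · set w := consensusPoint 𝓔 β (f s) - xs with hw
    set J := regMoment p α b xs (f s) with hJdef
    have key : ∀ (φ : 𝔼 → ℝ) (K : ℝ), (∀ z, |generator α ν γ φ w z| ≤
        K * ((‖w‖ * b + ‖w‖ ^ α * b ^ α) * reg b z ^ (p - α) + b ^ (α - p))) →
        ∫ x, generator α ν γ φ w (x - xs) ∂(f s) ≤
          K * ((‖w‖ * b + ‖w‖ ^ α * b ^ α) * J + b ^ (α - p)) := by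
      intro φ K hφ
      refine (le_abs_self _).trans ?_
      rw [← norm_eq_abs]
      refine (norm_integral_le_of_norm_le
        (((hr.const_mul (‖w‖ * b + ‖w‖ ^ α * b ^ α)).add
          (integrable_const (b ^ (α - p)))).const_mul K)
        (ae_of_all _ fun x => hφ (x - xs))).trans (le_of_eq ?_)
      simp only [Pi.add_apply]
      rw [integral_const_mul, integral_add (hr.const_mul _) (integrable_const _),
        integral_const_mul]
      simp only [integral_const, probReal_univ, one_smul]
      rfl
    have := key _ _ (h₁ b hb w)
    have := key _ _ (h₂ b hb w)
    have : 0 ≤ (2 ^ (α - p) + 1) * ((‖w‖ * b + ‖w‖ ^ α * b ^ α) * J + b ^ (α - p)) := by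
      positivity
    simp only
    linarith
  · simp only
    rw [← integral_add g2 g1]
    calc regMoment p α b xs (f s) ≤ ∫ x, (regBump (p - α) b (x - xs) +
          powBump (p - α) 1 b (x - xs) + 1) ∂(f s) :=
          integral_mono hr ((g2.add g1).add (integrable_const _))
            fun x => reg_rpow_le_regBump_add (by linarith) hb _
      _ = _ := by
        have : Integrable (fun x => regBump (p - α) b (x - xs) + powBump (p - α) 1 b (x - xs))
          (f s) := g2.add g1
        rw [integral_add this (integrable_const _)]; simp
  · simp only
    rw [← integral_add g2 g1]
    exact integral_nonneg fun x => regBump_add_powBump_nonneg (by linarith) hb _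
  · have e1 : ∫ x, regBump (p - α) b (x - xs) ∂(f s) ≤ 2 ^ (α - p) * regMoment p α b xs (f s) := by
      rw [regMoment, ← integral_const_mul]
      refine integral_mono g2 (hr.const_mul _) fun x => ?_
      simpa using regBump_le (q := p - α) (by linarith) hb0 (x - xs)
    have e2 : ∫ x, powBump (p - α) 1 b (x - xs) ∂(f s) ≤ regMoment p α b xs (f s) :=
      integral_mono g1 hr fun x => (le_abs_self _).trans (abs_powBump_le_reg hb _)
    have : 0 ≤ (K₁ + K₂) * regMoment p α b xs (f s) := by positivity
    simp only
    linarith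


/-! ### Closeness to the exponential decay -/

/-- Continuity method: if `V` reached `A`, there would be a first such time, before which `V ≤ A`,
and the implication excludes it. -/
theorem lt_of_forall_imp_lt {V : ℝ → ℝ} {T A : ℝ} (hV : ContinuousOn V (Icc 0 T)) (h0 : V 0 < A)
    (h : ∀ τ ∈ Icc 0 T, (∀ s ∈ Icc 0 τ, V s ≤ A) → V τ < A) : ∀ t ∈ Icc 0 T, V t < A := by
  by_contra! hcon
  obtain ⟨t, ht, hVt⟩ := hcon
  have ivt : ∀ s ∈ Icc 0 T, A ≤ V s → ∃ u ∈ Icc 0 s, V u = A := fun s hs hAs =>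
    intermediate_value_Icc hs.1 (hV.mono (Icc_subset_Icc_right hs.2)) ⟨h0.le, hAs⟩
  have hclosed : IsCompact (Icc 0 T ∩ V ⁻¹' {A}) :=
    isCompact_Icc.of_isClosed_subset (hV.preimage_isClosed_of_isClosed isClosed_Icc
      isClosed_singleton) inter_subset_left
  obtain ⟨u, hu, hVu⟩ := ivt t ht hVt
  obtain ⟨τ, hτ, hleast⟩ := hclosed.exists_isLeast ⟨u, ⟨hu.1, hu.2.trans ht.2⟩, hVu⟩
  refine (h τ hτ.1 fun s hs => ?_).ne hτ.2
  by_contra! hs'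
  obtain ⟨v, hv, hVv⟩ := ivt s ⟨hs.1, hs.2.trans hτ.1.2⟩ hs'.le
  have := hleast ⟨⟨hv.1, hv.2.trans (hs.2.trans hτ.1.2)⟩, hVv⟩
  have : s = τ := le_antisymm hs.2 (this.trans hv.2)
  rw [this] at hs'
  exact hs'.ne' hτ.2

/-- `V` is not known to be differentiable, so the integrating factor `e^{Cs}` is applied to the
nearby function `W`, and the difference is paid for at both ends and in the rate. -/
theorem abs_sub_mul_exp_le {V W W' : ℝ → ℝ} {C e₁ e₂ τ : ℝ} (hC : 0 ≤ C) (hτ : 0 ≤ τ)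
    (hW : ∀ s ∈ Icc 0 τ, HasDerivWithinAt W (W' s) (Icc 0 τ) s)
    (h1 : ∀ s ∈ Icc 0 τ, |W' s + C * V s| ≤ e₁) (h2 : ∀ s ∈ Icc 0 τ, |W s - V s| ≤ e₂) :
    |V τ - V 0 * Real.exp (-C * τ)| ≤ 2 * e₂ + Real.exp (C * τ) * (e₁ + C * e₂) * τ := by
  have m0 : (0 : ℝ) ∈ Icc 0 τ := ⟨le_rfl, hτ⟩
  have m1 : τ ∈ Icc 0 τ := ⟨hτ, le_rfl⟩
  have he1 : 0 ≤ e₁ := (abs_nonneg _).trans (h1 0 m0)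
  have he2 : 0 ≤ e₂ := (abs_nonneg _).trans (h2 0 m0)
  have hd : ∀ s ∈ Icc 0 τ, HasDerivWithinAt (fun s => Real.exp (C * s) * W s)
      (Real.exp (C * s) * (W' s + C * W s)) (Icc 0 τ) s := by
    intro s hs
    have h3 : HasDerivAt (fun s => Real.exp (C * s)) (Real.exp (C * s) * C) s := by
      simpa using ((hasDerivAt_id s).const_mul C).exp
    exact (h3.hasDerivWithinAt.mul (hW s hs)).congr_deriv (by ring)
  have hb : ∀ s ∈ Icc 0 τ, ‖Real.exp (C * s) * (W' s + C * W s)‖ ≤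
      Real.exp (C * τ) * (e₁ + C * e₂) := by
    intro s hs
    rw [norm_mul, norm_of_nonneg (Real.exp_pos _).le, norm_eq_abs]
    have e : W' s + C * W s = (W' s + C * V s) + C * (W s - V s) := by ring
    have : |W' s + C * W s| ≤ e₁ + C * e₂ := by
      rw [e]
      refine (abs_add_le _ _).trans (add_le_add (h1 s hs) ?_)
      rw [abs_mul, abs_of_nonneg hC]
      exact mul_le_mul_of_nonneg_left (h2 s hs) hC
    exact mul_le_mul (Real.exp_le_exp.2 (mul_le_mul_of_nonneg_left hs.2 hC)) this
      (abs_nonneg _) (Real.exp_pos _).le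
  have hmain := (convex_Icc 0 τ).norm_image_sub_le_of_norm_hasDerivWithin_le hd hb m0 m1
  simp only [mul_zero, Real.exp_zero, one_mul, sub_zero, norm_of_nonneg hτ, norm_eq_abs] at hmain
  have hE : Real.exp (-C * τ) * Real.exp (C * τ) = 1 := by
    rw [← Real.exp_add]; simp
  have hE0 := Real.exp_pos (-C * τ)
  have hE1 : Real.exp (-C * τ) ≤ 1 := Real.exp_le_one_iff.2 (by nlinarith)
  have e : V τ - V 0 * Real.exp (-C * τ) = -(W τ - V τ) +
      Real.exp (-C * τ) * (Real.exp (C * τ) * W τ - W 0) + Real.exp (-C * τ) * (W 0 - V 0) := by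
    linear_combination (-W τ) * hE
  rw [e]
  refine (abs_add_three _ _ _).trans ?_
  rw [abs_neg, abs_mul, abs_mul, abs_of_pos hE0]
  have f1 := h2 τ m1
  have f2 : Real.exp (-C * τ) * |W 0 - V 0| ≤ e₂ :=
    (mul_le_of_le_one_left (abs_nonneg _) hE1).trans (h2 0 m0)
  have f3 : Real.exp (-C * τ) * |Real.exp (C * τ) * W τ - W 0| ≤
      Real.exp (C * τ) * (e₁ + C * e₂) * τ :=
    (mul_le_of_le_one_left (abs_nonneg _) hE1).trans hmain
  linarith

theorem exists_rpow_neg_le {p κ : ℝ} (hp : 0 < p) (hκ : 0 < κ) (K : ℝ) :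
    ∃ b : ℝ, 1 ≤ b ∧ K * b ^ (-p) ≤ κ := by
  have h1 : Tendsto (fun b : ℝ => K * b ^ (-p)) atTop (𝓝 0) := by
    simpa using (tendsto_rpow_neg_atTop hp).const_mul K
  obtain ⟨b, hb⟩ := ((eventually_ge_atTop (1 : ℝ)).and (h1.eventually (gt_mem_nhds hκ))).exists
  exact ⟨b, hb.1, hb.2.le⟩

theorem exists_pos_mul_add_rpow_le {α κ : ℝ} (hα : 0 < α) (hκ : 0 < κ) (A B : ℝ) {η : ℝ}
    (hη : 0 < η) : ∃ w : ℝ, 0 < w ∧ w ≤ η ∧ w * A + (w + w ^ α) * B ≤ κ := by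
  have h1 : Tendsto (fun w : ℝ => w * A + (w + w ^ α) * B) (𝓝 0) (𝓝 0) := by
    have hc : ContinuousAt (fun w : ℝ => w * A + (w + w ^ α) * B) 0 := by
      have := continuousAt_rpow_const (0 : ℝ) α (Or.inr hα.le)
      fun_prop
    simpa [ContinuousAt, zero_rpow hα.ne'] using hc
  obtain ⟨δ, hδ, h⟩ := Metric.eventually_nhds_iff_ball.1 (h1.eventually (gt_mem_nhds hκ))
  refine ⟨min (δ / 2) η, lt_min (by linarith) hη, min_le_right _ _, (h _ ?_).le⟩
  rw [mem_ball_zero_iff, norm_of_nonneg (le_min (by linarith) hη.le)]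
  exact (min_le_left _ _).trans_lt (by linarith)

/-- The order of choices matters: `b` makes the truncation errors small, then `w` beats the possibly
huge bound `b^(α-p)` for the negative moment, and then `β₀` brings the consensus point within `w`.
The last choice presupposes `V ≤ V₀ + 1`, which the continuity method supplies. -/
theorem exists_forall_abs_Vmoment_sub_le [NeZero d] {𝓔 : 𝔼 → ℝ} {xs : 𝔼} (h𝓔 : Continuous 𝓔)
    (hgrowth : GrowthAssumption 𝓔 xs) {p α ν γ : ℝ} (hp : 1 < p) (hpα : p < α) (hα2 : α < 2)
    (hν : 0 < ν) (hγ : 0 < γ) (hC : 0 ≤ Cconst d p α ν γ) {T : ℝ} (hT : 0 ≤ T) (f₀ : Measure 𝔼)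
    {m : ℝ → ℝ} (hm : ∀ r, 0 < r → 0 < m r) {σ η : ℝ} (hσ : 0 < σ) (hη : 0 < η) :
    ∃ β₀ : ℝ, 0 < β₀ ∧ ∀ β, β₀ < β → ∀ f : ℝ → Measure 𝔼,
      IsWeakSolution 𝓔 xs p α ν γ β T f₀ f →
      (∀ r, 0 < r → ∀ t ∈ Icc 0 T, m r ≤ (f t).real (Metric.ball xs r)) → ∀ t ∈ Icc 0 T,
        |Vmoment p xs (f t) - Vmoment p xs f₀ * Real.exp (-Cconst d p α ν γ * t)| ≤ σ ∧
        ‖consensusPoint 𝓔 β (f t) - xs‖ ≤ η := by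
  have hp0 : 0 < p := by linarith
  have hα0 : 0 < α := by linarith
  obtain ⟨K, hK, hineq⟩ := exists_differential_inequality_Vmoment (d := d) hp hpα hα2 hν hγ
  set C := Cconst d p α ν γ with hCdef
  set V₀ := Vmoment p xs f₀ with hV₀
  have hV₀0 : 0 ≤ V₀ := Vmoment_nonneg _ _ _
  set L := Real.exp (C * T) * (1 + C) * T with hL
  have hL0 : 0 ≤ L := by positivity
  -- With both errors equal to `e`, the comparison lemma yields at most `(2 + L) e = min σ (1/2)`;
  -- the value `1/2 < 1` closes the continuity argument.
  set e := min σ (1 / 2) / (2 + L) with he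
  have hmin : 0 < min σ (1 / 2) := lt_min hσ (by norm_num)
  have he0 : 0 < e := by positivity
  obtain ⟨b, hb1, hb⟩ := exists_rpow_neg_le hp0 (show 0 < e / 4 by linarith) K
  have hb0 : 0 < b := by linarith
  obtain ⟨w, hw0, hwη, hw⟩ := exists_pos_mul_add_rpow_le hα0 (show 0 < e / (4 * K) by positivity)
    (1 + (V₀ + 1)) (b ^ (α - p)) hη
  obtain ⟨β₀, hβ₀, hcons⟩ := exists_consensusPoint_close h𝓔 hgrowth hp.le hm
    (show 0 ≤ V₀ + 1 by linarith) hw0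
  refine ⟨β₀, hβ₀, fun β hβ f h hmass => ?_⟩
  have hcp : ∀ t ∈ Icc 0 T, Vmoment p xs (f t) ≤ V₀ + 1 →
      ‖consensusPoint 𝓔 β (f t) - xs‖ ≤ w := fun t ht hV =>
    hcons β hβ (f t) (h.prob t ht) (h.moment t ht) hV fun r hr => hmass r hr t ht
  obtain ⟨W, W', hW⟩ := hineq 𝓔 xs β T f₀ f h b hb1 (e / 4) (by linarith)
  have hclose : ∀ τ ∈ Icc 0 T, (∀ s ∈ Icc 0 τ, Vmoment p xs (f s) ≤ V₀ + 1) →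
      |Vmoment p xs (f τ) - V₀ * Real.exp (-C * τ)| ≤ min σ (1 / 2) := by
    intro τ hτ hVτ
    have hsub : Icc 0 τ ⊆ Icc 0 T := Icc_subset_Icc_right hτ.2
    have hJ : ∀ s ∈ Icc 0 τ, regMoment p α b xs (f s) ≤ b ^ (α - p) := fun s hs =>
      have := h.prob s (hsub hs)
      regMoment_le hpα hb0 xs (f s)
    have h1 : ∀ s ∈ Icc 0 τ, |W' s + C * Vmoment p xs (f s)| ≤ e := by
      intro s hs
      refine ((hW s (hsub hs)).2.1).trans ?_
      have hc := hcp s (hsub hs) (hVτ s hs)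
      have c1 : ‖consensusPoint 𝓔 β (f s) - xs‖ * (1 + Vmoment p xs (f s)) ≤
          w * (1 + (V₀ + 1)) :=
        mul_le_mul hc (by linarith [hVτ s hs]) (by linarith [Vmoment_nonneg p xs (f s)]) hw0.le
      have c2 : (‖consensusPoint 𝓔 β (f s) - xs‖ + ‖consensusPoint 𝓔 β (f s) - xs‖ ^ α) *
          regMoment p α b xs (f s) ≤ (w + w ^ α) * b ^ (α - p) :=
        mul_le_mul (add_le_add hc (rpow_le_rpow (norm_nonneg _) hc hα0.le)) (hJ s hs)
          (regMoment_nonneg hb0 _ _) (by positivity)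
      have c3 : K * (w * (1 + (V₀ + 1)) + (w + w ^ α) * b ^ (α - p)) ≤ e / 4 := by
        refine (mul_le_mul_of_nonneg_left hw hK.le).trans (le_of_eq ?_)
        field_simp
      have c4 := mul_le_mul_of_nonneg_left (add_le_add c1 c2) hK.le
      linarith
    have h2 : ∀ s ∈ Icc 0 τ, |W s - Vmoment p xs (f s)| ≤ e := by
      intro s hs
      obtain ⟨-, -, d1, d2⟩ := hW s (hsub hs)
      have d3 : K * (b ^ (-α) * regMoment p α b xs (f s)) ≤ K * b ^ (-p) := by
        have : b ^ (-p) = b ^ (-α) * b ^ (α - p) := by rw [← rpow_add hb0]; congr 1; ring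
        rw [this]
        have := hJ s hs
        gcongr
      rw [abs_le]
      constructor <;> linarith
    have h3 := abs_sub_mul_exp_le hC hτ.1
      (fun s hs => (hW s (hsub hs)).1.mono hsub) h1 h2
    rw [h.initial] at h3
    refine h3.trans ?_
    have h4 : Real.exp (C * τ) * (e + C * e) * τ ≤ L * e := by
      calc Real.exp (C * τ) * (e + C * e) * τ ≤ Real.exp (C * T) * (e + C * e) * T := by
            have := hτ.2
            have := hτ.1
            gcongr
        _ = L * e := by rw [hL]; ring
    calc _ ≤ 2 * e + L * e := by linarith
      _ = (2 + L) * e := by ring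
      _ = _ := by rw [he]; field_simp
  have hbound : ∀ t ∈ Icc 0 T, Vmoment p xs (f t) < V₀ + 1 := by
    refine lt_of_forall_imp_lt h.moment_cont (by rw [h.initial]; linarith) fun τ hτ hV => ?_
    have h1 := (abs_le.1 (hclose τ hτ hV)).2
    have h2 : Real.exp (-C * τ) ≤ 1 := Real.exp_le_one_iff.2 (by nlinarith [hτ.1])
    have h3 := mul_le_of_le_one_right hV₀0 h2
    have h4 := min_le_right σ (1 / 2)
    linarith
  intro t ht
  exact ⟨(hclose t ht fun s hs => (hbound s ⟨hs.1, hs.2.trans ht.2⟩).le).trans (min_le_left _ _),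
    (hcp t ht (hbound t ht).le).trans hwη⟩


/-! ### Decay for small times -/

theorem le_of_hasDerivWithinAt_nonpos {g g' : ℝ → ℝ} {t : ℝ}
    (hg : ∀ s ∈ Icc 0 t, HasDerivWithinAt g (g' s) (Icc 0 t) s) (hg' : ∀ s ∈ Icc 0 t, g' s ≤ 0) :
    ∀ s ∈ Icc 0 t, g s ≤ g 0 := by
  have hanti : AntitoneOn g (Icc 0 t) :=
    antitoneOn_of_hasDerivWithinAt_nonpos (convex_Icc 0 t)
      (fun s hs => (hg s hs).continuousWithinAt)
      (fun s hs => (hg s (interior_subset hs)).mono interior_subset)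
      fun s hs => hg' s (interior_subset hs)
  exact fun s hs => hanti ⟨le_rfl, hs.1.trans hs.2⟩ hs hs.1

/-- Gronwall's inequality on a time so short that the exponential factor is at most `e` and the
inhomogeneity contributes at most `1`. -/
theorem add_one_le_of_differential_inequality {X X' : ℝ → ℝ} {lam mu A t : ℝ}
    (hmu : 0 ≤ mu) (hX : ∀ s ∈ Icc 0 t, HasDerivWithinAt X (X' s) (Icc 0 t) s)
    (hX' : ∀ s ∈ Icc 0 t, X' s ≤ lam * (X s + 1) + mu) (hlam : 0 ≤ lam) (h1 : lam * t ≤ 1)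
    (h2 : mu * t ≤ 1) (hA : X 0 ≤ A) (h0 : 0 ≤ X 0) :
    ∀ s ∈ Icc 0 t, X s + 1 ≤ Real.exp 1 * (A + 2) := by
  intro s hs
  have hd : ∀ s ∈ Icc 0 t, HasDerivWithinAt
      (fun s => Real.exp (-lam * s) * (X s + 1) - mu * s)
      (Real.exp (-lam * s) * (X' s - lam * (X s + 1)) - mu) (Icc 0 t) s := by
    intro s hs
    have h3 : HasDerivAt (fun s => Real.exp (-lam * s)) (Real.exp (-lam * s) * (-lam)) s := by
      simpa using ((hasDerivAt_id s).const_mul (-lam)).exp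
    have h4 : HasDerivAt (fun s => mu * s) mu s := by
      simpa using (hasDerivAt_id s).const_mul mu
    exact ((h3.hasDerivWithinAt.mul ((hX s hs).add_const 1)).sub
      h4.hasDerivWithinAt).congr_deriv (by ring)
  have hle := le_of_hasDerivWithinAt_nonpos hd (fun s hs => by
    have e1 : Real.exp (-lam * s) ≤ 1 := Real.exp_le_one_iff.2 (by nlinarith [hs.1])
    have e2 := Real.exp_pos (-lam * s)
    have := hX' s hs
    nlinarith) s hs
  simp only [mul_zero, Real.exp_zero, one_mul, sub_zero] at hle
  have hE : Real.exp (lam * s) * Real.exp (-lam * s) = 1 := by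
    rw [← Real.exp_add]; simp
  have hms : mu * s ≤ 1 := (mul_le_mul_of_nonneg_left hs.2 hmu).trans h2
  have hls : Real.exp (lam * s) ≤ Real.exp 1 :=
    Real.exp_le_exp.2 ((mul_le_mul_of_nonneg_left hs.2 hlam).trans h1)
  calc X s + 1 = Real.exp (lam * s) * (Real.exp (-lam * s) * (X s + 1)) := by
        rw [← mul_assoc, hE, one_mul]
    _ ≤ Real.exp (lam * s) * (A + 2) := by
        refine mul_le_mul_of_nonneg_left (by linarith) (Real.exp_pos _).le
    _ ≤ _ := mul_le_mul_of_nonneg_right hls (by linarith)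

theorem regMoment_le_lintegral {p α b : ℝ} (hpα : p < α) (hb : 0 < b) (xs : 𝔼) (ρ : Measure 𝔼)
    [IsFiniteMeasure ρ] (h : ∫⁻ x, ‖x - xs‖ₑ ^ (p - α) ∂ρ ≠ ⊤) :
    regMoment p α b xs ρ ≤ (∫⁻ x, ‖x - xs‖ₑ ^ (p - α) ∂ρ).toReal := by
  rw [regMoment, integral_eq_lintegral_of_nonneg_ae
    (ae_of_all _ fun x => (rpow_pos_of_pos (reg_pos hb (x - xs)) _).le)
    (integrable_reg hpα hb xs ρ).aestronglyMeasurable]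
  refine ENNReal.toReal_mono h (lintegral_mono fun x => ?_)
  rcases eq_or_ne (x - xs) 0 with h0 | h0
  -- At `x = xs` the extended power is `⊤`, so the comparison is trivial there; it would fail with
  -- the real convention for `0` to a negative power.
  · simp only [h0, enorm_zero]
    rw [ENNReal.zero_rpow_of_neg (by linarith)]
    exact le_top
  · rw [← ofReal_norm, ENNReal.ofReal_rpow_of_pos (norm_pos_iff.2 h0)]
    exact ENNReal.ofReal_le_ofReal (reg_rpow_le_norm (by linarith) h0)

theorem exists_regMoment_le_of_small_time [NeZero d] {p α ν γ : ℝ} (hp : 0 < p)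
    (hpα : p < α) (hα2 : α < 2) (hν : 0 < ν) (hγ : 0 < γ) : ∃ K, 0 < K ∧
    ∀ (𝓔 : 𝔼 → ℝ) (xs : 𝔼) (β T : ℝ) (f₀ : Measure 𝔼) (f : ℝ → Measure 𝔼),
    IsWeakSolution 𝓔 xs p α ν γ β T f₀ f → ∀ b : ℝ, 1 ≤ b → ∀ t ∈ Icc 0 T, ∀ η M : ℝ, 0 ≤ η →
    (∀ s ∈ Icc 0 t, ‖consensusPoint 𝓔 β (f s) - xs‖ ≤ η) → regMoment p α b xs f₀ ≤ M →
    K * (η * b + η ^ α * b ^ α) * t ≤ 1 → K * b ^ (α - p) * t ≤ 1 →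
    ∀ s ∈ Icc 0 t, regMoment p α b xs (f s) ≤ Real.exp 1 * (K * M + 2) := by
  obtain ⟨K, hK, hineq⟩ := exists_differential_inequality_regMoment (d := d) hp hpα hα2 hν hγ
  refine ⟨K, hK, fun 𝓔 xs β T f₀ f h b hb t ht η M hη hw hM h1 h2 => ?_⟩
  have hb0 : 0 < b := by linarith
  have hα : 0 < α := by linarith
  obtain ⟨X, X', hX⟩ := hineq 𝓔 xs β T f₀ f h b hb
  have hsub : Icc 0 t ⊆ Icc 0 T := Icc_subset_Icc_right ht.2
  have h0 : (0 : ℝ) ∈ Icc 0 t := ⟨le_rfl, ht.1⟩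
  intro s hs
  refine ((hX s (hsub hs)).2.2.1).trans (add_one_le_of_differential_inequality
    (by positivity) (fun s hs => (hX s (hsub hs)).1.mono hsub) (fun s hs => ?_)
    (by positivity) h1 h2 ?_ (hX 0 (hsub h0)).2.2.2.1 s hs)
  · refine ((hX s (hsub hs)).2.1).trans ?_
    have e1 := hw s hs
    have e2 := (hX s (hsub hs)).2.2.1
    have e3 : (‖consensusPoint 𝓔 β (f s) - xs‖ * b +
        ‖consensusPoint 𝓔 β (f s) - xs‖ ^ α * b ^ α) * regMoment p α b xs (f s) ≤
        (η * b + η ^ α * b ^ α) * (X s + 1) :=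
      mul_le_mul (by gcongr) e2 (regMoment_nonneg hb0 _ _) (by positivity)
    have := mul_le_mul_of_nonneg_left e3 hK.le
    linarith
  · refine ((hX 0 (hsub h0)).2.2.2.2).trans ?_
    rw [h.initial]
    gcongr

/-- For given `t` the inner scale is `b = 1 / (k t^(1/α))`. Then `b^(-α) = k^α t`, so the truncation
error at time `0` is a small multiple of `t`, while `b^α t = k^(-α)` is bounded, so for small `η`
the negative moment cannot grow much on `[0, t]`. This gives `V(t) ≤ V₀ (1 - (1-θ) C t)`, and `1 - x
≤ e^{-x}`. -/
theorem exists_Vmoment_le_of_small_time [NeZero d] {p α ν γ : ℝ} (hp : 1 < p) (hpα : p < α)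
    (hα2 : α < 2) (hν : 0 < ν) (hγ : 0 < γ) (hC : 0 < Cconst d p α ν γ) {xs : 𝔼}
    {f₀ : Measure 𝔼} [IsFiniteMeasure f₀] (hV₀ : 0 < Vmoment p xs f₀)
    (hM : ∫⁻ x, ‖x - xs‖ₑ ^ (p - α) ∂f₀ ≠ ⊤) {θ : ℝ} (hθ : 0 < θ) (hθ1 : θ < 1) :
    ∃ t₀ η σ : ℝ, 0 < t₀ ∧ 0 < η ∧ 0 < σ ∧
      ∀ (𝓔 : 𝔼 → ℝ) (β T : ℝ) (f : ℝ → Measure 𝔼), IsWeakSolution 𝓔 xs p α ν γ β T f₀ f →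
      (∀ t ∈ Icc 0 T,
        |Vmoment p xs (f t) - Vmoment p xs f₀ * Real.exp (-Cconst d p α ν γ * t)| ≤ σ ∧
        ‖consensusPoint 𝓔 β (f t) - xs‖ ≤ η) →
      ∀ t ∈ Icc 0 T, t ≤ t₀ → Vmoment p xs (f t) ≤
        Vmoment p xs f₀ * Real.exp (-(1 - θ) * Cconst d p α ν γ * t) := by
  have hp0 : 0 < p := by linarith
  have hα : 1 < α := by linarith
  have hα0 : 0 < α := by linarith
  obtain ⟨K₁, hK₁, hineq⟩ := exists_differential_inequality_Vmoment (d := d) hp hpα hα2 hν hγ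
  obtain ⟨K₂, hK₂, hreg⟩ := exists_regMoment_le_of_small_time (d := d) hp0 hpα hα2 hν hγ
  set C := Cconst d p α ν γ with hCdef
  set V₀ := Vmoment p xs f₀ with hV₀def
  set M := (∫⁻ x, ‖x - xs‖ₑ ^ (p - α) ∂f₀).toReal with hMdef
  have hM0 : 0 ≤ M := ENNReal.toReal_nonneg
  -- The slack in the decay rate at time `0`. Eighths of it are spent below: five in the derivative
  -- of `W`, one on `W 0`, one on `κ`, so that less than `c` is used.
  set c := C * V₀ * θ with hc
  have hc0 : 0 < c := by positivity
  set J := Real.exp 1 * (K₂ * M + 2) with hJ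
  have hJ0 : 0 ≤ J := by positivity
  obtain ⟨k, hk, hk1⟩ : ∃ k : ℝ, 0 < k ∧ K₁ * (k ^ α * M) ≤ c / 8 := by
    refine ⟨(c / (8 * K₁ * (M + 1))) ^ α⁻¹, by positivity, ?_⟩
    rw [← rpow_mul (by positivity), inv_mul_cancel₀ hα0.ne', rpow_one, div_mul_eq_mul_div,
      mul_div_assoc', div_le_iff₀ (by positivity)]
    nlinarith [mul_pos hK₁ hc0]
  -- The bound `c / (8 K₁)` serves the derivative of `W`; the bound `1`, with the term `K₂ k^(-α)`,
  -- serves the growth condition for the negative moment.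
  obtain ⟨η, hη, hη1, hηJ⟩ := exists_pos_mul_add_rpow_le hα0
    (show 0 < min (c / (8 * K₁)) 1 by positivity) 0
    (1 + 2 * V₀ + J + 2 * (K₂ * k ^ (-α))) one_pos
  have hη2 := hηJ.trans (min_le_left _ _)
  have hη3 := hηJ.trans (min_le_right _ _)
  have hηα : 0 < η ^ α := rpow_pos_of_pos hη α
  have hkα : 0 < k ^ (-α) := rpow_pos_of_pos hk _
  have hevent : ∀ᶠ t : ℝ in 𝓝 0, k * t ^ α⁻¹ < 1 ∧ K₁ * (k ^ p * t ^ (p / α)) < c / 8 ∧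
      K₂ * (k ^ (p - α) * t ^ (p / α)) < 1 ∧ K₂ * (k⁻¹ * t ^ (1 - α⁻¹)) < 1 / 2 ∧
      C * t < θ / 8 := by
    have lim : ∀ (A r : ℝ), 0 < r → Tendsto (fun t : ℝ => A * t ^ r) (𝓝 0) (𝓝 0) := by
      intro A r hr
      have h1 := ((continuousAt_rpow_const (0 : ℝ) r (Or.inr hr.le)).tendsto).const_mul A
      rwa [zero_rpow hr.ne', mul_zero] at h1
    have hαinv : α⁻¹ < 1 := inv_lt_one_of_one_lt₀ hα
    have l1 := lim k α⁻¹ (by positivity)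
    have l2 := lim (K₁ * k ^ p) (p / α) (by positivity)
    have l3 := lim (K₂ * k ^ (p - α)) (p / α) (by positivity)
    have l4 := lim (K₂ * k⁻¹) (1 - α⁻¹) (by linarith)
    have l5 := lim C 1 one_pos
    simp_rw [rpow_one] at l5
    filter_upwards [l1.eventually (gt_mem_nhds one_pos),
      l2.eventually (gt_mem_nhds (show 0 < c / 8 by linarith)),
      l3.eventually (gt_mem_nhds one_pos), l4.eventually (gt_mem_nhds one_half_pos),
      l5.eventually (gt_mem_nhds (show 0 < θ / 8 by linarith))] with t h1 h2 h3 h4 h5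
    exact ⟨h1, by linarith, by linarith, by linarith, h5⟩
  obtain ⟨δ, hδ, hball⟩ := Metric.eventually_nhds_iff_ball.1 hevent
  -- This `σ`, with `C t < θ / 8`, keeps `V ≥ V₀ (1 - θ/4)` on `[0, t]`, so replacing `V` by `V₀` in
  -- the rate costs two of the eighths.
  refine ⟨δ / 2, η, V₀ * θ / 8, by linarith, hη, by positivity,
    fun 𝓔 β T f h hcl t ht htδ => ?_⟩
  rcases eq_or_lt_of_le ht.1 with h0 | h0
  · rw [← h0, h.initial]; simp [hV₀def]
  obtain ⟨b1, b2, b3, b4, b5⟩ := hball t (by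
    rw [mem_ball_zero_iff, norm_of_nonneg h0.le]; linarith)
  have hu : 0 < k * t ^ α⁻¹ := by positivity
  set b := (k * t ^ α⁻¹)⁻¹ with hb
  have hb1 : 1 ≤ b := (one_le_inv₀ hu).2 b1.le
  have hb0 : 0 < b := by linarith
  have hpow : ∀ r : ℝ, b ^ (-r) = k ^ r * t ^ (r / α) := by
    intro r
    rw [hb, inv_rpow hu.le, rpow_neg hu.le, inv_inv, mul_rpow hk.le (by positivity),
      ← rpow_mul h0.le, inv_mul_eq_div]
  have hsub : Icc 0 t ⊆ Icc 0 T := Icc_subset_Icc_right ht.2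
  have hJb : ∀ s ∈ Icc 0 t, regMoment p α b xs (f s) ≤ J := by
    refine hreg 𝓔 xs β T f₀ f h b hb1 t ht η M hη.le (fun s hs => (hcl s (hsub hs)).2)
      (regMoment_le_lintegral hpα hb0 xs f₀ hM) ?_ ?_
    · have e1 : b * t = k⁻¹ * t ^ (1 - α⁻¹) := by
        rw [hb, mul_inv, ← rpow_neg h0.le, mul_assoc, ← rpow_add_one h0.ne']
        congr 2; ring
      have e2 : b ^ α * t = k ^ (-α) := by
        have := hpow (-α)
        rw [neg_neg] at this
        rw [this, mul_assoc, neg_div, div_self hα0.ne', ← rpow_add_one h0.ne']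
        simp
      have e3 : K₂ * (η * b + η ^ α * b ^ α) * t = η * (K₂ * (b * t)) + η ^ α * (K₂ * (b ^ α * t)) := by
        ring
      rw [e3, e1, e2]
      have e4 : η * (K₂ * (k⁻¹ * t ^ (1 - α⁻¹))) ≤ 1 * (1 / 2) :=
        mul_le_mul hη1 b4.le (by positivity) zero_le_one
      have e5 : 0 ≤ η ^ α * (1 + 2 * V₀ + J) + η * (1 + 2 * V₀ + J + 2 * (K₂ * k ^ (-α))) := by
        positivity
      linarith
    · have e1 : K₂ * b ^ (α - p) * t = K₂ * (k ^ (p - α) * t ^ (p / α)) := by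
        have := hpow (p - α)
        rw [neg_sub] at this
        rw [this, mul_assoc, mul_assoc, ← rpow_add_one h0.ne', sub_div, div_self hα0.ne',
          sub_add_cancel]
      rw [e1]; exact b3.le
  -- `κ` may depend on `t`, because it enters no other constant.
  set κ := min (c / 8) (c / 8 * t) with hκ
  have hκ0 : 0 < κ := by positivity
  obtain ⟨W, W', hW⟩ := hineq 𝓔 xs β T f₀ f h b hb1 κ hκ0
  have hVs : ∀ s ∈ Icc 0 t, V₀ * (1 - θ / 4) ≤ Vmoment p xs (f s) ∧ Vmoment p xs (f s) ≤ 2 * V₀ := by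
    intro s hs
    have e1 := abs_le.1 (hcl s (hsub hs)).1
    have e2 : Real.exp (-C * s) ≤ 1 := Real.exp_le_one_iff.2 (by nlinarith [hs.1])
    have e3 : 1 - θ / 8 ≤ Real.exp (-C * s) := by
      have := Real.one_sub_le_exp_neg (C * s)
      rw [← neg_mul] at this
      have : C * s ≤ C * t := mul_le_mul_of_nonneg_left hs.2 hC.le
      linarith
    have e4 := mul_le_mul_of_nonneg_left e2 hV₀.le
    have e5 := mul_le_mul_of_nonneg_left e3 hV₀.le
    have e6 : V₀ * θ ≤ V₀ * 1 := mul_le_mul_of_nonneg_left hθ1.le hV₀.le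
    constructor <;> linarith [e1.1, e1.2]
  have hW' : ∀ s ∈ Icc 0 t, W' s + (C * V₀ - 5 / 8 * c) ≤ 0 := by
    intro s hs
    obtain ⟨v1, v2⟩ := hVs s hs
    have e1 := (abs_le.1 (hW s (hsub hs)).2.1).2
    have e2 := (hcl s (hsub hs)).2
    have c1 : ‖consensusPoint 𝓔 β (f s) - xs‖ * (1 + Vmoment p xs (f s)) ≤ η * (1 + 2 * V₀) :=
      mul_le_mul e2 (by linarith) (by linarith [Vmoment_nonneg p xs (f s)]) hη.le
    have c2 : (‖consensusPoint 𝓔 β (f s) - xs‖ + ‖consensusPoint 𝓔 β (f s) - xs‖ ^ α) *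
        regMoment p α b xs (f s) ≤ (η + η ^ α) * J :=
      mul_le_mul (add_le_add e2 (rpow_le_rpow (norm_nonneg _) e2 hα0.le)) (hJb s hs)
        (regMoment_nonneg hb0 _ _) (by positivity)
    have c3 : K₁ * (η * (1 + 2 * V₀) + (η + η ^ α) * J) ≤ c / 8 := by
      have : η * (1 + 2 * V₀) + (η + η ^ α) * J ≤ c / (8 * K₁) := by
        have : 0 ≤ η ^ α * (1 + 2 * V₀) + (η + η ^ α) * (2 * (K₂ * k ^ (-α))) := by positivity
        linarith
      refine (mul_le_mul_of_nonneg_left this hK₁.le).trans (le_of_eq ?_)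
      field_simp
    have c4 := mul_le_mul_of_nonneg_left (add_le_add c1 c2) hK₁.le
    have c5 : K₁ * b ^ (-p) ≤ c / 8 := by rw [hpow]; exact b2.le
    have c6 := mul_le_mul_of_nonneg_left v1 hC.le
    have c7 : κ ≤ c / 8 := min_le_left _ _
    linarith
  have hmono := le_of_hasDerivWithinAt_nonpos (g := fun s => W s + (C * V₀ - 5 / 8 * c) * s)
    (g' := fun s => W' s + (C * V₀ - 5 / 8 * c)) (t := t) (fun s hs => by
      have h4 : HasDerivAt (fun s => (C * V₀ - 5 / 8 * c) * s) (C * V₀ - 5 / 8 * c) s := by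
        simpa using (hasDerivAt_id s).const_mul (C * V₀ - 5 / 8 * c)
      exact ((hW s (hsub hs)).1.mono hsub).add h4.hasDerivWithinAt) hW' t ⟨h0.le, le_rfl⟩
  simp only [mul_zero, add_zero] at hmono
  have hW0 : W 0 ≤ V₀ + c / 8 * t := by
    have e1 := (hW 0 ⟨le_rfl, ht.1.trans ht.2⟩).2.2.2
    rw [h.initial] at e1
    have e2 : b ^ (-α) * regMoment p α b xs f₀ ≤ k ^ α * t * M := by
      rw [hpow, div_self hα0.ne', rpow_one]
      exact mul_le_mul_of_nonneg_left (regMoment_le_lintegral hpα hb0 xs f₀ hM) (by positivity)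
    have e3 := mul_le_mul_of_nonneg_left e2 hK₁.le
    have e4 := mul_le_mul_of_nonneg_right hk1 h0.le
    linarith
  have hfin := (hW t ht).2.2.1
  have hκt : κ ≤ c / 8 * t := min_le_right _ _
  have hlin : Vmoment p xs (f t) ≤ V₀ * (1 - (1 - θ) * C * t) := by
    have : 0 < c * t := by positivity
    have e : V₀ * (1 - (1 - θ) * C * t) = V₀ - C * V₀ * t + c * t := by rw [hc]; ring
    rw [e]; linarith
  refine hlin.trans (mul_le_mul_of_nonneg_left ?_ hV₀.le)
  have := Real.one_sub_le_exp_neg ((1 - θ) * C * t)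
  rwa [← neg_mul, ← neg_mul] at this


/-! ### The Wasserstein distance to a Dirac mass -/

/-- Every coupling with a Dirac mass has its second coordinate almost surely equal to `xs`, so all
plans have the same cost. -/
theorem lintegral_edist_rpow_of_mem_transportPlans {p : ℝ} {ρ : Measure 𝔼} {xs : 𝔼}
    {plan : Measure (𝔼 × 𝔼)} (hplan : plan ∈ transportPlans ρ (Measure.dirac xs)) :
    ∫⁻ z, edist z.1 z.2 ^ p ∂plan = ∫⁻ x, edist x xs ^ p ∂ρ := by
  obtain ⟨-, h1, h2⟩ := hplan
  have hae : ∀ᵐ z ∂plan, z.2 = xs := by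
    have h3 : ∀ᵐ y ∂(plan.map Prod.snd), y = xs := by
      rw [h2, ae_dirac_eq]; exact rfl
    exact ae_of_ae_map measurable_snd.aemeasurable h3
  have hmeas : Measurable fun x : 𝔼 => edist x xs ^ p := by fun_prop
  rw [← h1, lintegral_map hmeas measurable_fst]
  refine lintegral_congr_ae (hae.mono fun z hz => ?_)
  simp only [hz]

theorem wassersteinDist_dirac_rpow {p : ℝ} (hp : 0 < p) {ρ : Measure 𝔼} [IsProbabilityMeasure ρ]
    {xs : 𝔼} (h : Integrable (fun x => ‖x - xs‖ ^ p) ρ) :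
    wassersteinDist p ρ (Measure.dirac xs) ^ p = ENNReal.ofReal (Vmoment p xs ρ) := by
  have hne : (transportPlans ρ (Measure.dirac xs)).Nonempty :=
    ⟨ρ.prod (Measure.dirac xs), inferInstance, by simp [Measure.map_fst_prod],
      by simp [Measure.map_snd_prod]⟩
  have e : wassersteinDist p ρ (Measure.dirac xs) = (∫⁻ x, edist x xs ^ p ∂ρ) ^ (1 / p) := by
    have : ∀ plan ∈ transportPlans ρ (Measure.dirac xs), (∫⁻ z, edist z.1 z.2 ^ p ∂plan) ^ (1 / p) =
        (∫⁻ x, edist x xs ^ p ∂ρ) ^ (1 / p) := fun plan hplan => by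
      rw [lintegral_edist_rpow_of_mem_transportPlans hplan]
    rw [wassersteinDist, biInf_congr this]
    exact biInf_const hne
  rw [e, ← ENNReal.rpow_mul, one_div, inv_mul_cancel₀ hp.ne', ENNReal.rpow_one, Vmoment,
    ofReal_integral_eq_lintegral_ofReal h (ae_of_all _ fun x => by positivity)]
  refine lintegral_congr fun x => ?_
  rw [edist_eq_enorm_sub, ← ofReal_norm, ENNReal.ofReal_rpow_of_nonneg (norm_nonneg _) hp.le]

/-! ### The time of reaching the prescribed accuracy -/

/-- In dimension `0` the space is a single point and the moment vanishes. -/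
theorem neZero_of_Vmoment_pos {p : ℝ} (hp : 0 < p) {xs : 𝔼} {ρ : Measure 𝔼}
    (h : 0 < Vmoment p xs ρ) : NeZero d := by
  refine ⟨?_⟩
  rintro rfl
  have : ∀ x : EuclideanSpace ℝ (Fin 0), ‖x - xs‖ ^ p = 0 := fun x => by
    rw [Subsingleton.elim x xs, sub_self, norm_zero, zero_rpow hp.ne']
  simp [Vmoment, this] at h

theorem mul_exp_neg_lt {V ε a : ℝ} (hV : 0 < V) (hε : 0 < ε) (h : Real.log (V / ε) < a) :
    V * Real.exp (-a) < ε := by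
  have := Real.exp_lt_exp.2 h
  rw [Real.exp_log (by positivity), div_lt_iff₀ hε] at this
  rw [Real.exp_neg, ← div_eq_mul_inv, div_lt_iff₀ (Real.exp_pos _)]
  linarith

theorem lt_mul_exp_neg {V ε a : ℝ} (hV : 0 < V) (hε : 0 < ε) (h : a < Real.log (V / ε)) :
    ε < V * Real.exp (-a) := by
  have := Real.exp_lt_exp.2 h
  rw [Real.exp_log (by positivity), lt_div_iff₀ hε] at this
  rw [Real.exp_neg, ← div_eq_mul_inv, lt_div_iff₀ (Real.exp_pos _)]
  linarith

/-- From time `t₀` on, the gap between the decays with rates `(1-θ) C` and `C` is at least `V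
e^{-CT} θ C t₀`, by `e^x - 1 ≥ x`, and a uniform error fits into it. -/
theorem mul_exp_add_le {V C θ t₀ t T σ : ℝ} (hV : 0 ≤ V) (hC : 0 ≤ C) (hθ : 0 ≤ θ) (ht₀ : t₀ ≤ t)
    (htT : t ≤ T) (h0 : 0 ≤ t₀) (hσ : σ ≤ V * Real.exp (-C * T) * (θ * C * t₀)) :
    V * Real.exp (-C * t) + σ ≤ V * Real.exp (-(1 - θ) * C * t) := by
  have e1 : Real.exp (-(1 - θ) * C * t) = Real.exp (-C * t) * Real.exp (θ * C * t) := by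
    rw [← Real.exp_add]; congr 1; ring
  have e2 : θ * C * t₀ ≤ Real.exp (θ * C * t) - 1 := by
    have h1 := Real.add_one_le_exp (θ * C * t)
    have h2 : θ * C * t₀ ≤ θ * C * t := by gcongr
    linarith
  have e3 : Real.exp (-C * T) ≤ Real.exp (-C * t) := Real.exp_le_exp.2 (by nlinarith)
  have e4 : V * Real.exp (-C * T) * (θ * C * t₀) ≤
      V * Real.exp (-C * t) * (Real.exp (θ * C * t) - 1) :=
    mul_le_mul (mul_le_mul_of_nonneg_left e3 hV) e2 (by positivity) (by positivity)
  rw [e1]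
  linarith

end

end FracCBO

/-! ### Choice of the parameters and the hitting time -/

theorem mainTheorem1 {d : ℕ} (𝓔 : EuclideanSpace ℝ (Fin d) → ℝ) (xs : EuclideanSpace ℝ (Fin d))
    (h𝓔 : Continuous 𝓔) (hgrowth : FracCBO.GrowthAssumption 𝓔 xs)
    (p α ν γ : ℝ) (hp : 1 < p) (hpα : p < α) (hα : α < 2) (hν : 0 < ν) (hγ : 0 < γ)
    (hνγ : γ ^ α * FracCBO.Bconst d p α < ν * p)
    (f₀ : Measure (EuclideanSpace ℝ (Fin d))) [IsProbabilityMeasure f₀]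
    (hf₀ : Integrable (fun x => ‖x - xs‖ ^ p) f₀) (hsupp : xs ∈ f₀.support)
    (ε θ : ℝ) (hε : ε ∈ Ioo 0 (FracCBO.Vmoment p xs f₀)) (hθ : θ ∈ Ioo (0 : ℝ) 1)
    (m₀ P : ℝ → ℝ) (hm₀ : ∀ r, 0 < r → 0 < m₀ r) (hP : ∀ r, 0 < r → 0 < P r) :
    ∃ β₀ : ℝ, 0 < β₀ ∧ ∀ β : ℝ, β₀ < β →
      ∀ f : ℝ → Measure (EuclideanSpace ℝ (Fin d)),
        FracCBO.IsWeakSolution 𝓔 xs p α ν γ β (FracCBO.Tstar p α ν γ ε θ xs f₀) f₀ f →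
        (∀ r, 0 < r → ∀ t ∈ Icc 0 (FracCBO.Tstar p α ν γ ε θ xs f₀),
          m₀ r * Real.exp (-P r * t) ≤ (f t).real (Metric.ball xs r)) →
        ∃ T ∈ Icc ((1 - θ) / (1 + θ / 2) * FracCBO.Tstar p α ν γ ε θ xs f₀)
            (FracCBO.Tstar p α ν γ ε θ xs f₀),
          FracCBO.Vmoment p xs (f T) = ε ∧
          (∀ t ∈ Icc 0 T, FracCBO.wassersteinDist p (f t) (Measure.dirac xs) ^ p =
            ENNReal.ofReal (FracCBO.Vmoment p xs (f t))) ∧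
          (∫⁻ x, ‖x - xs‖ₑ ^ (p - α) ∂f₀ ≠ ⊤ →
            ∀ t ∈ Icc 0 T, FracCBO.Vmoment p xs (f t) ≤
              FracCBO.Vmoment p xs f₀ *
                Real.exp (-(1 - θ) * FracCBO.Cconst d p α ν γ * t)) := by
  have hp0 : 0 < p := by linarith
  obtain ⟨hε0, hεV⟩ := hε
  obtain ⟨hθ0, hθ1⟩ := hθ
  have hV₀ : 0 < FracCBO.Vmoment p xs f₀ := hε0.trans hεV
  have : NeZero d := FracCBO.neZero_of_Vmoment_pos hp0 hV₀
  set C := FracCBO.Cconst d p α ν γ with hCdef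
  have hC : 0 < C := by rw [hCdef, FracCBO.Cconst]; linarith
  set V₀ := FracCBO.Vmoment p xs f₀ with hV₀def
  set S := FracCBO.Tstar p α ν γ ε θ xs f₀ with hS
  set l := Real.log (V₀ / ε) with hl
  have hl0 : 0 < l := Real.log_pos ((one_lt_div hε0).2 hεV)
  have hCS : C * S = l / (1 - θ) := by
    have : 0 < 1 - θ := by linarith
    change C * (1 / (C * (1 - θ)) * l) = _
    field_simp
  have hS0 : 0 < S := by
    have : 0 < l / (1 - θ) := div_pos hl0 (by linarith)
    rw [← hCS] at this
    exact (mul_pos_iff_of_pos_left hC).1 this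
  set R := (1 - θ) / (1 + θ / 2) * S with hR
  have hCR : C * R = l / (1 + θ / 2) := by
    have : 0 < 1 - θ := by linarith
    calc C * R = (1 - θ) / (1 + θ / 2) * (C * S) := by rw [hR]; ring
      _ = _ := by rw [hCS]; field_simp
  have hR0 : 0 ≤ R := mul_nonneg (div_nonneg (by linarith) (by linarith)) hS0.le
  have hRS : R ≤ S := mul_le_of_le_one_left hS0.le ((div_le_one (by linarith)).2 (by linarith))
  -- The ideal curve `V₀ e^{-Ct}` equals `ε` when `C t = l`. Since `C S = l / (1-θ) > l > l / (1 +
  -- θ/2) = C R`, the two ends of the interval lie strictly on either side of this time.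
  have hVS : V₀ * Real.exp (-C * S) < ε := by
    rw [neg_mul, hCS]
    exact FracCBO.mul_exp_neg_lt hV₀ hε0 ((lt_div_iff₀ (by linarith)).2 (by nlinarith))
  have hVR : ε < V₀ * Real.exp (-C * R) := by
    rw [neg_mul, hCR]
    exact FracCBO.lt_mul_exp_neg hV₀ hε0 ((div_lt_iff₀ (by linarith)).2 (by nlinarith))
  obtain ⟨t₀, η, σ₁, ht₀, hη, hσ₁, hsmall⟩ : ∃ t₀ η σ : ℝ, 0 < t₀ ∧ 0 < η ∧ 0 < σ ∧
      (∫⁻ x, ‖x - xs‖ₑ ^ (p - α) ∂f₀ ≠ ⊤ → ∀ (β : ℝ) (f : ℝ → Measure (EuclideanSpace ℝ (Fin d))),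
        FracCBO.IsWeakSolution 𝓔 xs p α ν γ β S f₀ f →
        (∀ t ∈ Icc 0 S, |FracCBO.Vmoment p xs (f t) - V₀ * Real.exp (-C * t)| ≤ σ ∧
          ‖FracCBO.consensusPoint 𝓔 β (f t) - xs‖ ≤ η) →
        ∀ t ∈ Icc 0 S, t ≤ t₀ → FracCBO.Vmoment p xs (f t) ≤
          V₀ * Real.exp (-(1 - θ) * C * t)) := by
    by_cases hM : ∫⁻ x, ‖x - xs‖ₑ ^ (p - α) ∂f₀ ≠ ⊤
    · obtain ⟨t₀, η, σ, h1, h2, h3, h4⟩ :=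
        FracCBO.exists_Vmoment_le_of_small_time hp hpα hα hν hγ hC hV₀ hM hθ0 hθ1
      exact ⟨t₀, η, σ, h1, h2, h3, fun _ β f => h4 𝓔 β S f⟩
    -- If the negative moment is infinite, the small-time statement is void and any constants do.
    · exact ⟨1, 1, 1, one_pos, one_pos, one_pos, fun h => absurd h hM⟩
  -- The four bounds serve, in this order, the small-time estimate, the exponential bound after
  -- `t₀`, and the position of `V` relative to `ε` at `S` and at `R`.
  obtain ⟨σ, hσ, hσ1, hσ2, hσ3, hσ4⟩ : ∃ σ : ℝ, 0 < σ ∧ σ ≤ σ₁ ∧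
      σ ≤ V₀ * Real.exp (-C * S) * (θ * C * t₀) ∧ σ ≤ ε - V₀ * Real.exp (-C * S) ∧
      σ ≤ V₀ * Real.exp (-C * R) - ε :=
    ⟨min (min σ₁ (V₀ * Real.exp (-C * S) * (θ * C * t₀)))
      (min (ε - V₀ * Real.exp (-C * S)) (V₀ * Real.exp (-C * R) - ε)),
      lt_min (lt_min hσ₁ (by positivity)) (lt_min (by linarith) (by linarith)),
      (min_le_left _ _).trans (min_le_left _ _), (min_le_left _ _).trans (min_le_right _ _),
      (min_le_right _ _).trans (min_le_left _ _), (min_le_right _ _).trans (min_le_right _ _)⟩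
  -- The mass bound is replaced by its value at the final time, its minimum over the horizon, so
  -- that it does not depend on time.
  obtain ⟨β₀, hβ₀, hclose⟩ := FracCBO.exists_forall_abs_Vmoment_sub_le h𝓔 hgrowth hp hpα hα hν hγ
    hC.le hS0.le f₀ (m := fun r => m₀ r * Real.exp (-P r * S))
    (fun r hr => mul_pos (hm₀ r hr) (Real.exp_pos _)) hσ hη
  refine ⟨β₀, hβ₀, fun β hβ f h hmass => ?_⟩
  have hcl := hclose β hβ f h fun r hr t ht => by
    refine le_trans (mul_le_mul_of_nonneg_left (Real.exp_le_exp.2 ?_) (hm₀ r hr).le)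
      (hmass r hr t ht)
    nlinarith [hP r hr, ht.2]
  have hmS : S ∈ Icc 0 S := ⟨hS0.le, le_rfl⟩
  have hmR : R ∈ Icc 0 S := ⟨hR0, hRS⟩
  obtain ⟨T, hT, hVT⟩ : ε ∈ (fun t => FracCBO.Vmoment p xs (f t)) '' Icc R S := by
    refine intermediate_value_Icc' hRS (h.moment_cont.mono (Icc_subset_Icc_left hR0)) ⟨?_, ?_⟩
    · have := (abs_le.1 (hcl S hmS).1).2
      linarith
    · have := (abs_le.1 (hcl R hmR).1).1
      linarith
  have hsub : Icc 0 T ⊆ Icc 0 S := Icc_subset_Icc_right hT.2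
  refine ⟨T, hT, hVT, fun t ht => ?_, fun hM t ht => ?_⟩
  · have := h.prob t (hsub ht)
    exact FracCBO.wassersteinDist_dirac_rpow hp0 (h.moment t (hsub ht))
  · rcases le_total t t₀ with ht' | ht'
    · exact hsmall hM β f h (fun s hs => ⟨(hcl s hs).1.trans hσ1, (hcl s hs).2⟩) t (hsub ht) ht'
    · have := (abs_le.1 (hcl t (hsub ht)).1).2
      have := FracCBO.mul_exp_add_le hV₀.le hC.le hθ0.le ht' (hsub ht).2 ht₀.le hσ2
      linarith
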